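/- Let $\sigma\in\{1,-1\}$, $T>0$, and let $q(x,t)$ be a classical solution on $\mathbb R\times[0,T]$ of the derivative nonlinear Schrödinger equation $$iq_t+q_{xx}-i(rq^2)_x=0,\qquad r=\sigma\bar q,\qquad q(x,0)=q_0(x),$$ such that $q,q_x,q_{xx}$ are continuous and bounded by $C/(1+x^2)$ uniformly in $t\in[0,T]$. (The case $\sigma=-1$ is $iq_t+q_{xx}+i(|q|^2q)_x=0$; the two signs are exchanged by $x\mapsto -x$.) Direct scattering of $q_0$. Put $\sigma_3=\mathrm{diag}(1,-1)$, $e^{w\hat\sigma_3}A=e^{w\sigma_3}Ae^{-w\sigma_3}$, $r_0=\sigma\bar q_0$, $\delta(x)=\frac12\int_{+\infty}^x q_0r_0\,dy$ and $$V_1(x,k)=\begin{pmatrix}-\frac i2 r_0q_0& kq_0e^{-2i\delta}\\ kr_0e^{2i\delta}&\frac i2r_0q_0\end{pmatrix}.$$ Let $\mu_1,\mu_2$ be the bounded continuous solutions of $$\mu_j(x,k)=I+\int_{\pm\infty}^x e^{-ik^2(x-y)\hat\sigma_3}\big(V_1(y,k)\mu_j(y,k)\big)\,dy,$$ with $+\infty$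 for $j=1$ and $-\infty$ for $j=2$; the second column of $\mu_1$ and the first column of $\mu_2$ are defined for $\operatorname{Im}k^2\ge0$, the other two columns for $\operatorname{Im}k^2\le0$. For $k^2\in\mathbb R$ let $S(k)=\mu_1(0,k)^{-1}\mu_2(0,k)$ and $r(k)=S_{21}(k)/S_{11}(k)$. For $\operatorname{Im}k^2\ge0$ let $a(k)$ be the determinant of the matrix formed by the first column of $\mu_2(0,k)$ and the second column of $\mu_1(0,k)$ (so $a=S_{11}$ when $k^2\in\mathbb R$). Assume that $a(k)\neq0$ for all $k$ with $\operatorname{Im}k^2\ge0$. Then $r(k)/k$ depends only on $\lambda=k^2\in\mathbb R\setminus\{0\}$ and extends to a continuous function $\rho$ of $\lambda\in\mathbb R$. For every $x\in\mathbb R$ and $t\in[0,T]$ the following Riemann–Hilbert problem has exactly one solution: find a $2\times2$ matrix function $N(\lambda)=N(x,t,\lambda)$, analytic in $\mathbb C\setminus\mathbb R$, with limits $N_\pm(\lambda)$ at each $\lambda\in\mathbb R$ from the upper ($+$) and lower ($-$) half plane, such that $$N_+(\lambda)=N_-(\lambda)\,e^{-i(\lambda x+2\lambda^2t)\hat\sigma_3}\begin{pmatrix}1-\sigma\lambda|\rho(\lambda)|^2&-\sigma\overline{\rho(\lambda)}\\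 \lambda\rho(\lambda)&1\end{pmatrix},\qquad \lambda\in\mathbb R,$$ and $N(\lambda)\to I$ as $\lambda\to\infty$, $\lambda\notin\mathbb R$. The limit $$\tilde q(x,t)=2i\lim_{\lambda\to\infty,\ \lambda\notin\mathbb R}\lambda N_{12}(x,t,\lambda)$$ exists, $|\tilde q(\cdot,t)|^2$ is integrable on $(x,\infty)$, and $$q(x,t)=\tilde q(x,t)\,\exp\Big(i\sigma\int_{+\infty}^x|\tilde q(y,t)|^2\,dy\Big).$$ -/

import Mathlib

open MeasureTheory Filter Topology Complex
open scoped ComplexConjugate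

noncomputable section

namespace DNLS

/-- `q` is a classical solution on `ℝ × [0,T]` of the derivative nonlinear Schrödinger equation
`i q_t + q_xx - i (r q²)_x = 0`, `r = σ q̄`, with initial value `q₀`: the function and its first
two `x`-derivatives are jointly continuous and decay like `(1 + x²)⁻¹`, uniformly in time.
The first argument of `q` is the position `x`, the second the time `t`. -/
structure IsSolution (σ T : ℝ) (q₀ : ℝ → ℂ) (q : ℝ → ℝ → ℂ) : Prop where
  smooth : ∀ t ∈ Set.Icc 0 T, ContDiff ℝ 2 (fun x => q x t)
  continuousOn : ∀ j ≤ 2, ContinuousOn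
    (fun p : ℝ × ℝ => iteratedDeriv j (fun x => q x p.2) p.1) (Set.univ ×ˢ Set.Icc 0 T)
  decay : ∃ C : ℝ, ∀ j ≤ 2, ∀ t ∈ Set.Icc 0 T, ∀ x : ℝ,
    ‖iteratedDeriv j (fun y => q y t) x‖ ≤ C / (1 + x ^ 2)
  differentiable_time : ∀ x : ℝ, ∀ t ∈ Set.Icc 0 T,
    DifferentiableWithinAt ℝ (fun s => q x s) (Set.Icc 0 T) t
  equation : ∀ x : ℝ, ∀ t ∈ Set.Icc 0 T,
    I * derivWithin (fun s => q x s) (Set.Icc 0 T) t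
      + iteratedDeriv 2 (fun y => q y t) x
      - I * deriv (fun y => (σ * conj (q y t)) * q y t ^ 2) x = 0
  initial : ∀ x : ℝ, q x 0 = q₀ x

/-- `∫_{+∞}^x Δ`, the integral of the one-form `Δ = (1/2) u r dx` with `r = σ ū`. -/
def phase (σ : ℝ) (u : ℝ → ℂ) (x : ℝ) : ℂ :=
  -∫ y in Set.Ioi x, (1 / 2) * u y * (σ * conj (u y))

/-- The coefficient `V₁` of the `x`-part `μ_x + i k² [σ₃, μ] = V₁ μ` of the Lax pair,
for the potential `u` at a fixed time. -/
def V₁ (σ : ℝ) (u : ℝ → ℂ) (k : ℂ) (x : ℝ) : Matrix (Fin 2) (Fin 2) ℂ :=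
  !![-(I / 2) * (σ * conj (u x)) * u x, k * u x * exp (-2 * I * phase σ u x);
     k * (σ * conj (u x)) * exp (2 * I * phase σ u x), (I / 2) * (σ * conj (u x)) * u x]

/-- Diagonal entries of `σ₃ = diag (1, -1)`. -/
def pauli (i : Fin 2) : ℂ := if i = 0 then 1 else -1

/-- `exp (w σ̂₃) A = exp (w σ₃) A exp (-w σ₃)`. -/
def conjExp (w : ℂ) (A : Matrix (Fin 2) (Fin 2) ℂ) : Matrix (Fin 2) (Fin 2) ℂ :=
  Matrix.diagonal (fun i => exp (w * pauli i)) * A * Matrix.diagonal (fun i => exp (-w * pauli i))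

/-- `m` is the `j`-th column of `μ₁`: the bounded continuous solution of the `j`-th column of
`μ₁(x) = 1 + ∫_{+∞}^x e^{-i k² (x - y) σ̂₃} (V₁ μ₁)(y) dy`. -/
def IsJostColumn₁ (σ : ℝ) (u : ℝ → ℂ) (k : ℂ) (j : Fin 2) (m : ℝ → Fin 2 → ℂ) : Prop :=
  Continuous m ∧ (∃ C : ℝ, ∀ x, ‖m x‖ ≤ C) ∧
    ∀ (x : ℝ) (i : Fin 2), m x i = (1 : Matrix (Fin 2) (Fin 2) ℂ) i j -
      ∫ y in Set.Ioi x, exp (-I * k ^ 2 * ((x : ℂ) - y) * (pauli i - pauli j)) *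
        ((V₁ σ u k y).mulVec (m y)) i

/-- `m` is the `j`-th column of `μ₂`: the bounded continuous solution of the `j`-th column of
`μ₂(x) = 1 + ∫_{-∞}^x e^{-i k² (x - y) σ̂₃} (V₁ μ₂)(y) dy`. -/
def IsJostColumn₂ (σ : ℝ) (u : ℝ → ℂ) (k : ℂ) (j : Fin 2) (m : ℝ → Fin 2 → ℂ) : Prop :=
  Continuous m ∧ (∃ C : ℝ, ∀ x, ‖m x‖ ≤ C) ∧
    ∀ (x : ℝ) (i : Fin 2), m x i = (1 : Matrix (Fin 2) (Fin 2) ℂ) i j +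
      ∫ y in Set.Iic x, exp (-I * k ^ 2 * ((x : ℂ) - y) * (pauli i - pauli j)) *
        ((V₁ σ u k y).mulVec (m y)) i

/-- The Jost solution `μ₁`, normalized at `x = +∞`, as a matrix. Its first column is meaningful
for `Im k² ≤ 0` and its second column for `Im k² ≥ 0`. -/
def μ₁ (σ : ℝ) (u : ℝ → ℂ) (k : ℂ) (x : ℝ) : Matrix (Fin 2) (Fin 2) ℂ :=
  Matrix.of fun i j => Classical.epsilon (IsJostColumn₁ σ u k j) x i

/-- The Jost solution `μ₂`, normalized at `x = -∞`, as a matrix. Its first column is meaningful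
for `Im k² ≥ 0` and its second column for `Im k² ≤ 0`. -/
def μ₂ (σ : ℝ) (u : ℝ → ℂ) (k : ℂ) (x : ℝ) : Matrix (Fin 2) (Fin 2) ℂ :=
  Matrix.of fun i j => Classical.epsilon (IsJostColumn₂ σ u k j) x i

/-- The scattering matrix, for `k² ∈ ℝ`: the value at `x = 0`, `t = 0` of the relation
`μ₂ = μ₁ e^{-i (k² x + 2 k⁴ t) σ̂₃} S(k)`. -/
def S (σ : ℝ) (u : ℝ → ℂ) (k : ℂ) : Matrix (Fin 2) (Fin 2) ℂ :=
  (μ₁ σ u k 0)⁻¹ * μ₂ σ u k 0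

/-- The function `a(k) = det (μ₂⁽¹⁾, μ₁⁽²⁾)` on the closed region `Im k² ≥ 0`, that is,
the continuation of the entry `S₁₁` from `k² ∈ ℝ` to this region. -/
def a (σ : ℝ) (u : ℝ → ℂ) (k : ℂ) : ℂ :=
  μ₂ σ u k 0 0 0 * μ₁ σ u k 0 1 1 - μ₂ σ u k 0 1 0 * μ₁ σ u k 0 0 1

/-- The reflection coefficient `r(k) = b(k) / a(k) = S₂₁ / S₁₁`, for `k² ∈ ℝ`. -/
def r (σ : ℝ) (u : ℝ → ℂ) (k : ℂ) : ℂ := S σ u k 1 0 / S σ u k 0 0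

/-- The matrix `J_N`. -/
def JN (σ : ℝ) (ρ : ℝ → ℂ) (l : ℝ) : Matrix (Fin 2) (Fin 2) ℂ :=
  !![1 - σ * l * (‖ρ l‖ : ℂ) ^ 2, -σ * conj (ρ l); l * ρ l, 1]

/-- `N` solves the Riemann–Hilbert problem on the real line with parameters `(x, t)`: it is
analytic off `ℝ`, has boundary values from the upper (`+`) and lower (`-`) half plane at every
real point, related by `N₊ = N₋ e^{-i (l x + 2 l² t) σ̂₃} J_N`, and tends to the identity
at infinity. The values of `N` on `ℝ` play no role. -/
structure IsRHSolution (σ : ℝ) (ρ : ℝ → ℂ) (x t : ℝ) (N : ℂ → Matrix (Fin 2) (Fin 2) ℂ) :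
    Prop where
  analytic : ∀ i j, DifferentiableOn ℂ (fun z => N z i j) {z | z.im ≠ 0}
  jump : ∀ l : ℝ, ∃ Nplus Nminus : Matrix (Fin 2) (Fin 2) ℂ,
    Tendsto N (𝓝[{z | 0 < z.im}] (l : ℂ)) (𝓝 Nplus) ∧
    Tendsto N (𝓝[{z | z.im < 0}] (l : ℂ)) (𝓝 Nminus) ∧
    Nplus = Nminus * conjExp (-I * (l * x + 2 * l ^ 2 * t)) (JN σ ρ l)
  infinity : Tendsto N (cocompact ℂ ⊓ 𝓟 {z | z.im ≠ 0}) (𝓝 1)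

end DNLS

end

/-!
The gauge transformation `q̃ = q e^{-2iδ}` turns the spectral problem into one whose Jost columns
depend, up to a factor `k`, on `λ = k²` only; they are the fixed points of Volterra operators which
depend continuously on `(t, λ)` and holomorphically on `λ` in the upper half plane, and integrating
by parts, which uses `q_x` and `q_xx`, yields their asymptotics as `λ → ∞`. The zero curvature
equation makes the Wronskian `a` independent of `t` and multiplies `b` by `e^{4iλ²t}`. The
Riemann–Hilbert problem is then solved explicitly: in the upper half plane by the Jost column
normalized at `-∞` divided by `a`, next to the Jost column normalized at `+∞`, and in the lower half
plane by their Schwarz reflections. Its jump condition is the linear relation between the columns on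
the real line. Uniqueness is Liouville's theorem: the quotient of two solutions has no jump, hence
is entire by Morera's theorem, and it tends to the identity at infinity. Finally the coefficient of
`1/λ` in the solution is `q̃ / 2i`, and `|q̃| = |q|` inverts the gauge transformation.
-/

open scoped BoundedContinuousFunction

noncomputable section

namespace DNLS

section HolomorphicOffRealLine

variable {E : Type*} [NormedAddCommGroup E] [NormedSpace ℂ E] [CompleteSpace E]

theorem differentiable_of_continuous_of_differentiableOn_im_ne_zero {f : ℂ → E}
    (hf : Continuous f) (hd : DifferentiableOn ℂ f {z | z.im ≠ 0}) : Differentiable ℂ f := by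
  have integral_rect_eq_zero (z w : ℂ) (h : 0 ∉ Set.Ioo (min z.im w.im) (max z.im w.im)) :
      wedgeIntegral z w f + wedgeIntegral w z f = 0 := by
    rw [wedgeIntegral_add_wedgeIntegral_eq]
    refine integral_boundary_rect_eq_zero_of_continuousOn_of_differentiableOn f z w
      hf.continuousOn (hd.mono fun v hv => ?_)
    exact ne_of_mem_of_not_mem hv.2 h
  rw [← differentiableOn_univ]
  refine (isConservativeOn_and_continuousOn_iff_isDifferentiableOn isOpen_univ).1
    ⟨fun z w _ => ?_, hf.continuousOn⟩
  rw [← add_eq_zero_iff_eq_neg]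
  -- The real line cuts the rectangle into two, neither of which meets it in its interior.
  have lower := integral_rect_eq_zero z (w.re : ℂ) (by grind [Complex.ofReal_im])
  have upper := integral_rect_eq_zero (z.re : ℂ) w (by grind [Complex.ofReal_im])
  rw [wedgeIntegral_add_wedgeIntegral_eq] at lower upper ⊢
  have intervalIntegrable_side (a c d : ℝ) :
      IntervalIntegrable (fun y : ℝ => f (a + y * I)) volume c d :=
    Continuous.intervalIntegrable (by fun_prop) _ _
  have right := intervalIntegral.integral_add_adjacent_intervals
    (intervalIntegrable_side w.re z.im 0) (intervalIntegrable_side w.re 0 w.im)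
  have left := intervalIntegral.integral_add_adjacent_intervals
    (intervalIntegrable_side z.re z.im 0) (intervalIntegrable_side z.re 0 w.im)
  simp only [ofReal_re, ofReal_im, ofReal_zero, zero_mul, add_zero] at *
  rw [← right, ← left]
  linear_combination (norm := module) lower + upper

theorem dense_im_ne_zero : Dense {z : ℂ | z.im ≠ 0} :=
  (dense_compl_singleton (0 : ℝ)).preimage Complex.isOpenMap_im

theorem tendsto_cocompact_of_tendsto_inf_principal {X Y : Type*} [TopologicalSpace X] [T2Space X]
    [TopologicalSpace Y] [RegularSpace Y] {A : Set X} (hA : Dense A) {g : X → Y}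
    (hg : Continuous g) {c : Y} (h : Tendsto g (cocompact X ⊓ 𝓟 A) (𝓝 c)) :
    Tendsto g (cocompact X) (𝓝 c) := by
  refine (closed_nhds_basis c).tendsto_right_iff.2 fun V ⟨hV, hVclosed⟩ => ?_
  obtain ⟨K, hK, hKV⟩ := mem_cocompact.1 (eventually_inf_principal.1 (h hV))
  refine mem_cocompact.2 ⟨K, hK, fun x hx => ?_⟩
  have hsub : Kᶜ ∩ A ⊆ g ⁻¹' V := fun y hy => hKV hy.1 hy.2
  exact (hVclosed.preimage hg).closure_subset_iff.2 hsub
    (hA.open_subset_closure_inter hK.isClosed.isOpen_compl hx)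

theorem eq_const_of_no_jump {H : ℂ → E} {c : E} (hd : DifferentiableOn ℂ H {z | z.im ≠ 0})
    (hjump : ∀ l : ℝ, ∃ h, Tendsto H (𝓝[{z | 0 < z.im}] (l : ℂ)) (𝓝 h) ∧
      Tendsto H (𝓝[{z | z.im < 0}] (l : ℂ)) (𝓝 h))
    (hinf : Tendsto H (cocompact ℂ ⊓ 𝓟 {z | z.im ≠ 0}) (𝓝 c)) {z : ℂ} (hz : z.im ≠ 0) :
    H z = c := by
  set A : Set ℂ := {z | z.im ≠ 0}
  have hlim (z : ℂ) : ∃ y, Tendsto H (𝓝[A] z) (𝓝 y) := by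
    by_cases hz : z.im = 0
    · obtain ⟨h, hupper, hlower⟩ := hjump z.re
      rw [show (z.re : ℂ) = z from Complex.ext rfl hz.symm] at hupper hlower
      have hsplit : A = {z : ℂ | 0 < z.im} ∪ {z | z.im < 0} := by
        ext z; exact ne_iff_lt_or_gt.trans or_comm
      rw [hsplit, nhdsWithin_union]
      exact ⟨h, hupper.sup hlower⟩
    · exact ⟨H z, (hd z hz).continuousWithinAt⟩
  have hcont : Continuous (extendFrom A H) := continuous_extendFrom dense_im_ne_zero hlim
  have heq : Set.EqOn (extendFrom A H) H A := fun z hz =>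
    extendFrom_eq (subset_closure hz) (hd z hz).continuousWithinAt
  have hentire : Differentiable ℂ (extendFrom A H) :=
    differentiable_of_continuous_of_differentiableOn_im_ne_zero hcont (hd.congr heq)
  rw [← heq hz]
  refine hentire.apply_eq_of_tendsto_cocompact z
    (tendsto_cocompact_of_tendsto_inf_principal dense_im_ne_zero hcont (hinf.congr' ?_))
  exact eventually_inf_principal.2 (.of_forall fun v hv => (heq hv).symm)

end HolomorphicOffRealLine

theorem det_conjExp (w : ℂ) (A : Matrix (Fin 2) (Fin 2) ℂ) : (conjExp w A).det = A.det := by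
  have hinv (i : Fin 2) : exp (w * pauli i) * exp (-w * pauli i) = 1 := by
    rw [← Complex.exp_add, neg_mul, add_neg_cancel, Complex.exp_zero]
  rw [conjExp, Matrix.det_mul_right_comm, Matrix.diagonal_mul_diagonal]
  simp_rw [hinv, Matrix.diagonal_one, one_mul]

theorem det_JN (σ : ℝ) (ρ : ℝ → ℂ) (l : ℝ) : (JN σ ρ l).det = 1 := by
  simp only [JN, Matrix.det_fin_two_of]
  linear_combination (σ : ℂ) * l * Complex.conj_mul' (ρ l)

namespace IsRHSolution

variable {σ : ℝ} {ρ : ℝ → ℂ} {x t : ℝ} {N N' : ℂ → Matrix (Fin 2) (Fin 2) ℂ}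

theorem det_eq_one (hN : IsRHSolution σ ρ x t N) {z : ℂ} (hz : z.im ≠ 0) : (N z).det = 1 := by
  have hdet : Continuous fun M : Matrix (Fin 2) (Fin 2) ℂ => M.det := continuous_id.matrix_det
  refine eq_const_of_no_jump (H := fun z => (N z).det) ?_ (fun l => ?_) ?_ hz
  · simp only [Matrix.det_fin_two]
    exact ((hN.analytic 0 0).mul (hN.analytic 1 1)).sub ((hN.analytic 0 1).mul (hN.analytic 1 0))
  · obtain ⟨P, M, hP, hM, hPM⟩ := hN.jump l
    have hdetPM : P.det = M.det := by rw [hPM, Matrix.det_mul, det_conjExp, det_JN, mul_one]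
    exact ⟨P.det, (hdet.tendsto P).comp hP, hdetPM ▸ (hdet.tendsto M).comp hM⟩
  · exact Matrix.det_one (n := Fin 2) (R := ℂ) ▸ (hdet.tendsto 1).comp hN.infinity

theorem differentiableOn_mul_adjugate (hN : IsRHSolution σ ρ x t N) (hN' : IsRHSolution σ ρ x t N')
    (i j : Fin 2) : DifferentiableOn ℂ (fun z => (N z * (N' z).adjugate) i j) {z | z.im ≠ 0} := by
  have hadj (i j : Fin 2) : DifferentiableOn ℂ (fun z => (N' z).adjugate i j) {z | z.im ≠ 0} := by
    simp only [Matrix.adjugate_fin_two]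
    fin_cases i <;> fin_cases j
    exacts [hN'.analytic 1 1, (hN'.analytic 0 1).neg, (hN'.analytic 1 0).neg, hN'.analytic 0 0]
  simp only [Matrix.mul_apply, Fin.sum_univ_two]
  exact ((hN.analytic i 0).mul (hadj 0 j)).add ((hN.analytic i 1).mul (hadj 1 j))

theorem mul_adjugate_eq_one (hN : IsRHSolution σ ρ x t N) (hN' : IsRHSolution σ ρ x t N') {z : ℂ}
    (hz : z.im ≠ 0) : N z * (N' z).adjugate = 1 := by
  have tendsto_mul_adjugate {F : Filter ℂ} {P P' : Matrix (Fin 2) (Fin 2) ℂ}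
      (h : Tendsto N F (𝓝 P)) (h' : Tendsto N' F (𝓝 P')) :
      Tendsto (fun z => N z * (N' z).adjugate) F (𝓝 (P * P'.adjugate)) :=
    h.mul ((continuous_id.matrix_adjugate.tendsto P').comp h')
  ext i j
  refine eq_const_of_no_jump (H := fun z => (N z * (N' z).adjugate) i j)
    (hN.differentiableOn_mul_adjugate hN' i j) (fun l => ?_) ?_ hz
  · obtain ⟨P, M, hP, hM, hPM⟩ := hN.jump l
    obtain ⟨P', M', hP', hM', hPM'⟩ := hN'.jump l
    have hno_jump : P * P'.adjugate = M * M'.adjugate := by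
      rw [hPM, hPM', Matrix.adjugate_mul_distrib, Matrix.mul_assoc,
        ← Matrix.mul_assoc (conjExp _ _), Matrix.mul_adjugate, det_conjExp, det_JN, one_smul,
        Matrix.one_mul]
    have hplus := (tendsto_mul_adjugate hP hP').apply_nhds i |>.apply_nhds j
    have hminus := (tendsto_mul_adjugate hM hM').apply_nhds i |>.apply_nhds j
    exact ⟨_, hplus, hno_jump ▸ hminus⟩
  · simpa only [Matrix.adjugate_one, mul_one] using
      (tendsto_mul_adjugate hN.infinity hN'.infinity).apply_nhds i |>.apply_nhds j

theorem unique (hN : IsRHSolution σ ρ x t N) (hN' : IsRHSolution σ ρ x t N') {z : ℂ}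
    (hz : z.im ≠ 0) : N z = N' z :=
  calc N z = N z * ((N' z).adjugate * N' z) := by
        rw [Matrix.adjugate_mul, hN'.det_eq_one hz, one_smul, mul_one]
    _ = N' z := by rw [← mul_assoc, hN.mul_adjugate_eq_one hN' hz, one_mul]

end IsRHSolution

section QuadraticDecay

variable {E : Type*} [NormedAddCommGroup E]

/-- The decay `|φ x| ≤ C / (1 + x²)` which the potentials and their derivatives have. -/
def QuadraticDecay (C : ℝ) (φ : ℝ → E) : Prop := ∀ x, ‖φ x‖ ≤ C * (1 + x ^ 2)⁻¹

theorem inv_one_add_sq_le_one (x : ℝ) : (1 + x ^ 2)⁻¹ ≤ 1 :=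
  inv_le_one_of_one_le₀ (by nlinarith [sq_nonneg x])

theorem tendsto_inv_one_add_sq_cocompact :
    Tendsto (fun x : ℝ => (1 + x ^ 2)⁻¹) (cocompact ℝ) (𝓝 0) := by
  have hsq : Tendsto (fun x : ℝ => x ^ 2) (cocompact ℝ) atTop := by
    simpa only [Real.norm_eq_abs, Function.comp_def, sq_abs] using
      (tendsto_pow_atTop (two_ne_zero (α := ℕ))).comp (tendsto_norm_cocompact_atTop (E := ℝ))
  exact tendsto_inv_atTop_zero.comp (tendsto_atTop_add_const_left _ _ hsq)

namespace QuadraticDecay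

variable {C : ℝ} {φ : ℝ → E}

theorem nonneg (h : QuadraticDecay C φ) : 0 ≤ C := by
  simpa using (norm_nonneg _).trans (h 0)

theorem norm_le (h : QuadraticDecay C φ) (x : ℝ) : ‖φ x‖ ≤ C :=
  (h x).trans (mul_le_of_le_one_right h.nonneg (inv_one_add_sq_le_one x))

theorem integrable (h : QuadraticDecay C φ) (hφ : AEStronglyMeasurable φ) : Integrable φ :=
  (integrable_inv_one_add_sq.const_mul C).mono' hφ (ae_of_all _ h)

theorem tendsto_cocompact (h : QuadraticDecay C φ) : Tendsto φ (cocompact ℝ) (𝓝 0) :=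
  squeeze_zero_norm h (by simpa using tendsto_inv_one_add_sq_cocompact.const_mul C)

theorem comp_neg (h : QuadraticDecay C φ) : QuadraticDecay C fun x => φ (-x) := fun x => by
  simpa using h (-x)

theorem mono {C' : ℝ} (h : QuadraticDecay C φ) (hC : C ≤ C') : QuadraticDecay C' φ :=
  fun x => (h x).trans (mul_le_mul_of_nonneg_right hC (by positivity))

theorem add {D : ℝ} {ψ : ℝ → E} (hφ : QuadraticDecay C φ) (hψ : QuadraticDecay D ψ) :
    QuadraticDecay (C + D) fun x => φ x + ψ x := fun x =>
  (norm_add_le _ _).trans ((add_le_add (hφ x) (hψ x)).trans_eq (add_mul ..).symm)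

theorem mul_of_norm_le {R : Type*} [NonUnitalNormedRing R] {C B : ℝ} {φ ψ : ℝ → R}
    (hφ : QuadraticDecay C φ) (hψ : ∀ x, ‖ψ x‖ ≤ B) :
    QuadraticDecay (C * B) fun x => φ x * ψ x := fun x => by
  calc ‖φ x * ψ x‖ ≤ C * (1 + x ^ 2)⁻¹ * B :=
        norm_mul_le_of_le (hφ x) (hψ x)
    _ = C * B * (1 + x ^ 2)⁻¹ := by ring

theorem mul {R : Type*} [NonUnitalNormedRing R] {C D : ℝ} {φ ψ : ℝ → R}
    (hφ : QuadraticDecay C φ) (hψ : QuadraticDecay D ψ) :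
    QuadraticDecay (C * D) fun x => φ x * ψ x :=
  hφ.mul_of_norm_le hψ.norm_le

end QuadraticDecay

end QuadraticDecay

section ParametricIntegral

theorem continuous_setIntegral_Iic_of_dominated {X E : Type*} [TopologicalSpace X]
    [FirstCountableTopology X] [NormedAddCommGroup E] [NormedSpace ℝ E] {F : X → ℝ → E}
    {b : X → ℝ} {g : ℝ → ℝ} (hF : Continuous (Function.uncurry F)) (hb : Continuous b)
    (hg : Integrable g) (hFg : ∀ z, ∀ y ≤ b z, ‖F z y‖ ≤ g y) (hg0 : 0 ≤ g) :
    Continuous fun z => ∫ y in Set.Iic (b z), F z y := by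
  simp_rw [← integral_indicator measurableSet_Iic]
  refine continuous_iff_continuousAt.2 fun z₀ => continuousAt_of_dominated (bound := g)
    (.of_forall fun z => ?_) (.of_forall fun z => ae_of_all _ fun y => ?_) hg ?_
  · exact ((hF.uncurry_left z).aestronglyMeasurable).indicator measurableSet_Iic
  · rw [norm_indicator_eq_indicator_norm]
    exact Set.indicator_apply_le' (hFg z y) fun _ => hg0 y
  · filter_upwards [Measure.ae_ne volume (b z₀)] with y hy
    rcases lt_or_gt_of_ne hy with hy | hy
    · refine (hF.uncurry_right y).continuousAt.congr ?_
      filter_upwards [(isOpen_lt continuous_const hb).mem_nhds hy] with z hz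
      exact (Set.indicator_of_mem (Set.mem_Iic.2 (le_of_lt hz)) (F z)).symm
    · refine (continuousAt_const (y := (0 : E))).congr ?_
      filter_upwards [(isOpen_lt hb continuous_const).mem_nhds hy] with z hz
      exact (Set.indicator_of_notMem (mt Set.mem_Iic.1 (not_le.2 hz)) (F z)).symm

theorem differentiableOn_integral_of_norm_le {α E : Type*} [MeasurableSpace α] {μ : Measure α}
    [NormedAddCommGroup E] [NormedSpace ℂ E] {F : ℂ → α → E} {U : Set ℂ}
    (hU : IsOpen U) (hmeas : ∀ z, AEStronglyMeasurable (F z) μ)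
    (hd : ∀ y, DifferentiableOn ℂ (fun z => F z y) U) {g : α → ℝ} (hg : Integrable g μ)
    (hFg : ∀ᵐ y ∂μ, ∀ z ∈ U, ‖F z y‖ ≤ g y) :
    DifferentiableOn ℂ (fun z => ∫ y, F z y ∂μ) U := by
  intro z₀ hz₀
  obtain ⟨r, hr, hball⟩ := Metric.isOpen_iff.1 hU z₀ hz₀
  have hderiv (y : α) (z : ℂ) (hz : z ∈ Metric.ball z₀ (r / 2)) :
      HasDerivAt (fun z => F z y) (deriv (fun z => F z y) z) z :=
    ((hd y).differentiableAt (hU.mem_nhds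
      (hball (Metric.ball_subset_ball (half_le_self hr.le) hz)))).hasDerivAt
  have hmeas_deriv : AEStronglyMeasurable (fun y => deriv (fun z => F z y) z₀) μ := by
    refine aestronglyMeasurable_of_tendsto_ae (𝓝[≠] z₀)
      (f := fun z y => slope (fun z => F z y) z₀ z)
      (fun z => ((hmeas z).sub (hmeas z₀)).const_smul _) (ae_of_all _ fun y => ?_)
    exact hasDerivAt_iff_tendsto_slope.1 (hderiv y z₀ (Metric.mem_ball_self (half_pos hr)))
  have cauchy_estimate : ∀ᵐ y ∂μ, ∀ z ∈ Metric.ball z₀ (r / 2),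
      ‖deriv (fun z => F z y) z‖ ≤ g y / (r / 4) := by
    filter_upwards [hFg] with y hy z hz
    have hsub : Metric.closedBall z (r / 4) ⊆ U := fun w hw => hball <| by
      rw [Metric.mem_ball] at hz ⊢
      linarith [dist_triangle w z z₀, Metric.mem_closedBall.1 hw]
    exact norm_deriv_le_of_forall_mem_sphere_norm_le (by positivity)
      ((hd y).diffContOnCl_ball hsub) fun w hw => hy w (hsub (Metric.sphere_subset_closedBall hw))
  have hint : Integrable (F z₀) μ := hg.mono' (hmeas z₀) (hFg.mono fun y hy => hy z₀ hz₀)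
  exact (hasDerivAt_integral_of_dominated_loc_of_deriv_le (Metric.ball_mem_nhds z₀ (half_pos hr))
    (.of_forall hmeas) hint hmeas_deriv cauchy_estimate (hg.div_const _)
    (ae_of_all _ hderiv)).2.differentiableAt.differentiableWithinAt

theorem hasDerivAt_setIntegral_Iic {E : Type*} [NormedAddCommGroup E] [NormedSpace ℝ E]
    [CompleteSpace E] {φ : ℝ → E} (hφ : Continuous φ)
    (hi : ∀ b, IntegrableOn φ (Set.Iic b)) (x : ℝ) :
    HasDerivAt (fun b => ∫ y in Set.Iic b, φ y) (φ x) x := by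
  have hsplit : (fun b => ∫ y in Set.Iic b, φ y) =
      fun b => (∫ y in Set.Iic x, φ y) + ∫ y in x..b, φ y := by
    ext b
    rw [← intervalIntegral.integral_Iic_sub_Iic (hi x) (hi b), add_sub_cancel]
  rw [hsplit]
  exact (intervalIntegral.integral_hasDerivAt_right (hφ.intervalIntegrable _ _)
    (hφ.stronglyMeasurableAtFilter _ _) hφ.continuousAt).const_add _

end ParametricIntegral

section Volterra

/-- The solution `v x = ∫_{-∞}^x e^{2iλ(x-y)} φ(y) dy` of `v' = 2iλ v + φ` vanishing at `-∞`. -/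
def volterra (lam : ℂ) (φ : ℝ → ℂ) (x : ℝ) : ℂ :=
  ∫ y in Set.Iic x, exp (2 * I * lam * (x - y)) * φ y

variable {lam : ℂ} {φ ψ : ℝ → ℂ} {C : ℝ}

theorem norm_exp_two_I_mul_le (hl : 0 ≤ lam.im) {s : ℝ} (hs : 0 ≤ s) :
    ‖exp (2 * I * lam * s)‖ ≤ 1 := by
  have : 0 ≤ lam.im * s := mul_nonneg hl hs
  rw [Complex.norm_exp, Real.exp_le_one_iff]
  simp only [mul_re, mul_im, re_ofNat, im_ofNat, I_re, I_im, ofReal_re, ofReal_im]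
  linarith

theorem norm_exp_two_I_mul_sub_le (hl : 0 ≤ lam.im) {x y : ℝ} (h : y ≤ x) :
    ‖exp (2 * I * lam * (x - y))‖ ≤ 1 := by
  exact_mod_cast norm_exp_two_I_mul_le hl (sub_nonneg.2 h)

theorem norm_exp_two_I_mul_sub_mul_le (hl : 0 ≤ lam.im) {x y : ℝ} (h : y ≤ x) (w : ℂ) :
    ‖exp (2 * I * lam * (x - y)) * w‖ ≤ ‖w‖ := by
  rw [norm_mul]
  exact mul_le_of_le_one_left (norm_nonneg _) (norm_exp_two_I_mul_sub_le hl h)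

theorem integrableOn_exp_two_I_mul_sub_mul (hl : 0 ≤ lam.im) (hφ : Integrable φ) (x : ℝ) :
    IntegrableOn (fun y : ℝ => exp (2 * I * lam * (x - y)) * φ y) (Set.Iic x) := by
  refine (hφ.norm.integrableOn (s := Set.Iic x)).mono' ?_ ?_
  · exact (Continuous.aestronglyMeasurable (by fun_prop)).mul hφ.aestronglyMeasurable.restrict
  · exact ae_restrict_of_forall_mem measurableSet_Iic fun y hy =>
      norm_exp_two_I_mul_sub_mul_le hl hy _

theorem norm_volterra_le (hl : 0 ≤ lam.im) {g : ℝ → ℝ} {x : ℝ}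
    (hg : IntegrableOn g (Set.Iic x)) (h : ∀ y, ‖φ y‖ ≤ g y) :
    ‖volterra lam φ x‖ ≤ ∫ y in Set.Iic x, g y :=
  norm_integral_le_of_norm_le hg <| ae_restrict_of_forall_mem measurableSet_Iic fun y hy =>
    (norm_exp_two_I_mul_sub_mul_le hl hy _).trans (h y)

theorem norm_volterra_le_arctan (hl : 0 ≤ lam.im) (hC : QuadraticDecay C φ) (x : ℝ) :
    ‖volterra lam φ x‖ ≤ C * (Real.arctan x + Real.pi / 2) := by
  simpa only [integral_const_mul, integral_Iic_inv_one_add_sq] using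
    norm_volterra_le hl (x := x) (integrable_inv_one_add_sq.const_mul C).integrableOn hC

theorem norm_volterra_le_pi (hl : 0 ≤ lam.im) (hC : QuadraticDecay C φ) (x : ℝ) :
    ‖volterra lam φ x‖ ≤ C * Real.pi := by
  refine (norm_volterra_le_arctan hl hC x).trans (mul_le_mul_of_nonneg_left ?_ hC.nonneg)
  linarith [Real.arctan_lt_pi_div_two x]

theorem tendsto_volterra_atBot (hl : 0 ≤ lam.im) (hC : QuadraticDecay C φ) :
    Tendsto (volterra lam φ) atBot (𝓝 0) := by
  have harctan : Tendsto Real.arctan atBot (𝓝 (-(Real.pi / 2))) :=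
    Real.tendsto_arctan_atBot.mono_right nhdsWithin_le_nhds
  refine squeeze_zero_norm (norm_volterra_le_arctan hl hC) ?_
  simpa using (harctan.add_const (Real.pi / 2)).const_mul C

theorem volterra_sub (hl : 0 ≤ lam.im) (hφ : Integrable φ) (hψ : Integrable ψ) (x : ℝ) :
    volterra lam (fun y => φ y - ψ y) x = volterra lam φ x - volterra lam ψ x := by
  rw [volterra, volterra, volterra, ← integral_sub (integrableOn_exp_two_I_mul_sub_mul hl hφ x)
    (integrableOn_exp_two_I_mul_sub_mul hl hψ x)]
  simp only [← mul_sub]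

theorem volterra_const_mul (lam c : ℂ) (φ : ℝ → ℂ) (x : ℝ) :
    volterra lam (fun y => c * φ y) x = c * volterra lam φ x := by
  simp only [volterra, ← integral_const_mul, mul_left_comm]

theorem volterra_eq_exp_mul (lam : ℂ) (φ : ℝ → ℂ) (x : ℝ) :
    volterra lam φ x =
      exp (2 * I * lam * x) * ∫ y in Set.Iic x, exp (-(2 * I * lam * y)) * φ y := by
  simp only [volterra, ← integral_const_mul, ← mul_assoc, ← Complex.exp_add]
  ring_nf

theorem hasDerivAt_exp_mul_ofReal (c : ℂ) (x : ℝ) :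
    HasDerivAt (fun x : ℝ => exp (c * x)) (c * exp (c * x)) x := by
  simpa [mul_comm] using ((hasDerivAt_id x).ofReal_comp.const_mul c).cexp

theorem hasDerivAt_volterra (hl : 0 ≤ lam.im) (hφ : Continuous φ) (hi : Integrable φ) (x : ℝ) :
    HasDerivAt (volterra lam φ) (2 * I * lam * volterra lam φ x + φ x) x := by
  have exp_mul_exp_neg (y : ℝ) : exp (2 * I * lam * y) * exp (-(2 * I * lam * y)) = 1 := by
    rw [← Complex.exp_add, add_neg_cancel, Complex.exp_zero]
  have hint (b : ℝ) : IntegrableOn (fun y : ℝ => exp (-(2 * I * lam * y)) * φ y) (Set.Iic b) := by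
    refine IntegrableOn.congr_fun ((integrableOn_exp_two_I_mul_sub_mul hl hi b).const_mul
      (exp (-(2 * I * lam * b)))) (fun y _ => ?_) measurableSet_Iic
    simp only [← mul_assoc, ← Complex.exp_add]
    ring_nf
  rw [show volterra lam φ = _ from funext (volterra_eq_exp_mul lam φ)]
  refine ((hasDerivAt_exp_mul_ofReal (2 * I * lam) x).mul
    (hasDerivAt_setIntegral_Iic (by fun_prop) hint x)).congr_deriv ?_
  linear_combination φ x * exp_mul_exp_neg x

theorem eq_volterra_of_hasDerivAt (hl : 0 ≤ lam.im) {v : ℝ → ℂ} (hi : Integrable φ)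
    (hv : ∀ x, HasDerivAt v (2 * I * lam * v x + φ x) x) (h0 : Tendsto v atBot (𝓝 0)) :
    v = volterra lam φ := by
  ext x
  have hderiv : ∀ y ∈ Set.Iic x, HasDerivAt (fun y : ℝ => exp (2 * I * lam * (x - y)) * v y)
      (exp (2 * I * lam * (x - y)) * φ y) y := by
    intro y _
    refine ((((hasDerivAt_id y).ofReal_comp.const_sub (x : ℂ)).const_mul (2 * I * lam)).cexp.mul
      (hv y)).congr_deriv ?_
    push_cast [id]
    ring
  have hlim : Tendsto (fun y : ℝ => exp (2 * I * lam * (x - y)) * v y) atBot (𝓝 0) := by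
    refine squeeze_zero_norm' ?_ (tendsto_zero_iff_norm_tendsto_zero.1 h0)
    filter_upwards [eventually_le_atBot x] with y hy
    exact norm_exp_two_I_mul_sub_mul_le hl hy _
  rw [volterra, integral_Iic_of_hasDerivAt_of_tendsto' hderiv
    (integrableOn_exp_two_I_mul_sub_mul hl hi x) hlim]
  simp

theorem continuous_volterra {P : Type*} [TopologicalSpace P] [FirstCountableTopology P]
    {lam : P → ℂ} (hl : Continuous lam) (him : ∀ p, 0 ≤ (lam p).im) {φ : P → ℝ → ℂ}
    (hφ : Continuous (Function.uncurry φ)) (hC : ∀ p, QuadraticDecay C (φ p)) :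
    Continuous fun z : P × ℝ => volterra (lam z.1) (φ z.1) z.2 := by
  rcases isEmpty_or_nonempty P with _ | ⟨⟨p⟩⟩
  · exact continuous_of_const fun z => isEmptyElim z.1
  have : Continuous fun q : (P × ℝ) × ℝ => φ q.1.1 q.2 :=
    hφ.comp (by fun_prop : Continuous fun q : (P × ℝ) × ℝ => (q.1.1, q.2))
  refine continuous_setIntegral_Iic_of_dominated
    (F := fun z : P × ℝ => fun y : ℝ => exp (2 * I * lam z.1 * (z.2 - y)) * φ z.1 y)
    (by simp only [Function.uncurry_def]; fun_prop) continuous_snd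
    (integrable_inv_one_add_sq.const_mul C)
    (fun z y hy => (norm_exp_two_I_mul_sub_mul_le (him _) hy _).trans (hC _ y))
    fun y => (norm_nonneg _).trans (hC p y)

theorem differentiableOn_volterra {U : Set ℂ} (hU : IsOpen U) {lam : ℂ → ℂ}
    (hlam : DifferentiableOn ℂ lam U) (him : ∀ z ∈ U, 0 ≤ (lam z).im) {φ : ℂ → ℝ → ℂ} {x : ℝ}
    (hφ : ∀ z, Continuous (φ z)) (hC : ∀ z, QuadraticDecay C (φ z))
    (hd : ∀ y, DifferentiableOn ℂ (fun z => φ z y) U) :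
    DifferentiableOn ℂ (fun z => volterra (lam z) (φ z) x) U := by
  refine differentiableOn_integral_of_norm_le hU
    (fun z => Continuous.aestronglyMeasurable (by have := hφ z; fun_prop))
    (fun y => DifferentiableOn.mul (by fun_prop) (hd y))
    (integrable_inv_one_add_sq.const_mul C).integrableOn ?_
  exact ae_restrict_of_forall_mem measurableSet_Iic fun y hy z hz =>
    (norm_exp_two_I_mul_sub_mul_le (him z hz) hy _).trans (hC z y)

end Volterra

section Weight

/-- The weight `e^{L arctan x}`; in the corresponding weighted supremum norm, Volterra operators
whose coefficients have quadratic decay are contractions for large `L`. -/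
def weight (L x : ℝ) : ℝ := Real.exp (L * Real.arctan x)

variable {L : ℝ}

theorem continuous_weight (L : ℝ) : Continuous (weight L) := by
  unfold weight
  fun_prop

theorem weight_pos (L x : ℝ) : 0 < weight L x := Real.exp_pos _

theorem weight_mul_weight_neg (L x : ℝ) : weight L x * weight (-L) x = 1 := by
  rw [weight, weight, ← Real.exp_add, neg_mul, add_neg_cancel, Real.exp_zero]

theorem weight_le (L x : ℝ) : weight L x ≤ Real.exp (|L| * (Real.pi / 2)) := by
  refine Real.exp_le_exp.2 ((le_abs_self _).trans ?_)
  rw [abs_mul]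
  gcongr
  exact abs_le.2 ⟨(Real.neg_pi_div_two_lt_arctan x).le, (Real.arctan_lt_pi_div_two x).le⟩

theorem integrable_weight_mul_inv_one_add_sq (L : ℝ) :
    Integrable fun y => weight L y * (1 + y ^ 2)⁻¹ := by
  refine integrable_inv_one_add_sq.bdd_mul (continuous_weight L).aestronglyMeasurable
    (ae_of_all _ fun y => ?_) (c := Real.exp (|L| * (Real.pi / 2)))
  rw [Real.norm_of_nonneg (weight_pos L y).le]
  exact weight_le L y

theorem integral_Iic_weight_le (hL : 0 < L) (x : ℝ) :
    ∫ y in Set.Iic x, weight L y * (1 + y ^ 2)⁻¹ ≤ L⁻¹ * weight L x := by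
  have hderiv : ∀ y ∈ Set.Iic x,
      HasDerivAt (fun y => L⁻¹ * weight L y) (weight L y * (1 + y ^ 2)⁻¹) y := by
    intro y _
    refine ((((Real.hasDerivAt_arctan y).const_mul L).exp).const_mul L⁻¹).congr_deriv ?_
    rw [weight]
    field_simp
  have hlim : Tendsto (fun y => L⁻¹ * weight L y) atBot
      (𝓝 (L⁻¹ * Real.exp (L * -(Real.pi / 2)))) :=
    (((Real.tendsto_arctan_atBot.mono_right nhdsWithin_le_nhds).const_mul L).rexp).const_mul _
  rw [integral_Iic_of_hasDerivAt_of_tendsto' hderiv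
    (integrable_weight_mul_inv_one_add_sq L).integrableOn hlim]
  exact sub_le_self _ (by positivity)

theorem norm_volterra_le_weight {lam : ℂ} (hl : 0 ≤ lam.im) {φ : ℝ → ℂ} {M : ℝ} (hL : 0 < L)
    (h : ∀ y, ‖φ y‖ ≤ M * (weight L y * (1 + y ^ 2)⁻¹)) (x : ℝ) :
    ‖volterra lam φ x‖ ≤ M * (L⁻¹ * weight L x) := by
  have hM : 0 ≤ M := by
    simpa [weight] using (norm_nonneg _).trans (h 0)
  refine (norm_volterra_le hl
    ((integrable_weight_mul_inv_one_add_sq L).const_mul M).integrableOn h).trans ?_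
  rw [integral_const_mul]
  exact mul_le_mul_of_nonneg_left (integral_Iic_weight_le hL x) hM

theorem eq_zero_of_le_integral_Iic {u : ℝ → ℝ} (h0 : 0 ≤ u) {B C : ℝ} (hB : ∀ x, u x ≤ B)
    (hC : 0 < C) (h : ∀ x, u x ≤ ∫ y in Set.Iic x, C * (1 + y ^ 2)⁻¹ * u y) : u = 0 := by
  set L := 2 * C with hL
  set D := ⨆ x, weight (-L) x * u x
  have hbdd : BddAbove (Set.range fun x => weight (-L) x * u x) := by
    refine ⟨Real.exp (|-L| * (Real.pi / 2)) * B, ?_⟩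
    rintro _ ⟨x, rfl⟩
    exact mul_le_mul (weight_le _ _) (hB x) (h0 x) (Real.exp_pos _).le
  have le_weight (x : ℝ) : u x ≤ weight L x * D := by
    rw [← one_mul (u x), ← weight_mul_weight_neg L x, mul_assoc]
    exact mul_le_mul_of_nonneg_left (le_ciSup hbdd x) (weight_pos L x).le
  -- Feeding the bound `weight L * D` into the inequality improves it by the factor `C / L = 1 / 2`.
  have half_le (x : ℝ) : weight (-L) x * u x ≤ D / 2 := by
    have : u x ≤ C * D * (L⁻¹ * weight L x) := by
      refine (h x).trans ?_
      refine (integral_mono_of_nonneg (ae_of_all _ fun y => ?_)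
        ((integrable_weight_mul_inv_one_add_sq L).const_mul (C * D)).integrableOn
        (ae_of_all _ fun y => ?_)).trans ?_
      · have := h0 y
        simp only [Pi.zero_apply] at this ⊢
        positivity
      · calc C * (1 + y ^ 2)⁻¹ * u y ≤ C * (1 + y ^ 2)⁻¹ * (weight L y * D) := by
              gcongr; exact le_weight y
          _ = C * D * (weight L y * (1 + y ^ 2)⁻¹) := by ring
      · rw [integral_const_mul]
        have hD : 0 ≤ D := Real.iSup_nonneg fun x => mul_nonneg (weight_pos _ _).le (h0 x)
        exact mul_le_mul_of_nonneg_left (integral_Iic_weight_le (by positivity) x) (by positivity)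
    calc weight (-L) x * u x ≤ weight (-L) x * (C * D * (L⁻¹ * weight L x)) :=
          mul_le_mul_of_nonneg_left this (weight_pos _ _).le
      _ = C * L⁻¹ * D * (weight L x * weight (-L) x) := by ring
      _ = D / 2 := by rw [weight_mul_weight_neg, hL]; field_simp
  have hD : D ≤ 0 := by linarith [ciSup_le half_le]
  ext x
  exact le_antisymm ((le_weight x).trans (mul_nonpos_of_nonneg_of_nonpos (weight_pos L x).le hD))
    (h0 x)

end Weight

section VolterraSystem

theorem QuadraticDecay.weight_mul {D : ℝ} {φ : ℝ → ℂ} (h : QuadraticDecay D φ) (L : ℝ) :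
    QuadraticDecay (Real.exp (|L| * (Real.pi / 2)) * D) fun y => weight L y * φ y := fun y => by
  rw [norm_mul, Complex.norm_of_nonneg (weight_pos L y).le, mul_assoc]
  exact mul_le_mul (weight_le L y) (h y) (norm_nonneg _) (Real.exp_pos _).le

theorem norm_weight_mul_volterra_le {lam : ℂ} (hl : 0 ≤ lam.im) {B C : ℝ} (hC : 0 < C)
    {φ : ℝ → ℂ} (h : QuadraticDecay (C * B) φ) (x : ℝ) :
    ‖weight (-(2 * C)) x * volterra lam (fun y => weight (2 * C) y * φ y) x‖ ≤ B / 2 := by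
  have hv := norm_volterra_le_weight hl (φ := fun y => weight (2 * C) y * φ y) (M := C * B)
    (L := 2 * C) (by positivity) (fun y => by
      rw [norm_mul, Complex.norm_of_nonneg (weight_pos _ y).le, mul_left_comm (C * B)]
      exact mul_le_mul_of_nonneg_left (h y) (weight_pos _ y).le) x
  rw [norm_mul, Complex.norm_of_nonneg (weight_pos _ x).le]
  calc _ ≤ weight (-(2 * C)) x * (C * B * ((2 * C)⁻¹ * weight (2 * C) x)) :=
        mul_le_mul_of_nonneg_left hv (weight_pos _ x).le
    _ = B / 2 * (weight (2 * C) x * weight (-(2 * C)) x) := by field_simp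
    _ = B / 2 := by rw [weight_mul_weight_neg, mul_one]

variable {ι P : Type*} [Fintype ι] [TopologicalSpace P]

/-- The hypotheses on the coefficients of a linear system of Volterra equations
`mᵢ(x) = eᵢ + ∫_{-∞}^x e^{2iλᵢ(x-y)} (A(y) m(y))ᵢ dy` whose rates `λᵢ` and coefficients `A` depend
on a parameter `p : P`. -/
structure IsVolterraSystem (lam : ι → P → ℂ) (A : P → ℝ → Matrix ι ι ℂ) (C : ℝ) : Prop where
  pos : 0 < C
  continuous_rate : ∀ i, Continuous (lam i)
  rate_im_nonneg : ∀ i p, 0 ≤ (lam i p).im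
  continuous_coeff : Continuous (Function.uncurry A)
  norm_mulVec_le : ∀ p y v, ‖(A p y).mulVec v‖ ≤ C * (1 + y ^ 2)⁻¹ * ‖v‖

namespace IsVolterraSystem

variable {lam : ι → P → ℂ} {A : P → ℝ → Matrix ι ι ℂ} {C : ℝ} (h : IsVolterraSystem lam A C)
include h

theorem quadraticDecay_mulVec {p : P} {B : ℝ} {v : ℝ → ι → ℂ} (hv : ∀ y, ‖v y‖ ≤ B) (i : ι) :
    QuadraticDecay (C * B) fun y => (A p y).mulVec (v y) i := fun y => by
  have := h.pos
  calc ‖(A p y).mulVec (v y) i‖ ≤ C * (1 + y ^ 2)⁻¹ * ‖v y‖ :=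
        (norm_le_pi_norm _ i).trans (h.norm_mulVec_le p y _)
    _ ≤ C * (1 + y ^ 2)⁻¹ * B := by gcongr; exact hv y
    _ = C * B * (1 + y ^ 2)⁻¹ := by ring

theorem continuous_weight_mul_mulVec {n : P × ℝ → ι → ℂ} (hn : Continuous n) (i : ι) :
    Continuous (Function.uncurry fun p y =>
      (weight (2 * C) y : ℂ) * (A p y).mulVec (n (p, y)) i) :=
  (continuous_ofReal.comp ((continuous_weight _).comp continuous_snd)).mul
    ((continuous_apply i).comp (h.continuous_coeff.matrix_mulVec hn))

end IsVolterraSystem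

/-- The integral operator of a Volterra system, conjugated with the weight `e^{2C arctan x}`. -/
def weightedVolterra (lam : ι → P → ℂ) (A : P → ℝ → Matrix ι ι ℂ) (C : ℝ) (e : ι → ℂ)
    (n : P × ℝ → ι → ℂ) (w : P × ℝ) (i : ι) : ℂ :=
  weight (-(2 * C)) w.2 * (e i + volterra (lam i w.1)
    (fun y => weight (2 * C) y * (A w.1 y).mulVec (n (w.1, y)) i) w.2)

namespace IsVolterraSystem

variable {lam : ι → P → ℂ} {A : P → ℝ → Matrix ι ι ℂ} {C : ℝ}
  (h : IsVolterraSystem lam A C)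
include h

theorem continuous_weightedVolterra [FirstCountableTopology P] (e : ι → ℂ) (n : P × ℝ →ᵇ (ι → ℂ)) :
    Continuous (weightedVolterra lam A C e n) := by
  refine continuous_pi fun i => Continuous.mul ?_ (continuous_const.add ?_)
  · have := continuous_weight (-(2 * C))
    fun_prop
  · exact continuous_volterra (h.continuous_rate i) (h.rate_im_nonneg i)
      (h.continuous_weight_mul_mulVec n.continuous i) fun p => (h.quadraticDecay_mulVec
        (fun y => n.norm_coe_le_norm (p, y)) i).weight_mul _

theorem norm_weightedVolterra_le (e : ι → ℂ) (n : P × ℝ →ᵇ (ι → ℂ)) (w : P × ℝ) :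
    ‖weightedVolterra lam A C e n w‖ ≤
      Real.exp (|-(2 * C)| * (Real.pi / 2)) * ‖e‖ + ‖n‖ / 2 := by
  refine (pi_norm_le_iff_of_nonneg (by positivity)).2 fun i => ?_
  rw [weightedVolterra, mul_add]
  refine (norm_add_le _ _).trans (add_le_add ?_ ?_)
  · rw [norm_mul, Complex.norm_of_nonneg (weight_pos _ _).le]
    exact mul_le_mul (weight_le _ _) (norm_le_pi_norm e i) (norm_nonneg _) (Real.exp_pos _).le
  · exact norm_weight_mul_volterra_le (h.rate_im_nonneg i _) h.pos
      (h.quadraticDecay_mulVec (fun y => n.norm_coe_le_norm (w.1, y)) i) _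

theorem norm_weightedVolterra_sub_le (e : ι → ℂ) (n m : P × ℝ →ᵇ (ι → ℂ)) (w : P × ℝ) :
    ‖weightedVolterra lam A C e n w - weightedVolterra lam A C e m w‖ ≤ ‖n - m‖ / 2 := by
  have integrable (n : P × ℝ →ᵇ (ι → ℂ)) (i : ι) : Integrable fun y =>
      (weight (2 * C) y : ℂ) * (A w.1 y).mulVec (n (w.1, y)) i :=
    ((h.quadraticDecay_mulVec (fun y => n.norm_coe_le_norm (w.1, y)) i).weight_mul
      (2 * C)).integrable
      ((h.continuous_weight_mul_mulVec n.continuous i).uncurry_left w.1).aestronglyMeasurable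
  refine (pi_norm_le_iff_of_nonneg (by positivity)).2 fun i => ?_
  rw [Pi.sub_apply, weightedVolterra, weightedVolterra, ← mul_sub, add_sub_add_left_eq_sub,
    ← volterra_sub (h.rate_im_nonneg i _) (integrable n i) (integrable m i)]
  simp only [← mul_sub, ← Pi.sub_apply, ← Matrix.mulVec_sub]
  exact norm_weight_mul_volterra_le (h.rate_im_nonneg i _) h.pos
    (h.quadraticDecay_mulVec (fun y => (n - m).norm_coe_le_norm (w.1, y)) i) _

end IsVolterraSystem

/-- `weightedVolterra` as an operator on bounded continuous functions. -/
def weightedVolterraBCF [FirstCountableTopology P] {lam : ι → P → ℂ} {A : P → ℝ → Matrix ι ι ℂ}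
    {C : ℝ} (h : IsVolterraSystem lam A C) (e : ι → ℂ) (n : P × ℝ →ᵇ (ι → ℂ)) :
    P × ℝ →ᵇ (ι → ℂ) :=
  BoundedContinuousFunction.ofNormedAddCommGroup (weightedVolterra lam A C e n)
    (h.continuous_weightedVolterra e n) _ (h.norm_weightedVolterra_le e n)

namespace IsVolterraSystem

variable [FirstCountableTopology P] {lam : ι → P → ℂ} {A : P → ℝ → Matrix ι ι ℂ} {C : ℝ}
  (h : IsVolterraSystem lam A C)
include h

theorem contractingWith_weightedVolterraBCF (e : ι → ℂ) :
    ContractingWith (1 / 2) (weightedVolterraBCF h e) := by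
  refine ⟨NNReal.half_lt_self one_ne_zero, LipschitzWith.of_dist_le_mul fun n m => ?_⟩
  refine (BoundedContinuousFunction.dist_le (by positivity)).2 fun w => ?_
  rw [dist_eq_norm, dist_eq_norm]
  refine (h.norm_weightedVolterra_sub_le e n m w).trans_eq ?_
  push_cast
  ring

theorem differentiableOn_iterate (e : ι → ℂ) {s : ℂ → P} {U : Set ℂ} (hU : IsOpen U)
    (hlam : ∀ i, DifferentiableOn ℂ (fun z => lam i (s z)) U)
    (hA : ∀ y i j, DifferentiableOn ℂ (fun z => A (s z) y i j) U) (k : ℕ) (x : ℝ) (i : ι) :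
    DifferentiableOn ℂ (fun z => (weightedVolterraBCF h e)^[k] 0 (s z, x) i) U := by
  induction k generalizing x i with
  | zero => exact differentiableOn_const 0
  | succ k ih =>
    simp only [Function.iterate_succ_apply']
    set n := (weightedVolterraBCF h e)^[k] 0
    have hcoeff (y : ℝ) : DifferentiableOn ℂ
        (fun z => weight (2 * C) y * (A (s z) y).mulVec (n (s z, y)) i) U := by
      simp only [Matrix.mulVec, dotProduct]
      exact (DifferentiableOn.fun_sum fun j _ => (hA y i j).mul (ih y j)).const_mul _
    exact ((differentiableOn_volterra hU (hlam i) (fun z _ => h.rate_im_nonneg i _)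
      (fun z => (h.continuous_weight_mul_mulVec n.continuous i).uncurry_left (s z))
      (fun z => (h.quadraticDecay_mulVec (fun y => n.norm_coe_le_norm (s z, y)) i).weight_mul _)
      hcoeff).const_add (e i)).const_mul (weight (-(2 * C)) x : ℂ)

theorem differentiableOn_fixedPoint (e : ι → ℂ) {s : ℂ → P} {U : Set ℂ} (hU : IsOpen U)
    (hlam : ∀ i, DifferentiableOn ℂ (fun z => lam i (s z)) U)
    (hA : ∀ y i j, DifferentiableOn ℂ (fun z => A (s z) y i j) U) (x : ℝ) (i : ι) :
    DifferentiableOn ℂ (fun z =>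
      (h.contractingWith_weightedVolterraBCF e).fixedPoint (weightedVolterraBCF h e) (s z, x) i)
      U := by
  have hunif := BoundedContinuousFunction.tendsto_iff_tendstoUniformly.1
    ((h.contractingWith_weightedVolterraBCF e).tendsto_iterate_fixedPoint 0)
  refine TendstoLocallyUniformlyOn.differentiableOn (φ := atTop)
    (F := fun k z => (weightedVolterraBCF h e)^[k] 0 (s z, x) i) ?_
    (.of_forall fun k => h.differentiableOn_iterate e hU hlam hA k x i) hU
  exact (((Pi.uniformContinuous_proj (fun _ : ι => ℂ) i).comp_tendstoUniformly hunif).comp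
    fun z => (s z, x)).tendstoLocallyUniformly.tendstoLocallyUniformlyOn

theorem exists_solution (e : ι → ℂ) :
    ∃ m : P → ℝ → ι → ℂ, Continuous (Function.uncurry m) ∧ (∃ M, ∀ p x, ‖m p x‖ ≤ M) ∧
      (∀ p x i, m p x i = e i + volterra (lam i p) (fun y => (A p y).mulVec (m p y) i) x) ∧
      ∀ (s : ℂ → P) (U : Set ℂ), IsOpen U → (∀ i, DifferentiableOn ℂ (fun z => lam i (s z)) U) →
        (∀ y i j, DifferentiableOn ℂ (fun z => A (s z) y i j) U) →
        ∀ x i, DifferentiableOn ℂ (fun z => m (s z) x i) U := by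
  set n := (h.contractingWith_weightedVolterraBCF e).fixedPoint (weightedVolterraBCF h e)
  have fixed (w : P × ℝ) (i : ι) : weightedVolterra lam A C e n w i = n w i :=
    congrArg (fun n : P × ℝ →ᵇ (ι → ℂ) => n w i)
      (h.contractingWith_weightedVolterraBCF e).fixedPoint_isFixedPt
  refine ⟨fun p x => weight (2 * C) x • n (p, x), ?_, ?_, fun p x i => ?_,
    fun s U hU hlam hA x i => ?_⟩
  · exact ((continuous_weight _).comp continuous_snd).smul n.continuous
  · refine ⟨Real.exp (|2 * C| * (Real.pi / 2)) * ‖n‖, fun p x => ?_⟩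
    rw [norm_smul, Real.norm_of_nonneg (weight_pos _ x).le]
    exact mul_le_mul (weight_le _ _) (n.norm_coe_le_norm _) (norm_nonneg _) (Real.exp_pos _).le
  · have cancel : (weight (2 * C) x : ℂ) * weight (-(2 * C)) x = 1 := by
      exact_mod_cast weight_mul_weight_neg (2 * C) x
    simp only [Matrix.mulVec_smul, Pi.smul_apply, real_smul]
    rw [← fixed (p, x) i, weightedVolterra, ← mul_assoc, cancel, one_mul]
  · exact (h.differentiableOn_fixedPoint e hU hlam hA x i).const_smul (weight (2 * C) x)

end IsVolterraSystem

end VolterraSystem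

section Potential

/-- A family, indexed by the time `t`, of twice differentiable potentials `Q t` decaying
quadratically together with their first two `x`-derivatives `Q' t` and `Q'' t`. -/
structure PotentialFamily (Q Q' Q'' : ℝ → ℝ → ℂ) (C : ℝ) : Prop where
  pos : 0 < C
  continuous : Continuous (Function.uncurry Q)
  continuous' : Continuous (Function.uncurry Q')
  continuous'' : ∀ t, Continuous (Q'' t)
  hasDerivAt : ∀ t x, HasDerivAt (Q t) (Q' t x) x
  hasDerivAt' : ∀ t x, HasDerivAt (Q' t) (Q'' t x) x
  decay : ∀ t, QuadraticDecay C (Q t)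
  decay' : ∀ t, QuadraticDecay C (Q' t)
  decay'' : ∀ t, QuadraticDecay C (Q'' t)

variable {σ : ℝ} {Q Q' Q'' : ℝ → ℝ → ℂ} {C : ℝ}

theorem norm_ofReal_of_abs_eq_one (hσ : |σ| = 1) : ‖(σ : ℂ)‖ = 1 := by simpa using hσ

theorem ofReal_mul_self_of_abs_eq_one (hσ : |σ| = 1) : (σ : ℂ) * σ = 1 := by
  rw [← Complex.ofReal_mul, ← abs_mul_abs_self, hσ, mul_one, Complex.ofReal_one]

theorem hasDerivAt_conj {f : ℝ → ℂ} {f' : ℂ} {x : ℝ} (h : HasDerivAt f f' x) :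
    HasDerivAt (fun y => conj (f y)) (conj f') x :=
  h.star

namespace PotentialFamily

variable (hQ : PotentialFamily Q Q' Q'' C)
include hQ

theorem continuous_apply (t : ℝ) : Continuous (Q t) := hQ.continuous.uncurry_left t

theorem continuous_apply' (t : ℝ) : Continuous (Q' t) := hQ.continuous'.uncurry_left t

theorem norm_le (t x : ℝ) : ‖Q t x‖ ≤ C := (hQ.decay t).norm_le x

theorem reflect :
    PotentialFamily (fun t x => Q t (-x)) (fun t x => -Q' t (-x)) (fun t x => Q'' t (-x)) C where
  pos := hQ.pos
  continuous := hQ.continuous.comp (by fun_prop : Continuous fun p : ℝ × ℝ => (p.1, -p.2))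
  continuous' :=
    (hQ.continuous'.comp (by fun_prop : Continuous fun p : ℝ × ℝ => (p.1, -p.2))).neg
  continuous'' t := (hQ.continuous'' t).comp continuous_neg
  hasDerivAt t x :=
    ((hQ.hasDerivAt t (-x)).scomp x (hasDerivAt_neg x)).congr_deriv (by simp)
  hasDerivAt' t x :=
    ((hQ.hasDerivAt' t (-x)).scomp x (hasDerivAt_neg x)).neg.congr_deriv (by simp)
  decay t := (hQ.decay t).comp_neg
  decay' t x := by simpa using hQ.decay' t (-x)
  decay'' t := (hQ.decay'' t).comp_neg

theorem continuous_density :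
    Continuous (Function.uncurry fun t x => σ * conj (Q t x) * Q t x) := by
  simp only [Function.uncurry_def]
  have hQ : Continuous fun w : ℝ × ℝ => Q w.1 w.2 := hQ.continuous
  fun_prop

theorem decay_density (hσ : |σ| = 1) (t : ℝ) :
    QuadraticDecay (C ^ 2) fun x => σ * conj (Q t x) * Q t x := by
  simpa only [QuadraticDecay, norm_mul, RCLike.norm_conj, norm_ofReal_of_abs_eq_one hσ, one_mul,
    ← sq C] using (hQ.decay t).mul (hQ.decay t)

end PotentialFamily

/-- The half mass `∫_{-∞}^x σ |Q|² / 2` to the left of `x`. -/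
def leftPhase (σ : ℝ) (Q : ℝ → ℂ) (x : ℝ) : ℝ := ∫ y in Set.Iic x, σ * ‖Q y‖ ^ 2 / 2

theorem ofReal_leftPhase (σ : ℝ) (Q : ℝ → ℂ) :
    (fun x => (leftPhase σ Q x : ℂ)) =
      volterra 0 (fun y => 1 / 2 * (σ * conj (Q y) * Q y)) := by
  ext x
  rw [leftPhase, ← integral_complex_ofReal, volterra]
  congr 1 with y
  simp only [mul_zero, zero_mul, Complex.exp_zero, one_mul, mul_assoc, Complex.conj_mul']
  push_cast
  ring

namespace PotentialFamily

variable (hQ : PotentialFamily Q Q' Q'' C)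
include hQ

theorem continuous_half_density : Continuous (Function.uncurry fun t x =>
    1 / 2 * (σ * conj (Q t x) * Q t x)) :=
  continuous_const.mul hQ.continuous_density

theorem decay_half_density (hσ : |σ| = 1) (t : ℝ) :
    QuadraticDecay (C ^ 2) fun x => 1 / 2 * (σ * conj (Q t x) * Q t x) := fun x => by
  refine le_trans ?_ (hQ.decay_density hσ t x)
  rw [norm_mul]
  exact mul_le_of_le_one_left (norm_nonneg _) (by norm_num)

theorem hasDerivAt_leftPhase (hσ : |σ| = 1) (t x : ℝ) :
    HasDerivAt (fun y => (leftPhase σ (Q t) y : ℂ)) (1 / 2 * (σ * conj (Q t x) * Q t x)) x := by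
  have hcont : Continuous fun y => 1 / 2 * (σ * conj (Q t y) * Q t y) :=
    hQ.continuous_half_density.uncurry_left t
  rw [ofReal_leftPhase]
  refine (hasDerivAt_volterra (by simp) hcont
    ((hQ.decay_half_density hσ t).integrable hcont.aestronglyMeasurable) x).congr_deriv ?_
  ring

theorem continuous_leftPhase (hσ : |σ| = 1) :
    Continuous fun w : ℝ × ℝ => (leftPhase σ (Q w.1) w.2 : ℂ) := by
  have h := continuous_volterra (lam := fun _ => 0) continuous_const (by simp)
    hQ.continuous_half_density (hQ.decay_half_density hσ)
  exact h.congr fun w => (congrFun (ofReal_leftPhase σ (Q w.1)) w.2).symm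

theorem tendsto_leftPhase (hσ : |σ| = 1) (t : ℝ) :
    Tendsto (fun x => (leftPhase σ (Q t) x : ℂ)) atBot (𝓝 0) := by
  rw [ofReal_leftPhase]
  exact tendsto_volterra_atBot (by simp) (hQ.decay_half_density hσ t)

end PotentialFamily

end Potential

section LeftJost

variable {σ : ℝ} {Q Q' Q'' : ℝ → ℝ → ℂ} {C : ℝ}

/-- The coefficient `W` of the system `f' = -(i/2) Q h`, `h' = 2 i z h + W f` satisfied by the first
entry `f` of a Jost column and `h = 2 i z g + σ Q̄ f`. -/
def jostCoeff (σ : ℝ) (Q Q' : ℝ → ℂ) (x : ℝ) : ℂ :=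
  σ * conj (Q' x) - I / 2 * (σ * conj (Q x) * Q x) * (σ * conj (Q x))

/-- The derivative of `jostCoeff`. -/
def jostCoeff' (σ : ℝ) (Q Q' Q'' : ℝ → ℂ) (x : ℝ) : ℂ :=
  σ * conj (Q'' x) - I / 2 * σ ^ 2 *
    (2 * conj (Q x) * conj (Q' x) * Q x + conj (Q x) ^ 2 * Q' x)

theorem hasDerivAt_jostCoeff (hQ : PotentialFamily Q Q' Q'' C) (t x : ℝ) :
    HasDerivAt (jostCoeff σ (Q t) (Q' t)) (jostCoeff' σ (Q t) (Q' t) (Q'' t) x) x := by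
  have h := hQ.hasDerivAt t x
  have hconj := (hasDerivAt_conj h).const_mul (σ : ℂ)
  refine (((hasDerivAt_conj (hQ.hasDerivAt' t x)).const_mul (σ : ℂ)).sub
    (((hconj.mul h).const_mul (I / 2)).mul hconj)).congr_deriv ?_
  simp only [jostCoeff', Pi.mul_apply]
  ring

theorem decay_jostCoeff (hσ : |σ| = 1) (hQ : PotentialFamily Q Q' Q'' C) (t : ℝ) :
    QuadraticDecay (C + C ^ 3) (jostCoeff σ (Q t) (Q' t)) := fun x => by
  have hQ' := hQ.decay' t x
  have hcubic : ‖Q t x * Q t x * Q t x‖ ≤ C * C * C * (1 + x ^ 2)⁻¹ :=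
    ((hQ.decay t).mul (hQ.decay t)).mul (hQ.decay t) x
  refine (norm_sub_le _ _).trans ?_
  simp only [norm_mul, norm_div, RCLike.norm_conj, norm_ofReal_of_abs_eq_one hσ, Complex.norm_I,
    one_mul, Complex.norm_ofNat] at hcubic ⊢
  have hnonneg : 0 ≤ ‖Q t x‖ * ‖Q t x‖ * ‖Q t x‖ := by positivity
  linarith

theorem decay_jostCoeff' (hσ : |σ| = 1) (hQ : PotentialFamily Q Q' Q'' C) (t : ℝ) :
    QuadraticDecay (C + 2 * C ^ 3) (jostCoeff' σ (Q t) (Q' t) (Q'' t)) := fun x => by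
  have hQ'' := hQ.decay'' t x
  have hcubic : ‖Q t x * Q t x * Q' t x‖ ≤ C * C * C * (1 + x ^ 2)⁻¹ :=
    ((hQ.decay t).mul (hQ.decay t)).mul (hQ.decay' t) x
  refine (norm_sub_le _ _).trans ((add_le_add_right
    ((norm_mul_le _ _).trans (mul_le_mul_of_nonneg_left (norm_add_le _ _) (norm_nonneg _))) _).trans
      ?_)
  simp only [norm_mul, norm_div, norm_pow, RCLike.norm_conj, norm_ofReal_of_abs_eq_one hσ,
    Complex.norm_I, one_mul, one_pow, mul_one, Complex.norm_ofNat] at hcubic ⊢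
  have hnonneg : 0 ≤ ‖Q t x‖ * ‖Q t x‖ * ‖Q' t x‖ := by positivity
  nlinarith

theorem continuous_jostCoeff (hQ : PotentialFamily Q Q' Q'' C) :
    Continuous fun p : ℝ × ℝ => jostCoeff σ (Q p.1) (Q' p.1) p.2 := by
  have hQc : Continuous fun p : ℝ × ℝ => Q p.1 p.2 := hQ.continuous
  have hQc' : Continuous fun p : ℝ × ℝ => Q' p.1 p.2 := hQ.continuous'
  unfold jostCoeff
  fun_prop

theorem continuous_jostCoeff' (hQ : PotentialFamily Q Q' Q'' C) (t : ℝ) :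
    Continuous (jostCoeff' σ (Q t) (Q' t) (Q'' t)) := by
  have := hQ.continuous_apply t
  have := hQ.continuous_apply' t
  have := hQ.continuous'' t
  unfold jostCoeff'
  fun_prop

/-- The retraction of the complex plane onto the closed upper half plane along the imaginary
direction. -/
def clampUpper (z : ℂ) : ℂ := z.re + (max z.im 0 : ℝ) * I

theorem continuous_clampUpper : Continuous clampUpper := by
  unfold clampUpper
  fun_prop

theorem clampUpper_im_nonneg (z : ℂ) : 0 ≤ (clampUpper z).im := by simp [clampUpper]

theorem clampUpper_of_nonneg {z : ℂ} (hz : 0 ≤ z.im) : clampUpper z = z := by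
  apply Complex.ext <;> simp [clampUpper, hz]

/-- The rates of the Volterra system for `(f, g, h)`. -/
def jostRate : Fin 3 → ℝ × ℂ → ℂ := ![fun _ => 0, fun p => clampUpper p.2, fun p => clampUpper p.2]

/-- The coefficient matrix of the Volterra system for `(f, g, h)`. Carrying `h` along makes it
independent of the spectral parameter. -/
def jostMatrix (σ : ℝ) (Q Q' : ℝ → ℂ) (x : ℝ) : Matrix (Fin 3) (Fin 3) ℂ :=
  !![0, 0, -(I / 2) * Q x;
     σ * conj (Q x), I / 2 * (σ * conj (Q x) * Q x), 0;
     jostCoeff σ Q Q' x, 0, 0]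

theorem continuous_jostMatrix (hQ : PotentialFamily Q Q' Q'' C) :
    Continuous fun p : ℝ × ℝ => jostMatrix σ (Q p.1) (Q' p.1) p.2 := by
  have hQc : Continuous fun p : ℝ × ℝ => Q p.1 p.2 := hQ.continuous
  have hf : Continuous fun p : ℝ × ℝ => -(I / 2) * Q p.1 p.2 := by fun_prop
  have hgf : Continuous fun p : ℝ × ℝ => σ * conj (Q p.1 p.2) := by fun_prop
  have hgg : Continuous fun p : ℝ × ℝ => I / 2 * (σ * conj (Q p.1 p.2) * Q p.1 p.2) := by fun_prop
  refine continuous_pi fun i => continuous_pi fun j => ?_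
  fin_cases i <;> fin_cases j
  exacts [continuous_const, continuous_const, hf, hgf, hgg, continuous_const,
    continuous_jostCoeff hQ, continuous_const, continuous_const]

theorem jostMatrix_mulVec (σ : ℝ) (Q Q' : ℝ → ℂ) (x : ℝ) (v : Fin 3 → ℂ) :
    (jostMatrix σ Q Q' x).mulVec v = ![-(I / 2) * Q x * v 2,
      σ * conj (Q x) * v 0 + I / 2 * (σ * conj (Q x) * Q x) * v 1, jostCoeff σ Q Q' x * v 0] := by
  ext i
  fin_cases i <;> simp [jostMatrix, Matrix.mulVec, dotProduct, Fin.sum_univ_three]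

theorem norm_jostMatrix_mulVec_le (hσ : |σ| = 1) (hQ : PotentialFamily Q Q' Q'' C) (t x : ℝ)
    (v : Fin 3 → ℂ) :
    ‖(jostMatrix σ (Q t) (Q' t) x).mulVec v‖ ≤
      (C + C ^ 2 + C ^ 3) * (1 + x ^ 2)⁻¹ * ‖v‖ := by
  have hC := hQ.pos
  have hv := norm_le_pi_norm v
  have hdecay := hQ.decay t x
  have hdensity := hQ.decay_density hσ t x
  have hcoeff := decay_jostCoeff hσ hQ t x
  simp only [norm_mul, RCLike.norm_conj, norm_ofReal_of_abs_eq_one hσ, one_mul] at hdensity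
  rw [jostMatrix_mulVec, pi_norm_le_iff_of_nonneg (by positivity)]
  intro i
  fin_cases i
  · calc ‖-(I / 2) * Q t x * v 2‖ = ‖Q t x‖ * ‖v 2‖ / 2 := by simp; ring
      _ ≤ C * (1 + x ^ 2)⁻¹ * ‖v‖ / 1 := by gcongr; exacts [hv 2, one_le_two]
      _ ≤ _ := by rw [div_one]; gcongr ?_ * _ * _; linarith [pow_pos hC 2, pow_pos hC 3]
  · calc ‖σ * conj (Q t x) * v 0 + I / 2 * (σ * conj (Q t x) * Q t x) * v 1‖
        ≤ ‖Q t x‖ * ‖v 0‖ + ‖Q t x‖ * ‖Q t x‖ * ‖v 1‖ / 2 := by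
          refine (norm_add_le _ _).trans_eq ?_
          simp only [norm_mul, RCLike.norm_conj, norm_ofReal_of_abs_eq_one hσ, norm_div,
            Complex.norm_I, Complex.norm_ofNat, one_mul]
          ring
      _ ≤ C * (1 + x ^ 2)⁻¹ * ‖v‖ + C ^ 2 * (1 + x ^ 2)⁻¹ * ‖v‖ / 1 := by
          gcongr; exacts [hv 0, hv 1, one_le_two]
      _ = (C + C ^ 2) * (1 + x ^ 2)⁻¹ * ‖v‖ := by ring
      _ ≤ _ := by gcongr ?_ * _ * _; linarith [pow_pos hC 3]
  · calc ‖jostCoeff σ (Q t) (Q' t) x * v 0‖ ≤ (C + C ^ 3) * (1 + x ^ 2)⁻¹ * ‖v‖ :=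
          norm_mul_le_of_le hcoeff (hv 0)
      _ ≤ _ := by gcongr ?_ * _ * _; linarith [pow_pos hC 2]

theorem isVolterraSystem_jostMatrix (hσ : |σ| = 1) (hQ : PotentialFamily Q Q' Q'' C) :
    IsVolterraSystem jostRate (fun p : ℝ × ℂ => jostMatrix σ (Q p.1) (Q' p.1))
      (C + C ^ 2 + C ^ 3) where
  pos := by have := hQ.pos; positivity
  continuous_rate := by
    have hclamp : Continuous fun p : ℝ × ℂ => clampUpper p.2 :=
      continuous_clampUpper.comp continuous_snd
    simpa [Fin.forall_fin_succ, jostRate] using ⟨continuous_const, hclamp⟩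
  rate_im_nonneg := by simp [Fin.forall_fin_succ, jostRate, clampUpper_im_nonneg]
  continuous_coeff := by
    have htime : Continuous fun w : (ℝ × ℂ) × ℝ => (w.1.1, w.2) := by fun_prop
    simpa only [Function.uncurry_def] using (continuous_jostMatrix hQ).comp' htime
  norm_mulVec_le p x v := norm_jostMatrix_mulVec_le hσ hQ p.1 x v

end LeftJost

section Solution

variable {ι P : Type*} [Fintype ι] [TopologicalSpace P] {lam : ι → P → ℂ}
  {A : P → ℝ → Matrix ι ι ℂ} {C : ℝ}

namespace IsVolterraSystem

variable (h : IsVolterraSystem lam A C) {p : P} {e : ι → ℂ} {v : ℝ → ι → ℂ} {B : ℝ}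
  (hB : ∀ y, ‖v y‖ ≤ B)
  (hv : ∀ x i, v x i = e i + volterra (lam i p) (fun y => (A p y).mulVec (v y) i) x)
include h hB hv

theorem hasDerivAt_solution (hcont : Continuous v) (i : ι) (x : ℝ) :
    HasDerivAt (fun x => v x i)
      (2 * I * lam i p * (v x i - e i) + (A p x).mulVec (v x) i) x := by
  have hφ : Continuous fun y => (A p y).mulVec (v y) i :=
    (continuous_apply i).comp ((h.continuous_coeff.uncurry_left p).matrix_mulVec hcont)
  have hderiv := (hasDerivAt_volterra (h.rate_im_nonneg i p) hφ
    ((h.quadraticDecay_mulVec hB i).integrable hφ.aestronglyMeasurable) x).const_add (e i)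
  simp only [← hv] at hderiv
  rwa [hv x i, add_sub_cancel_left]

theorem tendsto_solution_atBot (i : ι) : Tendsto (fun x => v x i) atBot (𝓝 (e i)) := by
  simpa [← hv] using (tendsto_volterra_atBot (h.rate_im_nonneg i p)
    (h.quadraticDecay_mulVec (p := p) hB i)).const_add (e i)

end IsVolterraSystem

end Solution

section JostSolution

variable {σ C M : ℝ} {Q Q' Q'' : ℝ → ℝ → ℂ} {t : ℝ} {z : ℂ} {f g h : ℝ → ℂ}

/-- `(f, g, h)` is a bounded solution of the Volterra system for the Jost column normalized at `-∞`,
for a single potential and a single spectral parameter. -/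
structure IsJostTriple (σ : ℝ) (Q Q' : ℝ → ℂ) (z : ℂ) (M : ℝ) (f g h : ℝ → ℂ) : Prop where
  norm_f_le : ∀ x, ‖f x‖ ≤ M
  norm_g_le : ∀ x, ‖g x‖ ≤ M
  norm_h_le : ∀ x, ‖h x‖ ≤ M
  deriv_f : ∀ x, HasDerivAt f (-(I / 2) * Q x * h x) x
  deriv_g : ∀ x, HasDerivAt g (2 * I * z * g x +
    (σ * conj (Q x) * f x + I / 2 * (σ * conj (Q x) * Q x) * g x)) x
  deriv_h : ∀ x, HasDerivAt h (2 * I * z * h x + jostCoeff σ Q Q' x * f x) x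
  lim_f : Tendsto f atBot (𝓝 1)
  lim_g : Tendsto g atBot (𝓝 0)
  lim_h : Tendsto h atBot (𝓝 0)

theorem IsVolterraSystem.isJostTriple (hS : IsVolterraSystem jostRate
      (fun p : ℝ × ℂ => jostMatrix σ (Q p.1) (Q' p.1)) C) (hz : 0 ≤ z.im) {v : ℝ → Fin 3 → ℂ}
    (hcont : Continuous v) (hM : ∀ x, ‖v x‖ ≤ M)
    (hv : ∀ x i, v x i = ![1, 0, 0] i + volterra (jostRate i (t, z))
      (fun y => (jostMatrix σ (Q t) (Q' t) y).mulVec (v y) i) x) :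
    IsJostTriple σ (Q t) (Q' t) z M (v · 0) (v · 1) (v · 2) where
  norm_f_le x := (norm_le_pi_norm _ _).trans (hM x)
  norm_g_le x := (norm_le_pi_norm _ _).trans (hM x)
  norm_h_le x := (norm_le_pi_norm _ _).trans (hM x)
  deriv_f x := by
    simpa [jostRate, jostMatrix_mulVec] using hS.hasDerivAt_solution (p := (t, z)) hM hv hcont 0 x
  deriv_g x := by
    simpa [jostRate, jostMatrix_mulVec, clampUpper_of_nonneg hz] using
      hS.hasDerivAt_solution (p := (t, z)) hM hv hcont 1 x
  deriv_h x := by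
    simpa [jostRate, jostMatrix_mulVec, clampUpper_of_nonneg hz] using
      hS.hasDerivAt_solution (p := (t, z)) hM hv hcont 2 x
  lim_f := hS.tendsto_solution_atBot (p := (t, z)) hM hv 0
  lim_g := hS.tendsto_solution_atBot (p := (t, z)) hM hv 1
  lim_h := hS.tendsto_solution_atBot (p := (t, z)) hM hv 2

theorem eq_zero_of_hasDerivAt_quadraticDecay_mul (hz : 0 ≤ z.im) (hC : 0 < C) {c d : ℝ → ℂ}
    {B : ℝ} (hcont : Continuous c) (hc : QuadraticDecay C c) (hB : ∀ x, ‖d x‖ ≤ B)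
    (hd : ∀ x, HasDerivAt d (2 * I * z * d x + c x * d x) x) (h0 : Tendsto d atBot (𝓝 0)) :
    d = 0 := by
  have hcd := hc.mul_of_norm_le hB
  have hdcont : Continuous d := continuous_iff_continuousAt.2 fun x => (hd x).continuousAt
  have hvolterra := eq_volterra_of_hasDerivAt hz
    (hcd.integrable (hcont.mul hdcont).aestronglyMeasurable) hd h0
  have hint : Integrable fun y => C * (1 + y ^ 2)⁻¹ * ‖d y‖ := by
    refine (integrable_inv_one_add_sq.const_mul C).mul_bdd (c := B)
      hdcont.norm.aestronglyMeasurable (ae_of_all _ fun x => ?_)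
    simpa using hB x
  have hnorm : (fun x => ‖d x‖) = 0 := by
    refine eq_zero_of_le_integral_Iic (fun x => norm_nonneg _) hB hC fun x => ?_
    conv_lhs => rw [hvolterra]
    refine norm_volterra_le hz hint.integrableOn fun y => ?_
    rw [norm_mul]
    gcongr
    exact hc y
  exact funext fun x => norm_eq_zero.1 (congrFun hnorm x)

namespace IsJostTriple

variable (hJ : IsJostTriple σ (Q t) (Q' t) z M f g h) (hσ : |σ| = 1)
  (hQ : PotentialFamily Q Q' Q'' C) (hz : 0 ≤ z.im)
include hJ

theorem continuous_f : Continuous f :=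
  continuous_iff_continuousAt.2 fun x => (hJ.deriv_f x).continuousAt

theorem continuous_h : Continuous h :=
  continuous_iff_continuousAt.2 fun x => (hJ.deriv_h x).continuousAt

include hQ

theorem decay_deriv_f : QuadraticDecay (C * M) fun x => -(I / 2) * Q t x * h x := by
  refine QuadraticDecay.mul_of_norm_le (fun x => ?_) hJ.norm_h_le
  refine le_trans ?_ (hQ.decay t x)
  rw [norm_mul]
  exact mul_le_of_le_one_left (norm_nonneg _) (by norm_num)

include hσ

theorem decay_conj_mul_f : QuadraticDecay (C * M) fun x => σ * conj (Q t x) * f x := by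
  refine QuadraticDecay.mul_of_norm_le (fun x => ?_) hJ.norm_f_le
  simpa [hσ] using hQ.decay t x

include hz

theorem rel : h = fun x => 2 * I * z * g x + σ * conj (Q t x) * f x := by
  have hcont : Continuous fun x => I / 2 * (σ * conj (Q t x) * Q t x) :=
    continuous_const.mul (hQ.continuous_density.uncurry_left t)
  have hdecay : QuadraticDecay (C ^ 2) fun x => I / 2 * (σ * conj (Q t x) * Q t x) := fun x => by
    simpa using hQ.decay_half_density hσ t x
  have hdefect := eq_zero_of_hasDerivAt_quadraticDecay_mul hz (pow_pos hQ.pos 2) hcont hdecay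
    (d := fun x => h x - (2 * I * z * g x + σ * conj (Q t x) * f x))
    (B := M + (‖2 * I * z‖ * M + C * M)) (fun x => ?_) (fun x => ?_) ?_
  · exact funext fun x => sub_eq_zero.1 (congrFun hdefect x)
  · refine norm_sub_le_of_le (hJ.norm_h_le x) (norm_add_le_of_le ?_
      ((hJ.decay_conj_mul_f hσ hQ).norm_le x))
    rw [norm_mul]
    gcongr
    exact hJ.norm_g_le x
  · refine ((hJ.deriv_h x).sub (((hJ.deriv_g x).const_mul (2 * I * z)).add
      (((hasDerivAt_conj (hQ.hasDerivAt t x)).const_mul (σ : ℂ)).mul (hJ.deriv_f x)))).congr_deriv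
        ?_
    simp only [jostCoeff]
    ring
  · have hconj := (hJ.decay_conj_mul_f hσ hQ).tendsto_cocompact.mono_left atBot_le_cocompact
    simpa using hJ.lim_h.sub ((hJ.lim_g.const_mul (2 * I * z)).add hconj)

/-- Since `v = 2 i z h + W f` satisfies `v' = 2 i z v + (W f)'`, whose inhomogeneity does not
involve `z`, the bound on `v` does not depend on `z`. -/
theorem norm_mul_norm_h_le (x : ℝ) : ‖z‖ * ‖h x‖ ≤
    ((C + 2 * C ^ 3) * M + (C + C ^ 3) * (C * M)) * Real.pi + (C + C ^ 3) * M := by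
  set W := jostCoeff σ (Q t) (Q' t)
  set W' := jostCoeff' σ (Q t) (Q' t) (Q'' t)
  have hWf := (decay_jostCoeff hσ hQ t).mul_of_norm_le hJ.norm_f_le
  have hψ : QuadraticDecay ((C + 2 * C ^ 3) * M + (C + C ^ 3) * (C * M))
      fun y => W' y * f y + W y * (-(I / 2) * Q t y * h y) :=
    ((decay_jostCoeff' hσ hQ t).mul_of_norm_le hJ.norm_f_le).add
      ((decay_jostCoeff hσ hQ t).mul (hJ.decay_deriv_f hQ))
  have hψ_cont : Continuous fun y => W' y * f y + W y * (-(I / 2) * Q t y * h y) := by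
    have := hQ.continuous_apply t
    have : Continuous W := (continuous_jostCoeff hQ).comp (.prodMk_right t)
    have : Continuous W' := continuous_jostCoeff' hQ t
    have : Continuous f := hJ.continuous_f
    have : Continuous h := hJ.continuous_h
    fun_prop
  have hlim : Tendsto (fun y => 2 * I * z * h y + W y * f y) atBot (𝓝 0) := by
    simpa using (hJ.lim_h.const_mul (2 * I * z)).add
      (hWf.tendsto_cocompact.mono_left atBot_le_cocompact)
  have hv : (fun y => 2 * I * z * h y + W y * f y) = volterra z _ :=
    eq_volterra_of_hasDerivAt hz (hψ.integrable hψ_cont.aestronglyMeasurable)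
      (fun y => ((hJ.deriv_h y).const_mul (2 * I * z)).add
        ((hasDerivAt_jostCoeff hQ t y).mul (hJ.deriv_f y))) hlim
  have hzh : ‖2 * I * z * h x‖ ≤ ((C + 2 * C ^ 3) * M + (C + C ^ 3) * (C * M)) * Real.pi +
      (C + C ^ 3) * M := by
    rw [← add_sub_cancel_right (2 * I * z * h x) (W x * f x)]
    refine norm_sub_le_of_le ?_ (hWf.norm_le x)
    exact (congrFun hv x).symm ▸ norm_volterra_le_pi hz hψ x
  refine le_trans ?_ hzh
  simp only [norm_mul, Complex.norm_ofNat, Complex.norm_I, mul_one]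
  linarith [mul_nonneg (norm_nonneg z) (norm_nonneg (h x))]

theorem norm_mul_norm_f_sub_one_le (x : ℝ) : ‖z‖ * ‖f x - 1‖ ≤
    C * (((C + 2 * C ^ 3) * M + (C + C ^ 3) * (C * M)) * Real.pi + (C + C ^ 3) * M) *
      Real.pi := by
  set E := ((C + 2 * C ^ 3) * M + (C + C ^ 3) * (C * M)) * Real.pi + (C + C ^ 3) * M
  have hcont : Continuous fun y => -(I / 2) * Q t y * h y :=
    (continuous_const.mul (hQ.continuous_apply t)).mul hJ.continuous_h
  have hf : (fun y => f y - 1) = volterra 0 fun y => -(I / 2) * Q t y * h y :=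
    eq_volterra_of_hasDerivAt (by simp)
      ((hJ.decay_deriv_f hQ).integrable hcont.aestronglyMeasurable)
      (fun y => by simpa using hJ.deriv_f y) (by simpa using hJ.lim_f.sub_const 1)
  have hdecay : QuadraticDecay (C * E) fun y => z * (-(I / 2) * Q t y * h y) := fun y => by
    have hzh := (hQ.decay t).mul_of_norm_le (ψ := fun y => z * h y)
      (fun y => (norm_mul_le _ _).trans (hJ.norm_mul_norm_h_le hσ hQ hz y)) y
    refine le_trans ?_ hzh
    simp only [norm_mul, norm_neg, norm_div, Complex.norm_I, Complex.norm_ofNat]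
    linarith [show 0 ≤ ‖z‖ * (‖Q t y‖ * ‖h y‖) by positivity]
  rw [← norm_mul, congrFun hf x, ← volterra_const_mul]
  exact norm_volterra_le_pi (by simp) hdecay x

end IsJostTriple

/-- `f, g, h` are the components of the Jost column normalized at `-∞` for the family `Q`:
`f` and `k g` are its two entries and `h = 2 i z g + σ Q̄ f`, where `z = k²`. -/
structure IsJost (σ : ℝ) (Q : ℝ → ℝ → ℂ) (f g h : ℝ → ℂ → ℝ → ℂ) : Prop where
  cont_f : Continuous fun p : (ℝ × ℂ) × ℝ => f p.1.1 p.1.2 p.2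
  cont_g : Continuous fun p : (ℝ × ℂ) × ℝ => g p.1.1 p.1.2 p.2
  bound : ∃ M, ∀ t z x, ‖f t z x‖ ≤ M ∧ ‖g t z x‖ ≤ M
  deriv_f : ∀ t z x, 0 ≤ z.im → HasDerivAt (f t z)
    (-(I / 2) * (σ * conj (Q t x) * Q t x) * f t z x + z * Q t x * g t z x) x
  deriv_g : ∀ t z x, 0 ≤ z.im → HasDerivAt (g t z)
    (2 * I * z * g t z x + σ * conj (Q t x) * f t z x +
      (I / 2) * (σ * conj (Q t x) * Q t x) * g t z x) x
  rel : ∀ t z x, 0 ≤ z.im → h t z x = 2 * I * z * g t z x + σ * conj (Q t x) * f t z x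
  lim_f : ∀ t z, 0 ≤ z.im → Tendsto (f t z) atBot (𝓝 1)
  lim_g : ∀ t z, 0 ≤ z.im → Tendsto (g t z) atBot (𝓝 0)
  hol_f : ∀ t x, DifferentiableOn ℂ (fun z => f t z x) {z | 0 < z.im}
  hol_g : ∀ t x, DifferentiableOn ℂ (fun z => g t z x) {z | 0 < z.im}
  asymp : ∃ M, ∀ t z x, 0 ≤ z.im → ‖z‖ * ‖h t z x‖ ≤ M ∧ ‖z‖ * ‖f t z x - 1‖ ≤ M

theorem IsJost.of_isJostTriple (hσ : |σ| = 1) (hQ : PotentialFamily Q Q' Q'' C)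
    {m : ℝ × ℂ → ℝ → Fin 3 → ℂ} (hcont : Continuous (Function.uncurry m))
    (hM : ∀ p x, ‖m p x‖ ≤ M)
    (hm : ∀ t z, 0 ≤ z.im →
      IsJostTriple σ (Q t) (Q' t) z M (m (t, z) · 0) (m (t, z) · 1) (m (t, z) · 2))
    (hhol : ∀ t x i, DifferentiableOn ℂ (fun z => m (t, z) x i) {z | 0 < z.im}) :
    IsJost σ Q (fun t z x => m (t, z) x 0) (fun t z x => m (t, z) x 1)
      (fun t z x => m (t, z) x 2) where
  cont_f := (continuous_apply 0).comp hcont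
  cont_g := (continuous_apply 1).comp hcont
  bound := ⟨M, fun _ _ x => ⟨(norm_le_pi_norm _ _).trans (hM _ x),
    (norm_le_pi_norm _ _).trans (hM _ x)⟩⟩
  deriv_f t z x hz := by
    refine ((hm t z hz).deriv_f x).congr_deriv ?_
    rw [congrFun ((hm t z hz).rel hσ hQ hz) x]
    linear_combination (-(z * Q t x * m (t, z) x 1)) * Complex.I_sq
  deriv_g t z x hz := by simpa only [add_assoc] using (hm t z hz).deriv_g x
  rel t z x hz := congrFun ((hm t z hz).rel hσ hQ hz) x
  lim_f t z hz := (hm t z hz).lim_f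
  lim_g t z hz := (hm t z hz).lim_g
  hol_f t x := hhol t x 0
  hol_g t x := hhol t x 1
  asymp := ⟨max _ _, fun t z x hz =>
    ⟨((hm t z hz).norm_mul_norm_h_le hσ hQ hz x).trans (le_max_left _ _),
      ((hm t z hz).norm_mul_norm_f_sub_one_le hσ hQ hz x).trans (le_max_right _ _)⟩⟩

theorem exists_isJost (hσ : |σ| = 1) (hQ : PotentialFamily Q Q' Q'' C) :
    ∃ f g h, IsJost σ Q f g h := by
  have hS := isVolterraSystem_jostMatrix hσ hQ
  obtain ⟨m, hcont, ⟨M, hM⟩, hm, hhol⟩ := hS.exists_solution ![1, 0, 0]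
  have hclamp : DifferentiableOn ℂ clampUpper {z | 0 < z.im} :=
    differentiableOn_id.congr fun z hz => clampUpper_of_nonneg (le_of_lt hz)
  refine ⟨_, _, _, .of_isJostTriple hσ hQ hcont hM
    (fun t z hz => hS.isJostTriple hz (hcont.uncurry_left _) (hM _) (hm _))
    fun t x i => hhol (fun z => (t, z)) _ (isOpen_lt continuous_const continuous_im) ?_
      (fun y i j => differentiableOn_const (jostMatrix σ (Q t) (Q' t) y i j)) x i⟩
  simpa [Fin.forall_fin_succ, jostRate] using hclamp

end JostSolution

section RightJost

variable {σ : ℝ} {Q : ℝ → ℝ → ℂ}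

/-- `c, d, e` are the components of the Jost column normalized at `+∞` for the family `Q`:
`k c` and `d` are its two entries and `e = 2 i z c - Q d`, where `z = k²`. -/
structure IsRightJost (σ : ℝ) (Q : ℝ → ℝ → ℂ) (c d e : ℝ → ℂ → ℝ → ℂ) : Prop where
  cont_c : Continuous fun p : (ℝ × ℂ) × ℝ => c p.1.1 p.1.2 p.2
  cont_d : Continuous fun p : (ℝ × ℂ) × ℝ => d p.1.1 p.1.2 p.2
  bound : ∃ M, ∀ t z x, ‖c t z x‖ ≤ M ∧ ‖d t z x‖ ≤ M
  deriv_c : ∀ t z x, 0 ≤ z.im → HasDerivAt (c t z)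
    (-(2 * I * z * c t z x) - (I / 2) * (σ * conj (Q t x) * Q t x) * c t z x + Q t x * d t z x) x
  deriv_d : ∀ t z x, 0 ≤ z.im → HasDerivAt (d t z)
    (z * (σ * conj (Q t x)) * c t z x + (I / 2) * (σ * conj (Q t x) * Q t x) * d t z x) x
  rel : ∀ t z x, 0 ≤ z.im → e t z x = 2 * I * z * c t z x - Q t x * d t z x
  lim_c : ∀ t z, 0 ≤ z.im → Tendsto (c t z) atTop (𝓝 0)
  lim_d : ∀ t z, 0 ≤ z.im → Tendsto (d t z) atTop (𝓝 1)
  hol_c : ∀ t x, DifferentiableOn ℂ (fun z => c t z x) {z | 0 < z.im}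
  hol_d : ∀ t x, DifferentiableOn ℂ (fun z => d t z x) {z | 0 < z.im}
  asymp : ∃ M, ∀ t z x, 0 ≤ z.im → ‖z‖ * ‖e t z x‖ ≤ M ∧ ‖z‖ * ‖d t z x - 1‖ ≤ M

theorem differentiableOn_conj_neg_conj {F : ℂ → ℂ} (hF : DifferentiableOn ℂ F {z | 0 < z.im}) :
    DifferentiableOn ℂ (fun z => conj (F (-conj z))) {z | 0 < z.im} := by
  have hopen : IsOpen {z : ℂ | 0 < z.im} := isOpen_lt continuous_const Complex.continuous_im
  intro z hz
  have hF_neg : DifferentiableAt ℂ (fun w => F (-w)) (conj z) :=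
    DifferentiableAt.comp (g := F) (f := fun w => -w) (conj z)
      (hF.differentiableAt (hopen.mem_nhds (by simpa using hz))) (by fun_prop)
  have hconj := hF_neg.conj_conj
  rw [Complex.conj_conj] at hconj
  exact hconj.differentiableWithinAt

theorem hasDerivAt_conj_comp_neg {φ : ℝ → ℂ} {φ' : ℂ} {x : ℝ} (h : HasDerivAt φ φ' (-x)) :
    HasDerivAt (fun y => conj (φ (-y))) (-conj φ') x := by
  simpa using hasDerivAt_conj (h.scomp x (hasDerivAt_neg x))

theorem tendsto_conj_comp_neg_atTop {φ : ℝ → ℂ} {l : ℂ} (h : Tendsto φ atBot (𝓝 l)) :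
    Tendsto (fun x => conj (φ (-x))) atTop (𝓝 (conj l)) :=
  (Complex.continuous_conj.tendsto l).comp (h.comp tendsto_neg_atTop_atBot)

/-- The reflection `(x, z) ↦ (-x, -z̄)` followed by conjugation exchanges the two normalizations and
the two signs `σ`. -/
theorem IsJost.reflect (hσ : |σ| = 1) {f g h : ℝ → ℂ → ℝ → ℂ}
    (hJ : IsJost (-σ) (fun t x => Q t (-x)) f g h) :
    IsRightJost σ Q (fun t z x => σ * conj (g t (-conj z) (-x)))
      (fun t z x => conj (f t (-conj z) (-x))) (fun t z x => σ * conj (h t (-conj z) (-x))) where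
  cont_c := by
    have hflip : Continuous fun p : (ℝ × ℂ) × ℝ => ((p.1.1, -conj p.1.2), -p.2) := by fun_prop
    exact continuous_const.mul (Complex.continuous_conj.comp (hJ.cont_g.comp hflip))
  cont_d := by
    have hflip : Continuous fun p : (ℝ × ℂ) × ℝ => ((p.1.1, -conj p.1.2), -p.2) := by fun_prop
    exact Complex.continuous_conj.comp (hJ.cont_f.comp hflip)
  bound := by
    obtain ⟨M, hM⟩ := hJ.bound
    exact ⟨M, fun t z x => by simpa [hσ] using (hM t (-conj z) (-x)).symm⟩
  deriv_c t z x hz := by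
    refine ((hasDerivAt_conj_comp_neg
      (hJ.deriv_g t (-conj z) (-x) (by simpa using hz))).const_mul (σ : ℂ)).congr_deriv ?_
    simp only [map_mul, map_add, map_neg, Complex.conj_conj, Complex.conj_I, neg_neg,
      map_div₀, Complex.conj_ofReal, Complex.ofReal_neg, map_ofNat]
    linear_combination
      (Q t x * conj (f t (-conj z) (-x))) * ofReal_mul_self_of_abs_eq_one hσ
  deriv_d t z x hz := by
    refine (hasDerivAt_conj_comp_neg
      (hJ.deriv_f t (-conj z) (-x) (by simpa using hz))).congr_deriv ?_
    simp only [map_mul, map_add, map_neg, Complex.conj_conj, Complex.conj_I, neg_neg,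
      map_div₀, Complex.conj_ofReal, Complex.ofReal_neg, map_ofNat]
    linear_combination (-(z * conj (Q t x) * conj (g t (-conj z) (-x)))) *
      ofReal_mul_self_of_abs_eq_one hσ
  rel t z x hz := by
    simp only [hJ.rel t (-conj z) (-x) (by simpa using hz), map_mul, map_add, map_neg,
      Complex.conj_conj, Complex.conj_I, Complex.conj_ofReal, Complex.ofReal_neg, neg_neg,
      map_ofNat]
    linear_combination
      (-(Q t x * conj (f t (-conj z) (-x)))) * ofReal_mul_self_of_abs_eq_one hσ
  lim_c t z hz := by
    simpa using (tendsto_conj_comp_neg_atTop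
      (hJ.lim_g t (-conj z) (by simpa using hz))).const_mul (σ : ℂ)
  lim_d t z hz := by
    simpa using tendsto_conj_comp_neg_atTop (hJ.lim_f t (-conj z) (by simpa using hz))
  hol_c t x := (differentiableOn_conj_neg_conj (hJ.hol_g t (-x))).const_mul _
  hol_d t x := differentiableOn_conj_neg_conj (hJ.hol_f t (-x))
  asymp := by
    obtain ⟨M, hM⟩ := hJ.asymp
    refine ⟨M, fun t z x hz => ?_⟩
    have hconj : conj (f t (-conj z) (-x)) - 1 = conj (f t (-conj z) (-x) - 1) := by simp
    simpa only [norm_mul, norm_ofReal_of_abs_eq_one hσ, one_mul, RCLike.norm_conj, norm_neg, hconj]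
      using hM t (-conj z) (-x) (by simpa using hz)

theorem exists_isRightJost (hσ : |σ| = 1) {Q' Q'' : ℝ → ℝ → ℂ} {C : ℝ}
    (hQ : PotentialFamily Q Q' Q'' C) : ∃ c d e, IsRightJost σ Q c d e := by
  obtain ⟨f, g, h, hJ⟩ := exists_isJost (σ := -σ) (by simpa using hσ) hQ.reflect
  exact ⟨_, _, _, hJ.reflect hσ⟩

end RightJost

section AtInfinity

variable {l : Filter ℂ} {φ : ℂ → ℂ} {b : ℂ}

theorem tendsto_zero_of_isBoundedUnder_mul (hl : l ≤ cocompact ℂ)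
    (h : IsBoundedUnder (· ≤ ·) l fun z => ‖z * φ z‖) : Tendsto φ l (𝓝 0) := by
  rw [← Metric.cobounded_eq_cocompact] at hl
  refine ((tendsto_inv₀_cobounded.mono_left hl).zero_mul_isBoundedUnder_le h).congr' ?_
  filter_upwards [hl (Bornology.eventually_ne_cobounded 0)] with z hz
  exact inv_mul_cancel_left₀ hz _

theorem tendsto_zero_of_tendsto_mul (hl : l ≤ cocompact ℂ)
    (h : Tendsto (fun z => 2 * I * (z * φ z)) l (𝓝 b)) : Tendsto φ l (𝓝 0) := by
  refine tendsto_zero_of_isBoundedUnder_mul hl (h.const_mul (2 * I)⁻¹ |>.congr fun z => ?_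
    ).norm.isBoundedUnder_le
  exact inv_mul_cancel_left₀ (mul_ne_zero two_ne_zero I_ne_zero) _

theorem tendsto_of_norm_mul_norm_sub_le {S : Set ℂ} {M : ℝ}
    (h : ∀ z ∈ S, ‖z‖ * ‖φ z - b‖ ≤ M) : Tendsto φ (cocompact ℂ ⊓ 𝓟 S) (𝓝 b) := by
  refine tendsto_sub_nhds_zero_iff.1 (tendsto_zero_of_isBoundedUnder_mul inf_le_left
    ⟨M, eventually_map.2 ?_⟩)
  filter_upwards [mem_inf_of_right (mem_principal_self S)] with z hz
  simpa using h z hz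

end AtInfinity

section Wronskian

theorem eq_of_hasDerivAt_zero {E : Type*} [NormedAddCommGroup E] [NormedSpace ℝ E] {F : ℝ → E}
    (h : ∀ x, HasDerivAt F 0 x) (x y : ℝ) : F x = F y :=
  is_const_of_deriv_eq_zero (fun x => (h x).differentiableAt) (fun x => (h x).deriv) x y

variable {σ : ℝ} {Q : ℝ → ℝ → ℂ} {f g h c d e : ℝ → ℂ → ℝ → ℂ}

namespace IsJost

variable (hJ : IsJost σ Q f g h)
include hJ

theorem tendsto_f (t x : ℝ) :
    Tendsto (fun z => f t z x) (cocompact ℂ ⊓ 𝓟 {z | 0 ≤ z.im}) (𝓝 1) := by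
  obtain ⟨M, hM⟩ := hJ.asymp
  exact tendsto_of_norm_mul_norm_sub_le fun z hz => (hM t z x hz).2

theorem tendsto_h (t x : ℝ) :
    Tendsto (fun z => h t z x) (cocompact ℂ ⊓ 𝓟 {z | 0 ≤ z.im}) (𝓝 0) := by
  obtain ⟨M, hM⟩ := hJ.asymp
  exact tendsto_of_norm_mul_norm_sub_le fun z hz => by simpa using (hM t z x hz).1

theorem tendsto_mul_g (t x : ℝ) :
    Tendsto (fun z => 2 * I * (z * g t z x)) (cocompact ℂ ⊓ 𝓟 {z | 0 ≤ z.im})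
      (𝓝 (-(σ * conj (Q t x)))) := by
  have hlim := (hJ.tendsto_h t x).sub ((hJ.tendsto_f t x).const_mul (σ * conj (Q t x)))
  rw [zero_sub, mul_one] at hlim
  refine hlim.congr' ?_
  filter_upwards [mem_inf_of_right (mem_principal_self _)] with z hz
  rw [hJ.rel t z x hz]
  ring

end IsJost

namespace IsRightJost

variable (hR : IsRightJost σ Q c d e)
include hR

theorem tendsto_d (t x : ℝ) :
    Tendsto (fun z => d t z x) (cocompact ℂ ⊓ 𝓟 {z | 0 ≤ z.im}) (𝓝 1) := by
  obtain ⟨M, hM⟩ := hR.asymp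
  exact tendsto_of_norm_mul_norm_sub_le fun z hz => (hM t z x hz).2

theorem tendsto_e (t x : ℝ) :
    Tendsto (fun z => e t z x) (cocompact ℂ ⊓ 𝓟 {z | 0 ≤ z.im}) (𝓝 0) := by
  obtain ⟨M, hM⟩ := hR.asymp
  exact tendsto_of_norm_mul_norm_sub_le fun z hz => by simpa using (hM t z x hz).1

theorem tendsto_mul_c (t x : ℝ) :
    Tendsto (fun z => 2 * I * (z * c t z x)) (cocompact ℂ ⊓ 𝓟 {z | 0 ≤ z.im}) (𝓝 (Q t x)) := by
  have hlim := (hR.tendsto_e t x).add ((hR.tendsto_d t x).const_mul (Q t x))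
  rw [zero_add, mul_one] at hlim
  refine hlim.congr' ?_
  filter_upwards [mem_inf_of_right (mem_principal_self _)] with z hz
  rw [hR.rel t z x hz]
  ring

theorem normSq_sub_normSq (t l x : ℝ) :
    conj (d t l x) * d t l x - σ * l * (conj (c t l x) * c t l x) = 1 := by
  have hl : 0 ≤ (l : ℂ).im := by simp
  set F : ℝ → ℂ := fun x => conj (d t l x) * d t l x - σ * l * (conj (c t l x) * c t l x)
  have hF (x : ℝ) : HasDerivAt F 0 x := by
    have hc := hR.deriv_c t l x hl
    have hd := hR.deriv_d t l x hl
    refine (((hasDerivAt_conj hd).mul hd).sub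
      (((hasDerivAt_conj hc).mul hc).const_mul (σ * l : ℂ))).congr_deriv ?_
    simp only [map_mul, map_add, map_sub, map_neg, Complex.conj_conj, Complex.conj_I,
      map_div₀, Complex.conj_ofReal, map_ofNat]
    ring
  have hlim : Tendsto F atTop (𝓝 1) := by
    have hc := hR.lim_c t l hl
    have hd := hR.lim_d t l hl
    simpa using (((Complex.continuous_conj.tendsto _).comp hd).mul hd).sub
      ((((Complex.continuous_conj.tendsto _).comp hc).mul hc).const_mul (σ * l : ℂ))
  exact tendsto_nhds_unique
    (tendsto_const_nhds.congr fun y => eq_of_hasDerivAt_zero hF x y) hlim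

end IsRightJost

/-- The function `a`: the Wronskian of the first Jost column at `-∞` and the second one at `+∞`. -/
def wronskianA (f g c d : ℝ → ℂ → ℝ → ℂ) (t : ℝ) (z : ℂ) : ℂ :=
  f t z 0 * d t z 0 - z * g t z 0 * c t z 0

/-- The function `b / k`: up to the factor `k`, the Wronskian of the first Jost columns at `±∞`, for
a real spectral parameter. -/
def wronskianB (σ : ℝ) (f g c d : ℝ → ℂ → ℝ → ℂ) (t : ℝ) (l : ℝ) : ℂ :=
  conj (d t l 0) * g t l 0 - σ * conj (c t l 0) * f t l 0

variable (hJ : IsJost σ Q f g h) (hR : IsRightJost σ Q c d e)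
include hJ hR

theorem wronskianA_eq (t : ℝ) {z : ℂ} (hz : 0 ≤ z.im) (x : ℝ) :
    f t z x * d t z x - z * g t z x * c t z x = wronskianA f g c d t z := by
  refine eq_of_hasDerivAt_zero (F := fun x => f t z x * d t z x - z * g t z x * c t z x)
    (fun x => ?_) x 0
  refine (((hJ.deriv_f t z x hz).mul (hR.deriv_d t z x hz)).sub
    (((hJ.deriv_g t z x hz).const_mul z).mul (hR.deriv_c t z x hz))).congr_deriv ?_
  ring

theorem wronskianB_eq (t l x : ℝ) :
    exp (-(2 * I * l) * x) * (conj (d t l x) * g t l x - σ * conj (c t l x) * f t l x) =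
      wronskianB σ f g c d t l := by
  have hl : 0 ≤ (l : ℂ).im := by simp
  have hconst := eq_of_hasDerivAt_zero (F := fun x : ℝ => exp (-(2 * I * l) * x) *
    (conj (d t l x) * g t l x - σ * conj (c t l x) * f t l x)) (fun x => ?_) x 0
  · simpa [wronskianB] using hconst
  refine ((hasDerivAt_exp_mul_ofReal _ x).mul
    (((hasDerivAt_conj (hR.deriv_d t l x hl)).mul (hJ.deriv_g t l x hl)).sub
      (((hasDerivAt_conj (hR.deriv_c t l x hl)).const_mul (σ : ℂ)).mul
        (hJ.deriv_f t l x hl)))).congr_deriv ?_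
  simp only [map_mul, map_add, map_sub, map_neg, Complex.conj_conj, Complex.conj_I,
    map_div₀, Complex.conj_ofReal, map_ofNat, Pi.sub_apply, Pi.mul_apply]
  ring

theorem exp_mul_wronskianB (t l x : ℝ) : wronskianB σ f g c d t l * exp (2 * I * l * x) =
    conj (d t l x) * g t l x - σ * conj (c t l x) * f t l x := by
  rw [← wronskianB_eq hJ hR t l x, mul_right_comm, ← Complex.exp_add, neg_mul, neg_add_cancel,
    Complex.exp_zero, one_mul]

/- The next two identities are the scattering relation: they express the first Jost column at `-∞`
in the basis of the Jost columns at `+∞`. -/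

theorem jost_first_eq (t l x : ℝ) :
    f t l x = wronskianA f g c d t l * conj (d t l x) +
      l * (wronskianB σ f g c d t l * exp (2 * I * l * x)) * c t l x := by
  rw [← wronskianA_eq hJ hR t (by simp) x, exp_mul_wronskianB hJ hR t l x]
  linear_combination (-f t l x) * hR.normSq_sub_normSq t l x

theorem jost_second_eq (t l x : ℝ) :
    g t l x = wronskianA f g c d t l * (σ * conj (c t l x)) +
      wronskianB σ f g c d t l * exp (2 * I * l * x) * d t l x := by
  rw [← wronskianA_eq hJ hR t (by simp) x, exp_mul_wronskianB hJ hR t l x]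
  linear_combination (-g t l x) * hR.normSq_sub_normSq t l x

theorem continuous_wronskianA (t : ℝ) : Continuous (wronskianA f g c d t) := by
  have hincl : Continuous fun z : ℂ => (((t, z), 0) : (ℝ × ℂ) × ℝ) := by fun_prop
  exact ((hJ.cont_f.comp hincl).mul (hR.cont_d.comp hincl)).sub
    ((continuous_id.mul (hJ.cont_g.comp hincl)).mul (hR.cont_c.comp hincl))

theorem continuous_wronskianB (t : ℝ) : Continuous (wronskianB σ f g c d t) := by
  have hincl : Continuous fun l : ℝ => (((t, (l : ℂ)), 0) : (ℝ × ℂ) × ℝ) := by fun_prop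
  exact ((Complex.continuous_conj.comp (hR.cont_d.comp hincl)).mul (hJ.cont_g.comp hincl)).sub
    ((continuous_const.mul (Complex.continuous_conj.comp (hR.cont_c.comp hincl))).mul
      (hJ.cont_f.comp hincl))

theorem differentiableOn_wronskianA (t : ℝ) :
    DifferentiableOn ℂ (wronskianA f g c d t) {z | 0 < z.im} :=
  ((hJ.hol_f t 0).mul (hR.hol_d t 0)).sub ((differentiableOn_id.mul (hJ.hol_g t 0)).mul
    (hR.hol_c t 0))

theorem tendsto_wronskianA (t : ℝ) :
    Tendsto (wronskianA f g c d t) (cocompact ℂ ⊓ 𝓟 {z | 0 ≤ z.im}) (𝓝 1) := by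
  have hgc := ((hJ.tendsto_mul_g t 0).mul
    (tendsto_zero_of_tendsto_mul inf_le_left (hR.tendsto_mul_c t 0))).const_mul (2 * I)⁻¹
  have hlim := ((hJ.tendsto_f t 0).mul (hR.tendsto_d t 0)).sub hgc
  rw [mul_one, mul_zero, mul_zero, sub_zero] at hlim
  refine hlim.congr fun z => ?_
  have := Complex.I_ne_zero
  rw [wronskianA]
  field_simp

end Wronskian

section Flux

/-- The flux `u_x - i r u²`, `r = σ ū`, of the conservation law `u_t = i (u_x - i r u²)_x` into
which the derivative nonlinear Schrödinger equation can be put. -/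
def flux (σ : ℝ) (u u' : ℝ → ℝ → ℂ) (t x : ℝ) : ℂ :=
  u' t x - I * (σ * conj (u t x) * u t x * u t x)

/-- The `x`-derivative of `flux`, in terms of `u`, `u_x` and `u_xx`. -/
def fluxDeriv (σ : ℝ) (u u' u'' : ℝ → ℝ → ℂ) (t x : ℝ) : ℂ :=
  u'' t x - I * (σ * conj (u' t x) * u t x * u t x + 2 * (σ * conj (u t x) * u t x * u' t x))

/-- The equation `u_t = i (u_x - i r u²)_x` on the time interval `[0, T]`, for a family of
potentials indexed by the time. -/
def IsFluxSolution (σ T : ℝ) (u u' u'' : ℝ → ℝ → ℂ) : Prop :=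
  ∀ x, ∀ t ∈ Set.Icc 0 T,
    HasDerivWithinAt (fun s => u s x) (I * fluxDeriv σ u u' u'' t x) (Set.Icc 0 T) t

namespace IsSolution

variable {σ T : ℝ} {q₀ : ℝ → ℂ} {q : ℝ → ℝ → ℂ}

theorem hasDerivAt (hq : IsSolution σ T q₀ q) {t : ℝ} (ht : t ∈ Set.Icc 0 T) (x : ℝ) :
    HasDerivAt (fun y => q y t) (iteratedDeriv 1 (fun y => q y t) x) x := by
  rw [iteratedDeriv_one]
  exact ((hq.smooth t ht).differentiable (by norm_num) x).hasDerivAt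

theorem hasDerivAt_iteratedDeriv_one (hq : IsSolution σ T q₀ q) {t : ℝ}
    (ht : t ∈ Set.Icc 0 T) (x : ℝ) :
    HasDerivAt (iteratedDeriv 1 (fun y => q y t)) (iteratedDeriv 2 (fun y => q y t) x) x := by
  rw [iteratedDeriv_succ (n := 1)]
  exact ((hq.smooth t ht).differentiable_iteratedDeriv 1 (by norm_num) x).hasDerivAt

theorem hasDerivWithinAt_time (hq : IsSolution σ T q₀ q) (x : ℝ) {t : ℝ}
    (ht : t ∈ Set.Icc 0 T) :
    HasDerivWithinAt (q x)
      (I * fluxDeriv σ (fun s y => q y s) (fun s => iteratedDeriv 1 fun y => q y s)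
        (fun s => iteratedDeriv 2 fun y => q y s) t x) (Set.Icc 0 T) t := by
  have hspace := hq.hasDerivAt ht x
  have hequation := hq.equation x t ht
  have hcubic : HasDerivAt (fun y => σ * conj (q y t) * q y t ^ 2) _ x :=
    ((hasDerivAt_conj hspace).const_mul (σ : ℂ)).fun_mul (hspace.fun_pow 2)
  rw [hcubic.deriv] at hequation
  refine (hq.differentiable_time x t ht).hasDerivWithinAt.congr_deriv ?_
  rw [fluxDeriv]
  push_cast at hequation
  linear_combination (-I) * hequation + derivWithin (fun s => q x s) (Set.Icc 0 T) t * I_sq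

/-- A solution is extended to all times by its values at the end points of the time interval. -/
theorem exists_potentialFamily (hT : 0 ≤ T) (hq : IsSolution σ T q₀ q) :
    ∃ (u u' u'' : ℝ → ℝ → ℂ) (C : ℝ), PotentialFamily u u' u'' C ∧
      (∀ t ∈ Set.Icc 0 T, ∀ x, u t x = q x t) ∧ IsFluxSolution σ T u u' u'' := by
  set clamp : ℝ → ℝ := fun t => Set.projIcc 0 T hT t
  have clamp_mem (t) : clamp t ∈ Set.Icc 0 T := (Set.projIcc 0 T hT t).2
  have clamp_eq {t} (ht : t ∈ Set.Icc 0 T) : clamp t = t :=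
    congrArg Subtype.val (Set.projIcc_of_mem hT ht)
  obtain ⟨C, hC⟩ := hq.decay
  have hcont (j : ℕ) (hj : j ≤ 2) :
      Continuous fun w : ℝ × ℝ => iteratedDeriv j (fun x => q x (clamp w.1)) w.2 :=
    (hq.continuousOn j hj).comp_continuous (f := fun w : ℝ × ℝ => (w.2, clamp w.1))
      (by fun_prop) fun w => ⟨trivial, clamp_mem w.1⟩
  have hdecay (j : ℕ) (hj : j ≤ 2) (t : ℝ) :
      QuadraticDecay (max C 1) (iteratedDeriv j fun y => q y (clamp t)) := by
    refine QuadraticDecay.mono (fun x => ?_) (le_max_left C 1)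
    simpa only [div_eq_mul_inv] using hC j hj _ (clamp_mem t) x
  refine ⟨fun t x => q x (clamp t), fun t => iteratedDeriv 1 fun y => q y (clamp t),
    fun t => iteratedDeriv 2 fun y => q y (clamp t), max C 1, ?_, ?_, ?_⟩
  · exact
    { pos := by positivity
      continuous := by
        simpa only [iteratedDeriv_zero, Function.uncurry_def] using hcont 0 (by norm_num)
      continuous' := hcont 1 (by norm_num)
      continuous'' := fun t => (hq.smooth _ (clamp_mem t)).continuous_iteratedDeriv 2 le_rfl
      hasDerivAt := fun t => hq.hasDerivAt (clamp_mem t)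
      hasDerivAt' := fun t => hq.hasDerivAt_iteratedDeriv_one (clamp_mem t)
      decay := fun t => by simpa only [iteratedDeriv_zero] using hdecay 0 (by norm_num) t
      decay' := hdecay 1 (by norm_num)
      decay'' := hdecay 2 le_rfl }
  · intro t ht x
    simp only [clamp_eq ht]
  · intro x t ht
    simp only [fluxDeriv, clamp_eq ht]
    exact (hq.hasDerivWithinAt_time x ht).congr (fun s hs => by rw [clamp_eq hs])
      (by rw [clamp_eq ht])

end IsSolution

namespace QuadraticDecay

variable {φ ψ : ℝ → ℂ} {C D : ℝ}

theorem sub (hφ : QuadraticDecay C φ) (hψ : QuadraticDecay D ψ) :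
    QuadraticDecay (C + D) fun x => φ x - ψ x := fun x =>
  (norm_sub_le _ _).trans ((add_le_add (hφ x) (hψ x)).trans_eq (add_mul ..).symm)

theorem const_mul (c : ℂ) (h : QuadraticDecay C φ) :
    QuadraticDecay (‖c‖ * C) fun x => c * φ x := fun x => by
  rw [norm_mul, mul_assoc]
  exact mul_le_mul_of_nonneg_left (h x) (norm_nonneg c)

theorem conj_comp (h : QuadraticDecay C φ) :
    QuadraticDecay C fun x => (starRingEnd ℂ) (φ x) := fun x => by
  rw [RCLike.norm_conj]
  exact h x

end QuadraticDecay

namespace PotentialFamily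

variable {σ : ℝ} {u u' u'' : ℝ → ℝ → ℂ} {C : ℝ}

theorem continuous_flux (hu : PotentialFamily u u' u'' C) :
    Continuous (Function.uncurry (flux σ u u')) :=
  hu.continuous'.sub (continuous_const.mul (hu.continuous_density.mul hu.continuous))

theorem hasDerivAt_flux (hu : PotentialFamily u u' u'' C) (t x : ℝ) :
    HasDerivAt (flux σ u u' t) (fluxDeriv σ u u' u'' t x) x := by
  have hu₁ := hu.hasDerivAt t x
  refine ((hu.hasDerivAt' t x).sub (((((hasDerivAt_conj hu₁).const_mul (σ : ℂ)).mul
    hu₁).mul hu₁).const_mul I)).congr_deriv ?_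
  rw [fluxDeriv, Pi.mul_apply]
  ring

theorem decay_flux (hσ : |σ| = 1) (hu : PotentialFamily u u' u'' C) (t : ℝ) :
    QuadraticDecay (C + C ^ 3) (flux σ u u' t) :=
  ((hu.decay' t).sub (((hu.decay_density hσ t).mul (hu.decay t)).const_mul I)).mono
    (le_of_eq (by rw [norm_I]; ring))

theorem continuous_fluxDeriv (hu : PotentialFamily u u' u'' C) (t : ℝ) :
    Continuous (fluxDeriv σ u u' u'' t) := by
  have h := hu.continuous_apply t
  have h' := hu.continuous_apply' t
  have h'' := hu.continuous'' t
  unfold fluxDeriv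
  fun_prop

theorem decay_fluxDeriv (hσ : |σ| = 1) (hu : PotentialFamily u u' u'' C) (t : ℝ) :
    QuadraticDecay (C + 3 * C ^ 3) (fluxDeriv σ u u' u'' t) :=
  ((hu.decay'' t).sub ((((((hu.decay' t).conj_comp.const_mul (σ : ℂ)).mul (hu.decay t)).mul
    (hu.decay t)).add (((hu.decay_density hσ t).mul (hu.decay' t)).const_mul 2)).const_mul
      I)).mono (le_of_eq (by
    rw [norm_I, norm_ofReal_of_abs_eq_one hσ, Complex.norm_ofNat]; ring))

end PotentialFamily

end Flux

section Gauge

theorem phase_eq (σ : ℝ) (u : ℝ → ℂ) (x : ℝ) :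
    phase σ u x = -((leftPhase σ (fun y => u (-y)) (-x) : ℝ) : ℂ) := by
  rw [phase, leftPhase, ← integral_complex_ofReal,
    ← integral_comp_neg_Ioi (f := fun y : ℝ => ((σ * ‖u (-y)‖ ^ 2 / 2 : ℝ) : ℂ))]
  congr 2 with y
  rw [neg_neg, mul_left_comm, mul_assoc _ (u y), Complex.mul_conj']
  push_cast
  ring

theorem conj_phase (σ : ℝ) (u : ℝ → ℂ) (x : ℝ) : conj (phase σ u x) = phase σ u x := by
  rw [phase_eq, map_neg, Complex.conj_ofReal]

theorem norm_exp_mul_phase {c : ℂ} (hc : c.re = 0) (σ : ℝ) (u : ℝ → ℂ) (x : ℝ) :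
    ‖exp (c * phase σ u x)‖ = 1 := by
  rw [phase_eq, Complex.norm_exp]
  simp [hc]

theorem exp_phase_mul_exp_neg_phase (σ : ℝ) (u : ℝ → ℂ) (x : ℝ) :
    exp (2 * I * phase σ u x) * exp (-2 * I * phase σ u x) = 1 := by
  rw [← Complex.exp_add, neg_mul, neg_mul, add_neg_cancel, Complex.exp_zero]

/-- The gauge-transformed potential `u e^{-2 i δ}`, whose `x`-part of the Lax pair has no
diagonal term. -/
def gauge (σ : ℝ) (u : ℝ → ℝ → ℂ) (t x : ℝ) : ℂ := u t x * exp (-2 * I * phase σ (u t) x)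

/-- The first derivative of `gauge`. -/
def gauge' (σ : ℝ) (u u' : ℝ → ℝ → ℂ) (t x : ℝ) : ℂ :=
  flux σ u u' t x * exp (-2 * I * phase σ (u t) x)

/-- The second derivative of `gauge`. -/
def gauge'' (σ : ℝ) (u u' u'' : ℝ → ℝ → ℂ) (t x : ℝ) : ℂ :=
  (fluxDeriv σ u u' u'' t x - I * (σ * conj (u t x) * u t x * flux σ u u' t x)) *
    exp (-2 * I * phase σ (u t) x)

theorem conj_gauge (σ : ℝ) (u : ℝ → ℝ → ℂ) (t x : ℝ) :
    conj (gauge σ u t x) = conj (u t x) * exp (2 * I * phase σ (u t) x) := by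
  rw [gauge, map_mul, ← Complex.exp_conj]
  simp only [map_mul, map_neg, Complex.conj_I, conj_phase, map_ofNat, neg_mul_neg]

theorem gauge_density (σ : ℝ) (u : ℝ → ℝ → ℂ) (t x : ℝ) :
    σ * conj (gauge σ u t x) * gauge σ u t x = σ * conj (u t x) * u t x := by
  rw [conj_gauge, gauge]
  linear_combination (σ * conj (u t x) * u t x) * exp_phase_mul_exp_neg_phase σ (u t) x

theorem norm_gauge (σ : ℝ) (u : ℝ → ℝ → ℂ) (t x : ℝ) : ‖gauge σ u t x‖ = ‖u t x‖ := by
  rw [gauge, norm_mul, norm_exp_mul_phase (by simp), mul_one]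

namespace PotentialFamily

variable {σ : ℝ} {u u' u'' : ℝ → ℝ → ℂ} {C : ℝ}

theorem hasDerivAt_phase (hσ : |σ| = 1) (hu : PotentialFamily u u' u'' C) (t x : ℝ) :
    HasDerivAt (phase σ (u t)) (1 / 2 * (σ * conj (u t x) * u t x)) x := by
  rw [funext (phase_eq σ (u t))]
  refine ((hu.reflect.hasDerivAt_leftPhase hσ t (-x)).scomp x
    (hasDerivAt_neg x)).neg.congr_deriv ?_
  simp

theorem continuous_phase (hσ : |σ| = 1) (hu : PotentialFamily u u' u'' C) :
    Continuous fun w : ℝ × ℝ => phase σ (u w.1) w.2 := by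
  simp only [phase_eq]
  exact ((hu.reflect.continuous_leftPhase hσ).comp
    (by fun_prop : Continuous fun w : ℝ × ℝ => (w.1, -w.2))).neg

theorem tendsto_phase (hσ : |σ| = 1) (hu : PotentialFamily u u' u'' C) (t : ℝ) :
    Tendsto (phase σ (u t)) atTop (𝓝 0) := by
  rw [funext (phase_eq σ (u t))]
  simpa using ((hu.reflect.tendsto_leftPhase hσ t).comp tendsto_neg_atTop_atBot).neg

theorem hasDerivAt_mul_exp_phase (hσ : |σ| = 1) (hu : PotentialFamily u u' u'' C)
    {φ : ℝ → ℂ} {φ' : ℂ} {t x : ℝ} (hφ : HasDerivAt φ φ' x) :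
    HasDerivAt (fun y => φ y * exp (-2 * I * phase σ (u t) y))
      ((φ' - I * (σ * conj (u t x) * u t x * φ x)) * exp (-2 * I * phase σ (u t) x)) x := by
  refine (hφ.mul ((hu.hasDerivAt_phase hσ t x).const_mul (-2 * I)).cexp).congr_deriv ?_
  ring

theorem decay_mul_exp_phase (t : ℝ) {φ : ℝ → ℂ} {D : ℝ} (hφ : QuadraticDecay D φ) :
    QuadraticDecay D fun x => φ x * exp (-2 * I * phase σ (u t) x) := fun x => by
  rw [norm_mul, norm_exp_mul_phase (by simp), mul_one]
  exact hφ x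

theorem gauge (hσ : |σ| = 1) (hu : PotentialFamily u u' u'' C) :
    PotentialFamily (gauge σ u) (gauge' σ u u') (gauge'' σ u u' u'')
      (C + 4 * C ^ 3 + C ^ 5) := by
  have hC := hu.pos
  have hC₃ := pow_pos hC 3
  have hC₅ := pow_pos hC 5
  have hexp : Continuous fun w : ℝ × ℝ => exp (-2 * I * phase σ (u w.1) w.2) :=
    (continuous_const.mul (hu.continuous_phase hσ)).cexp
  have hcorrection (t : ℝ) : QuadraticDecay (C ^ 2 * (C + C ^ 3)) fun x =>
      I * (σ * conj (u t x) * u t x * flux σ u u' t x) := by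
    simpa only [norm_I, one_mul] using
      ((hu.decay_density hσ t).mul (hu.decay_flux hσ t)).const_mul I
  exact
    { pos := by positivity
      continuous := hu.continuous.mul hexp
      continuous' := hu.continuous_flux.mul hexp
      continuous'' := fun t => ((hu.continuous_fluxDeriv t).sub (continuous_const.mul
        ((hu.continuous_density.mul hu.continuous_flux).comp (.prodMk_right t)))).mul
        (hexp.comp (.prodMk_right t))
      hasDerivAt := fun t x => hu.hasDerivAt_mul_exp_phase hσ (hu.hasDerivAt t x)
      hasDerivAt' := fun t x => hu.hasDerivAt_mul_exp_phase hσ (hu.hasDerivAt_flux t x)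
      decay := fun t => (decay_mul_exp_phase t (hu.decay t)).mono (by linarith)
      decay' := fun t => (decay_mul_exp_phase t (hu.decay_flux hσ t)).mono (by linarith)
      decay'' := fun t => (decay_mul_exp_phase t
        ((hu.decay_fluxDeriv hσ t).sub (hcorrection t))).mono (le_of_eq (by ring)) }

end PotentialFamily

end Gauge

section LaxPairing

variable {σ T : ℝ} {u u' u'' : ℝ → ℝ → ℂ} {C : ℝ} {z κ : ℂ} {M M' : ℝ}
  {F G Y₁ Y₂ : ℝ → ℝ → ℂ}

/-- A family, indexed by the time, of solutions `(F, G)` bounded by `M` of the `x`-part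
`F_x = z u G`, `G_x = 2 i z G + r F`, `r = σ ū`, of the Lax pair, normalized to `(1, 0)` at
`-∞`. -/
structure IsLaxColumn (σ : ℝ) (u : ℝ → ℝ → ℂ) (z : ℂ) (M : ℝ) (F G : ℝ → ℝ → ℂ) : Prop where
  norm_F_le : ∀ t x, ‖F t x‖ ≤ M
  norm_G_le : ∀ t x, ‖G t x‖ ≤ M
  continuous_F : ∀ x, Continuous fun t => F t x
  continuous_G : ∀ x, Continuous fun t => G t x
  hasDerivAt_F : ∀ t x, HasDerivAt (F t) (z * u t x * G t x) x
  hasDerivAt_G : ∀ t x, HasDerivAt (G t) (2 * I * z * G t x + σ * conj (u t x) * F t x) x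
  tendsto_F : ∀ t, Tendsto (F t) atBot (𝓝 1)
  tendsto_G : ∀ t, Tendsto (G t) atBot (𝓝 0)

/-- A family, indexed by the time, of bounded row solutions `(Y₁, Y₂)` of the adjoint of the
system of `IsLaxColumn`, whose behaviour at `+∞` does not depend on the time. -/
structure IsLaxRow (σ : ℝ) (u : ℝ → ℝ → ℂ) (z : ℂ) (M : ℝ) (Y₁ Y₂ : ℝ → ℝ → ℂ) : Prop where
  norm_Y₁_le : ∀ t x, ‖Y₁ t x‖ ≤ M
  norm_Y₂_le : ∀ t x, ‖Y₂ t x‖ ≤ M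
  hasDerivAt_Y₁ : ∀ t x, HasDerivAt (Y₁ t) (-(σ * conj (u t x) * Y₂ t x)) x
  hasDerivAt_Y₂ : ∀ t x, HasDerivAt (Y₂ t) (-(z * u t x * Y₁ t x) - 2 * I * z * Y₂ t x) x
  tendsto_Y₁ : ∀ s t, Tendsto (fun x => Y₁ s x - Y₁ t x) atTop (𝓝 0)
  tendsto_Y₂ : ∀ s t, Tendsto (fun x => Y₂ s x - Y₂ t x) atTop (𝓝 0)

/-- The pairing of a row at the time `s` with a column at the time `t`. -/
def laxPairing (Y₁ Y₂ F G : ℝ → ℝ → ℂ) (s t x : ℝ) : ℂ := Y₁ s x * F t x + Y₂ s x * G t x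

/-- The effect of a variation `v` of the potential on the coefficient matrix of the `x`-part of
the Lax pair, between the row `(y₁, y₂)` and the column `(f, g)`. -/
def potentialVariation (σ : ℝ) (z v y₁ y₂ f g : ℂ) : ℂ :=
  y₁ * (z * v) * g + y₂ * (σ * conj v) * f

theorem norm_potentialVariation_le (hσ : |σ| = 1) (v : ℂ) {y₁ y₂ f g : ℂ} (hy₁ : ‖y₁‖ ≤ M')
    (hy₂ : ‖y₂‖ ≤ M') (hf : ‖f‖ ≤ M) (hg : ‖g‖ ≤ M) :
    ‖potentialVariation σ z v y₁ y₂ f g‖ ≤ M' * M * (‖z‖ + 1) * ‖v‖ := by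
  have hM' : 0 ≤ M' := (norm_nonneg _).trans hy₁
  refine (norm_add_le _ _).trans ?_
  simp only [norm_mul, norm_ofReal_of_abs_eq_one hσ, one_mul, RCLike.norm_conj]
  calc ‖y₁‖ * (‖z‖ * ‖v‖) * ‖g‖ + ‖y₂‖ * ‖v‖ * ‖f‖
      ≤ M' * (‖z‖ * ‖v‖) * M + M' * ‖v‖ * M := by gcongr
    _ = M' * M * (‖z‖ + 1) * ‖v‖ := by ring

theorem continuous_of_hasDerivAt {φ φ' : ℝ → ℂ} (h : ∀ x, HasDerivAt φ (φ' x) x) : Continuous φ :=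
  continuous_iff_continuousAt.2 fun x => (h x).continuousAt

theorem tendsto_mul_zero_of_norm_le {l : Filter ℝ} {φ ψ : ℝ → ℂ} (hφ : ∀ x, ‖φ x‖ ≤ M)
    (hψ : Tendsto ψ l (𝓝 0)) : Tendsto (fun x => φ x * ψ x) l (𝓝 0) := by
  simpa only [mul_comm] using hψ.zero_mul_isBoundedUnder_le (isBoundedUnder_of ⟨M, hφ⟩)

section

variable (hF : IsLaxColumn σ u z M F G) (hY : IsLaxRow σ u z M' Y₁ Y₂)
include hF hY

theorem hasDerivAt_laxPairing (s t x : ℝ) :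
    HasDerivAt (laxPairing Y₁ Y₂ F G s t)
      (potentialVariation σ z (u t x - u s x) (Y₁ s x) (Y₂ s x) (F t x) (G t x)) x := by
  refine (((hY.hasDerivAt_Y₁ s x).mul (hF.hasDerivAt_F t x)).add
    ((hY.hasDerivAt_Y₂ s x).mul (hF.hasDerivAt_G t x))).congr_deriv ?_
  rw [potentialVariation, map_sub]
  ring

theorem laxPairing_self_eq (t x y : ℝ) :
    laxPairing Y₁ Y₂ F G t t x = laxPairing Y₁ Y₂ F G t t y :=
  eq_of_hasDerivAt_zero (fun x => (hasDerivAt_laxPairing hF hY t t x).congr_deriv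
    (by simp [potentialVariation])) x y

theorem continuous_potentialVariation {φ : ℝ → ℂ} (hφ : Continuous φ) (s t : ℝ) : Continuous
    fun x => potentialVariation σ z (φ x) (Y₁ s x) (Y₂ s x) (F t x) (G t x) := by
  have hF₁ := continuous_of_hasDerivAt (hF.hasDerivAt_F t)
  have hG₁ := continuous_of_hasDerivAt (hF.hasDerivAt_G t)
  have hY₁ := continuous_of_hasDerivAt (hY.hasDerivAt_Y₁ s)
  have hY₂ := continuous_of_hasDerivAt (hY.hasDerivAt_Y₂ s)
  unfold potentialVariation
  fun_prop

theorem decay_potentialVariation (hσ : |σ| = 1) {φ : ℝ → ℂ} {D : ℝ} (hφ : QuadraticDecay D φ)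
    (s t : ℝ) : QuadraticDecay (M' * M * (‖z‖ + 1) * D)
      fun x => potentialVariation σ z (φ x) (Y₁ s x) (Y₂ s x) (F t x) (G t x) := fun x => by
  have hM := (norm_nonneg _).trans (hF.norm_F_le 0 0)
  have hM' := (norm_nonneg _).trans (hY.norm_Y₁_le 0 0)
  rw [mul_assoc _ D]
  exact (norm_potentialVariation_le hσ _ (hY.norm_Y₁_le s x) (hY.norm_Y₂_le s x)
    (hF.norm_F_le t x) (hF.norm_G_le t x)).trans (by gcongr; exact hφ x)

theorem integrable_potentialVariation (hσ : |σ| = 1) {φ : ℝ → ℂ} {D : ℝ} (hφ : Continuous φ)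
    (hφD : QuadraticDecay D φ) (s t : ℝ) : Integrable
      fun x => potentialVariation σ z (φ x) (Y₁ s x) (Y₂ s x) (F t x) (G t x) :=
  (decay_potentialVariation hF hY hσ hφD s t).integrable
    (continuous_potentialVariation hF hY hφ s t).aestronglyMeasurable

theorem laxPairing_sub_eq_integral (hσ : |σ| = 1) (hu : PotentialFamily u u' u'' C) (s t : ℝ) :
    laxPairing Y₁ Y₂ F G t t 0 - laxPairing Y₁ Y₂ F G s s 0 =
      ∫ x, potentialVariation σ z (u t x - u s x) (Y₁ s x) (Y₂ s x) (F t x) (G t x) := by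
  refine (integral_of_hasDerivAt_of_tendsto (hasDerivAt_laxPairing hF hY s t)
    (integrable_potentialVariation hF hY hσ ((hu.continuous_apply t).sub (hu.continuous_apply s))
      ((hu.decay t).sub (hu.decay s)) s t) ?_ ?_).symm
  · have hFst : Tendsto (fun x => F t x - F s x) atBot (𝓝 0) := by
      simpa using (hF.tendsto_F t).sub (hF.tendsto_F s)
    have hGst : Tendsto (fun x => G t x - G s x) atBot (𝓝 0) := by
      simpa using (hF.tendsto_G t).sub (hF.tendsto_G s)
    refine tendsto_sub_nhds_zero_iff.1 ?_
    have hlim := (tendsto_mul_zero_of_norm_le (hY.norm_Y₁_le s) hFst).add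
      (tendsto_mul_zero_of_norm_le (hY.norm_Y₂_le s) hGst)
    rw [add_zero] at hlim
    refine hlim.congr fun x => ?_
    rw [laxPairing_self_eq hF hY s 0 x, laxPairing, laxPairing]
    ring
  · refine tendsto_sub_nhds_zero_iff.1 ?_
    have hlim := (tendsto_mul_zero_of_norm_le (hF.norm_F_le t) (hY.tendsto_Y₁ s t)).add
      (tendsto_mul_zero_of_norm_le (hF.norm_G_le t) (hY.tendsto_Y₂ s t))
    rw [add_zero] at hlim
    refine hlim.congr fun x => ?_
    rw [laxPairing_self_eq hF hY t 0 x, laxPairing, laxPairing]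
    ring

end

/-- The diagonal entry of the part of the `t`-part of the Lax pair that depends on the potential,
for a potential with value `v`. -/
def laxTime₁₁ (σ : ℝ) (z v : ℂ) : ℂ := -(I * z * (v * (σ * conj v)))

/-- The upper right entry of the `t`-part of the Lax pair, for a potential with value `v` and
derivative `v'`. -/
def laxTime₁₂ (σ : ℝ) (z v v' : ℂ) : ℂ := 2 * z ^ 2 * v + z * (I * v' + v ^ 2 * (σ * conj v))

/-- The lower left entry of the `t`-part of the Lax pair, for a potential with value `v` and
derivative `v'`. -/
def laxTime₂₁ (σ : ℝ) (z v v' : ℂ) : ℂ :=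
  2 * z * (σ * conj v) - I * (σ * conj v') + (σ * conj v) ^ 2 * v

/-- The `t`-part of the Lax pair between the row `(y₁, y₂)` and the column `(f, g)`. -/
def laxTime (σ : ℝ) (z v v' y₁ y₂ f g : ℂ) : ℂ :=
  y₁ * f * laxTime₁₁ σ z v + y₁ * g * laxTime₁₂ σ z v v' + y₂ * f * laxTime₂₁ σ z v v' -
    y₂ * g * laxTime₁₁ σ z v + 4 * I * z ^ 2 * (y₂ * g)

section

variable (hF : IsLaxColumn σ u z M F G) (hY : IsLaxRow σ u z M' Y₁ Y₂)
include hF hY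

/-- The zero curvature equation: the compatibility of the two parts of the Lax pair. -/
theorem hasDerivAt_laxTime (hu : PotentialFamily u u' u'' C) (s x : ℝ) :
    HasDerivAt (fun x => laxTime σ z (u s x) (u' s x) (Y₁ s x) (Y₂ s x) (F s x) (G s x))
      (potentialVariation σ z (I * fluxDeriv σ u u' u'' s x) (Y₁ s x) (Y₂ s x) (F s x) (G s x))
      x := by
  have hv := hu.hasDerivAt s x
  have hv' := hu.hasDerivAt' s x
  have hr := (hasDerivAt_conj hv).const_mul (σ : ℂ)
  have hr' := (hasDerivAt_conj hv').const_mul (σ : ℂ)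
  have h₁₁ : HasDerivAt (fun x => laxTime₁₁ σ z (u s x)) _ x :=
    ((hv.fun_mul hr).const_mul (I * z)).fun_neg
  have h₁₂ : HasDerivAt (fun x => laxTime₁₂ σ z (u s x) (u' s x)) _ x :=
    (hv.const_mul (2 * z ^ 2)).fun_add
      (((hv'.const_mul I).fun_add ((hv.fun_pow 2).fun_mul hr)).const_mul z)
  have h₂₁ : HasDerivAt (fun x => laxTime₂₁ σ z (u s x) (u' s x)) _ x :=
    ((hr.const_mul (2 * z)).fun_sub (hr'.const_mul I)).fun_add ((hr.fun_pow 2).fun_mul hv)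
  have hf := hF.hasDerivAt_F s x
  have hg := hF.hasDerivAt_G s x
  have hy₁ := hY.hasDerivAt_Y₁ s x
  have hy₂ := hY.hasDerivAt_Y₂ s x
  refine ((((((hy₁.mul hf).mul h₁₁).add ((hy₁.mul hg).mul h₁₂)).add
    ((hy₂.mul hf).mul h₂₁)).sub ((hy₂.mul hg).mul h₁₁)).add
    ((hy₂.mul hg).const_mul (4 * I * z ^ 2))).congr_deriv ?_
  simp only [potentialVariation, fluxDeriv, laxTime₁₁, laxTime₁₂, laxTime₂₁, Pi.mul_apply,
    map_add, map_sub, map_mul, Complex.conj_I, Complex.conj_conj, Complex.conj_ofReal, map_ofNat]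
  push_cast
  ring_nf
  simp only [Complex.I_sq]
  ring

theorem tendsto_laxTime_sub {l : Filter ℝ} {s : ℝ} (hu : Tendsto (u s) l (𝓝 0))
    (hu' : Tendsto (u' s) l (𝓝 0)) :
    Tendsto (fun x => laxTime σ z (u s x) (u' s x) (Y₁ s x) (Y₂ s x) (F s x) (G s x) -
      4 * I * z ^ 2 * (Y₂ s x * G s x)) l (𝓝 0) := by
  have hentry {E : ℂ × ℂ → ℂ} (hE : Continuous E) (h0 : E (0, 0) = 0) :
      Tendsto (fun x => E (u s x, u' s x)) l (𝓝 0) :=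
    h0 ▸ (hE.tendsto (0, 0)).comp (hu.prodMk_nhds hu')
  have h₁₁ := hentry (E := fun v => laxTime₁₁ σ z v.1) (by unfold laxTime₁₁; fun_prop)
    (by simp [laxTime₁₁])
  have h₁₂ := hentry (E := fun v => laxTime₁₂ σ z v.1 v.2) (by unfold laxTime₁₂; fun_prop)
    (by simp [laxTime₁₂])
  have h₂₁ := hentry (E := fun v => laxTime₂₁ σ z v.1 v.2) (by unfold laxTime₂₁; fun_prop)
    (by simp [laxTime₂₁])
  have hbdd {φ ψ : ℝ → ℂ} (hφ : ∀ x, ‖φ x‖ ≤ M') (hψ : ∀ x, ‖ψ x‖ ≤ M) (x : ℝ) :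
      ‖φ x * ψ x‖ ≤ M' * M :=
    norm_mul_le_of_le (hφ x) (hψ x)
  have hlim := (((tendsto_mul_zero_of_norm_le (hbdd (hY.norm_Y₁_le s) (hF.norm_F_le s)) h₁₁).add
    (tendsto_mul_zero_of_norm_le (hbdd (hY.norm_Y₁_le s) (hF.norm_G_le s)) h₁₂)).add
    (tendsto_mul_zero_of_norm_le (hbdd (hY.norm_Y₂_le s) (hF.norm_F_le s)) h₂₁)).sub
    (tendsto_mul_zero_of_norm_le (hbdd (hY.norm_Y₂_le s) (hF.norm_G_le s)) h₁₁)
  simp only [add_zero, sub_zero] at hlim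
  refine hlim.congr fun x => ?_
  rw [laxTime, add_sub_cancel_right]

theorem integral_potentialVariation_fluxDeriv (hσ : |σ| = 1) (hu : PotentialFamily u u' u'' C)
    {s : ℝ} {m : ℂ} (hm : Tendsto (fun x => Y₂ s x * G s x) atTop (𝓝 m)) :
    ∫ x, potentialVariation σ z (I * fluxDeriv σ u u' u'' s x) (Y₁ s x) (Y₂ s x) (F s x) (G s x) =
      4 * I * z ^ 2 * m := by
  have htop := (tendsto_laxTime_sub hF hY
    ((hu.decay s).tendsto_cocompact.mono_left atTop_le_cocompact)
    ((hu.decay' s).tendsto_cocompact.mono_left atTop_le_cocompact)).add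
    (hm.const_mul (4 * I * z ^ 2))
  have hbot := (tendsto_laxTime_sub hF hY
    ((hu.decay s).tendsto_cocompact.mono_left atBot_le_cocompact)
    ((hu.decay' s).tendsto_cocompact.mono_left atBot_le_cocompact)).add
    ((tendsto_mul_zero_of_norm_le (hY.norm_Y₂_le s) (hF.tendsto_G s)).const_mul (4 * I * z ^ 2))
  simp only [sub_add_cancel, mul_zero, zero_add] at htop hbot
  rw [integral_of_hasDerivAt_of_tendsto (hasDerivAt_laxTime hF hY hu s)
    (integrable_potentialVariation hF hY hσ ((hu.continuous_fluxDeriv s).const_mul I)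
      ((hu.decay_fluxDeriv hσ s).const_mul I) s s) hbot htop, sub_zero]

end

theorem IsFluxSolution.norm_slope_le (hσ : |σ| = 1) (hu : PotentialFamily u u' u'' C)
    (hut : IsFluxSolution σ T u u' u'') {s t : ℝ} (hs : s ∈ Set.Icc 0 T) (ht : t ∈ Set.Icc 0 T)
    (x : ℝ) : ‖slope (fun r => u r x) s t‖ ≤ (C + 3 * C ^ 3) * (1 + x ^ 2)⁻¹ := by
  have hlip := (convex_Icc (0 : ℝ) T).norm_image_sub_le_of_norm_hasDerivWithin_le
    (fun r hr => hut x r hr)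
    (fun r _ => (norm_mul_le_of_le Complex.norm_I.le (hu.decay_fluxDeriv hσ r x)).trans_eq
      (one_mul _)) hs ht
  have hC := hu.pos
  rw [slope, vsub_eq_sub, norm_smul, norm_inv]
  rcases eq_or_ne t s with rfl | hts
  · simp only [sub_self, norm_zero, mul_zero]
    positivity
  · rwa [inv_mul_le_iff₀ (norm_pos_iff.2 (sub_ne_zero.2 hts)), mul_comm]

section

variable (hF : IsLaxColumn σ u z M F G) (hY : IsLaxRow σ u z M' Y₁ Y₂) (hσ : |σ| = 1)
  (hu : PotentialFamily u u' u'' C)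
include hF hY hσ hu

theorem slope_laxPairing (s t : ℝ) :
    slope (fun t => laxPairing Y₁ Y₂ F G t t 0) s t = ∫ x, potentialVariation σ z
      (slope (fun r => u r x) s t) (Y₁ s x) (Y₂ s x) (F t x) (G t x) := by
  rw [slope_def_module, laxPairing_sub_eq_integral hF hY hσ hu s t, ← integral_smul]
  refine integral_congr_ae (ae_of_all _ fun x => ?_)
  simp only [potentialVariation, slope_def_module, Complex.real_smul, map_mul,
    Complex.conj_ofReal]
  ring

theorem hasDerivWithinAt_laxPairing (hut : IsFluxSolution σ T u u' u'') {s : ℝ}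
    (hs : s ∈ Set.Icc 0 T) {m : ℂ} (hm : Tendsto (fun x => Y₂ s x * G s x) atTop (𝓝 m)) :
    HasDerivWithinAt (fun t => laxPairing Y₁ Y₂ F G t t 0) (4 * I * z ^ 2 * m)
      (Set.Icc 0 T) s := by
  have hM := (norm_nonneg _).trans (hF.norm_F_le 0 0)
  have hM' := (norm_nonneg _).trans (hY.norm_Y₁_le 0 0)
  rw [← integral_potentialVariation_fluxDeriv hF hY hσ hu hm, hasDerivWithinAt_iff_tendsto_slope]
  refine Tendsto.congr (fun t => (slope_laxPairing hF hY hσ hu s t).symm) ?_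
  refine tendsto_integral_filter_of_dominated_convergence
    (fun x => M' * M * (‖z‖ + 1) * ((C + 3 * C ^ 3) * (1 + x ^ 2)⁻¹))
    (Eventually.of_forall fun t => ?_) ?_
    ((integrable_inv_one_add_sq.const_mul _).const_mul _) (ae_of_all _ fun x => ?_)
  · simp only [slope_def_module]
    exact (continuous_potentialVariation hF hY (((hu.continuous_apply t).sub
      (hu.continuous_apply s)).const_smul _) s t).aestronglyMeasurable
  · filter_upwards [self_mem_nhdsWithin] with t ht
    refine ae_of_all _ fun x => (norm_potentialVariation_le hσ _ (hY.norm_Y₁_le s x)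
      (hY.norm_Y₂_le s x) (hF.norm_F_le t x) (hF.norm_G_le t x)).trans ?_
    gcongr
    exact hut.norm_slope_le hσ hu hs ht.1 x
  · have hslope := hasDerivWithinAt_iff_tendsto_slope.1 (hut x s hs)
    have hG := ((hF.continuous_G x).tendsto s).mono_left
      (nhdsWithin_le_nhds (s := Set.Icc 0 T \ {s}))
    have hF' := ((hF.continuous_F x).tendsto s).mono_left
      (nhdsWithin_le_nhds (s := Set.Icc 0 T \ {s}))
    exact (((hslope.const_mul z).const_mul (Y₁ s x)).mul hG).add
      (((((Complex.continuous_conj.tendsto _).comp hslope).const_mul (σ : ℂ)).const_mul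
        (Y₂ s x)).mul hF')

end

theorem eq_exp_mul_of_hasDerivWithinAt {w : ℝ → ℂ} {c : ℂ}
    (hw : ∀ s ∈ Set.Icc 0 T, HasDerivWithinAt w (c * w s) (Set.Icc 0 T) s) {t : ℝ}
    (ht : t ∈ Set.Icc 0 T) : w t = exp (c * t) * w 0 := by
  have hderiv : ∀ s ∈ Set.Icc 0 T,
      HasDerivWithinAt (fun s : ℝ => exp (-c * s) * w s) 0 (Set.Icc 0 T) s := fun s hs =>
    ((hasDerivAt_exp_mul_ofReal (-c) s).hasDerivWithinAt.mul (hw s hs)).congr_deriv (by ring)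
  have hconst := constant_of_has_deriv_right_zero (fun s hs => (hderiv s hs).continuousWithinAt)
    (fun s hs => (hderiv s ⟨hs.1, hs.2.le⟩).mono_of_mem_nhdsWithin (Icc_mem_nhdsGE_of_mem hs)) t ht
  simp only [Complex.ofReal_zero, mul_zero, Complex.exp_zero, one_mul] at hconst
  rw [← hconst, ← mul_assoc, ← Complex.exp_add, neg_mul, add_neg_cancel, Complex.exp_zero, one_mul]

section

variable (hF : IsLaxColumn σ u z M F G) (hY : IsLaxRow σ u z M' Y₁ Y₂) (hσ : |σ| = 1)
  (hu : PotentialFamily u u' u'' C) (hut : IsFluxSolution σ T u u' u'')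
include hF hY hσ hu hut

theorem laxPairing_eq_of_tendsto_Y₂ (hY₂ : ∀ t, Tendsto (Y₂ t) atTop (𝓝 0)) {t : ℝ}
    (ht : t ∈ Set.Icc 0 T) : laxPairing Y₁ Y₂ F G t t 0 = laxPairing Y₁ Y₂ F G 0 0 0 := by
  have hlim (s : ℝ) : Tendsto (fun x => Y₂ s x * G s x) atTop (𝓝 0) := by
    simpa only [mul_comm] using tendsto_mul_zero_of_norm_le (hF.norm_G_le s) (hY₂ s)
  have hevol := eq_exp_mul_of_hasDerivWithinAt (c := 0) (fun s hs =>
    (hasDerivWithinAt_laxPairing hF hY hσ hu hut hs (hlim s)).congr_deriv (by ring)) ht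
  simpa only [zero_mul, Complex.exp_zero, one_mul] using hevol

theorem laxPairing_eq_of_tendsto_Y₁ (hY₁ : ∀ t, Tendsto (Y₁ t) atTop (𝓝 0)) {t : ℝ}
    (ht : t ∈ Set.Icc 0 T) :
    laxPairing Y₁ Y₂ F G t t 0 = exp (4 * I * z ^ 2 * t) * laxPairing Y₁ Y₂ F G 0 0 0 := by
  refine eq_exp_mul_of_hasDerivWithinAt (w := fun t => laxPairing Y₁ Y₂ F G t t 0) (fun s hs =>
    hasDerivWithinAt_laxPairing hF hY hσ hu hut hs ?_) ht
  have hlim : Tendsto (fun x => Y₁ s x * F s x) atTop (𝓝 0) := by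
    simpa only [mul_comm] using tendsto_mul_zero_of_norm_le (hF.norm_F_le s) (hY₁ s)
  have hconst := (tendsto_const_nhds (x := laxPairing Y₁ Y₂ F G s s 0)).sub hlim
  rw [sub_zero] at hconst
  refine hconst.congr fun x => ?_
  rw [laxPairing_self_eq hF hY s 0 x, laxPairing, add_sub_cancel_left]

end

end LaxPairing

section Scattering

variable {σ T : ℝ} {u u' u'' : ℝ → ℝ → ℂ} {C : ℝ} {f g h c d e : ℝ → ℂ → ℝ → ℂ} {z : ℂ} {t : ℝ}

/-- The first entry of the Jost column normalized at `-∞`, in the gauge of the Lax pair. -/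
def leftColumn₁ (σ : ℝ) (u : ℝ → ℝ → ℂ) (f : ℝ → ℂ → ℝ → ℂ) (z : ℂ) (t x : ℝ) : ℂ :=
  exp (I * leftPhase σ (u t) x) * f t z x

/-- The second entry of the Jost column normalized at `-∞`, in the gauge of the Lax pair. -/
def leftColumn₂ (σ : ℝ) (u : ℝ → ℝ → ℂ) (g : ℝ → ℂ → ℝ → ℂ) (z : ℂ) (t x : ℝ) : ℂ :=
  exp (I * leftPhase σ (u t) x) * exp (-2 * I * phase σ (u t) x) * g t z x

/-- The first entry of the Jost column normalized at `+∞`, in the gauge of the Lax pair. -/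
def rightColumn₁ (σ : ℝ) (u : ℝ → ℝ → ℂ) (c : ℝ → ℂ → ℝ → ℂ) (z : ℂ) (t x : ℝ) : ℂ :=
  exp (I * phase σ (u t) x) * c t z x

/-- The second entry of the Jost column normalized at `+∞`, in the gauge of the Lax pair. -/
def rightColumn₂ (σ : ℝ) (u : ℝ → ℝ → ℂ) (d : ℝ → ℂ → ℝ → ℂ) (z : ℂ) (t x : ℝ) : ℂ :=
  exp (-I * phase σ (u t) x) * d t z x

theorem exp_I_mul_exp_neg_two_I (w : ℂ) : exp (I * w) * exp (-2 * I * w) = exp (-I * w) := by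
  rw [← Complex.exp_add]
  ring_nf

theorem exp_neg_I_mul_exp_two_I (w : ℂ) : exp (-I * w) * exp (2 * I * w) = exp (I * w) := by
  rw [← Complex.exp_add]
  ring_nf

section

variable (hσ : |σ| = 1) (hu : PotentialFamily u u' u'' C)
include hσ hu

theorem hasDerivAt_leftColumn₁ (hJ : IsJost σ (gauge σ u) f g h) (hz : 0 ≤ z.im) (t x : ℝ) :
    HasDerivAt (leftColumn₁ σ u f z t) (z * u t x * leftColumn₂ σ u g z t x) x := by
  refine (((hu.hasDerivAt_leftPhase hσ t x).const_mul I).cexp.mul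
    (hJ.deriv_f t z x hz)).congr_deriv ?_
  rw [leftColumn₂, gauge_density, gauge]
  ring

theorem hasDerivAt_leftColumn₂ (hJ : IsJost σ (gauge σ u) f g h) (hz : 0 ≤ z.im) (t x : ℝ) :
    HasDerivAt (leftColumn₂ σ u g z t) (2 * I * z * leftColumn₂ σ u g z t x +
      σ * conj (u t x) * leftColumn₁ σ u f z t x) x := by
  refine ((((hu.hasDerivAt_leftPhase hσ t x).const_mul I).cexp.mul
    ((hu.hasDerivAt_phase hσ t x).const_mul (-2 * I)).cexp).mul
    (hJ.deriv_g t z x hz)).congr_deriv ?_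
  simp only [leftColumn₁, leftColumn₂, Pi.mul_apply]
  rw [gauge_density, conj_gauge]
  linear_combination (exp (I * leftPhase σ (u t) x) * σ * conj (u t x) * f t z x) *
    exp_phase_mul_exp_neg_phase σ (u t) x

theorem exists_isLaxColumn (hJ : IsJost σ (gauge σ u) f g h) (hz : 0 ≤ z.im) :
    ∃ M, IsLaxColumn σ u z M (leftColumn₁ σ u f z) (leftColumn₂ σ u g z) := by
  obtain ⟨M, hM⟩ := hJ.bound
  have hnorm (t x : ℝ) :
      ‖exp (I * leftPhase σ (u t) x) * exp (-2 * I * phase σ (u t) x)‖ = 1 := by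
    rw [norm_mul, Complex.norm_exp_I_mul_ofReal, norm_exp_mul_phase (by simp), one_mul]
  have hθ (x : ℝ) : Continuous fun t => exp (I * leftPhase σ (u t) x) :=
    (continuous_const.mul ((hu.continuous_leftPhase hσ).comp (.prodMk_left x))).cexp
  have hδ (x : ℝ) : Continuous fun t => exp (-2 * I * phase σ (u t) x) :=
    (continuous_const.mul ((hu.continuous_phase hσ).comp (.prodMk_left x))).cexp
  have hincl (x : ℝ) : Continuous fun t : ℝ => ((t, z), x) := by fun_prop
  refine ⟨M, ⟨fun t x => ?_, fun t x => ?_, fun x => (hθ x).mul (hJ.cont_f.comp (hincl x)),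
    fun x => ((hθ x).mul (hδ x)).mul (hJ.cont_g.comp (hincl x)),
    hasDerivAt_leftColumn₁ hσ hu hJ hz, hasDerivAt_leftColumn₂ hσ hu hJ hz, fun t => ?_,
    fun t => tendsto_mul_zero_of_norm_le (fun x => (hnorm t x).le) (hJ.lim_g t z hz)⟩⟩
  · rw [leftColumn₁, norm_mul, Complex.norm_exp_I_mul_ofReal, one_mul]
    exact (hM t z x).1
  · rw [leftColumn₂, norm_mul, hnorm, one_mul]
    exact (hM t z x).2
  · simpa using! ((hu.tendsto_leftPhase hσ t).const_mul I).cexp.mul (hJ.lim_f t z hz)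

theorem hasDerivAt_rightColumn₁ (hR : IsRightJost σ (gauge σ u) c d e) (hz : 0 ≤ z.im)
    (t x : ℝ) : HasDerivAt (rightColumn₁ σ u c z t)
      (u t x * rightColumn₂ σ u d z t x - 2 * I * z * rightColumn₁ σ u c z t x) x := by
  refine (((hu.hasDerivAt_phase hσ t x).const_mul I).cexp.mul
    (hR.deriv_c t z x hz)).congr_deriv ?_
  rw [rightColumn₁, rightColumn₂, gauge_density, gauge]
  linear_combination (u t x * d t z x) * exp_I_mul_exp_neg_two_I (phase σ (u t) x)

theorem hasDerivAt_rightColumn₂ (hR : IsRightJost σ (gauge σ u) c d e) (hz : 0 ≤ z.im)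
    (t x : ℝ) : HasDerivAt (rightColumn₂ σ u d z t)
      (z * (σ * conj (u t x)) * rightColumn₁ σ u c z t x) x := by
  refine (((hu.hasDerivAt_phase hσ t x).const_mul (-I)).cexp.mul
    (hR.deriv_d t z x hz)).congr_deriv ?_
  rw [rightColumn₁, gauge_density, conj_gauge]
  linear_combination (z * σ * conj (u t x) * c t z x) *
    exp_neg_I_mul_exp_two_I (phase σ (u t) x)

theorem tendsto_rightColumn₁ (hR : IsRightJost σ (gauge σ u) c d e) (hz : 0 ≤ z.im) (t : ℝ) :
    Tendsto (rightColumn₁ σ u c z t) atTop (𝓝 0) := by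
  simpa using! ((hu.tendsto_phase hσ t).const_mul I).cexp.mul (hR.lim_c t z hz)

theorem tendsto_rightColumn₂ (hR : IsRightJost σ (gauge σ u) c d e) (hz : 0 ≤ z.im) (t : ℝ) :
    Tendsto (rightColumn₂ σ u d z t) atTop (𝓝 1) := by
  simpa only [mul_zero, Complex.exp_zero, one_mul] using!
    ((hu.tendsto_phase hσ t).const_mul (-I)).cexp.mul (hR.lim_d t z hz)

end

theorem IsRightJost.exists_norm_rightColumn_le {Q : ℝ → ℝ → ℂ} (hR : IsRightJost σ Q c d e) :
    ∃ M, ∀ (u : ℝ → ℝ → ℂ) z t x,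
      ‖rightColumn₁ σ u c z t x‖ ≤ M ∧ ‖rightColumn₂ σ u d z t x‖ ≤ M := by
  obtain ⟨M, hM⟩ := hR.bound
  refine ⟨M, fun u z t x => ?_⟩
  rw [rightColumn₁, rightColumn₂, norm_mul, norm_mul, norm_exp_mul_phase (by simp),
    norm_exp_mul_phase (by simp), one_mul, one_mul]
  exact hM t z x

section

variable (hσ : |σ| = 1) (hu : PotentialFamily u u' u'' C)
  (hR : IsRightJost σ (gauge σ u) c d e)
include hσ hu hR

theorem exists_isLaxRow_wronskianA (hz : 0 ≤ z.im) : ∃ M, IsLaxRow σ u z M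
    (rightColumn₂ σ u d z) (fun t x => -(z * rightColumn₁ σ u c z t x)) := by
  obtain ⟨M, hM⟩ := hR.exists_norm_rightColumn_le
  have hM₀ : 0 ≤ M := (norm_nonneg _).trans (hM u 0 0 0).1
  have hY₁ := tendsto_rightColumn₂ hσ hu hR hz
  have hY₂ (t : ℝ) := ((tendsto_rightColumn₁ hσ hu hR hz t).const_mul z).neg
  refine ⟨(1 + ‖z‖) * M, ⟨fun t x => ?_, fun t x => ?_, fun t x => ?_, fun t x => ?_,
    fun s t => by simpa using (hY₁ s).sub (hY₁ t), fun s t => by simpa using (hY₂ s).sub (hY₂ t)⟩⟩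
  · nlinarith [(hM u z t x).2, norm_nonneg z]
  · rw [norm_neg, norm_mul]
    nlinarith [(hM u z t x).1, norm_nonneg z]
  · exact (hasDerivAt_rightColumn₂ hσ hu hR hz t x).congr_deriv (by ring)
  · exact ((hasDerivAt_rightColumn₁ hσ hu hR hz t x).const_mul z).neg.congr_deriv (by ring)

theorem tendsto_exp_mul_rightColumn₁ (l t : ℝ) : Tendsto (fun x : ℝ =>
    exp (-(2 * I * l) * x) * -(σ * conj (rightColumn₁ σ u c l t x))) atTop (𝓝 0) := by
  refine tendsto_mul_zero_of_norm_le (M := 1) (fun x => ?_) ?_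
  · simp [Complex.norm_exp]
  · simpa using (((Complex.continuous_conj.tendsto _).comp
      (tendsto_rightColumn₁ hσ hu hR (z := l) (by simp) t)).const_mul (σ : ℂ)).neg

theorem exists_isLaxRow_wronskianB (l : ℝ) : ∃ M, IsLaxRow σ u l M
    (fun t x => exp (-(2 * I * l) * x) * -(σ * conj (rightColumn₁ σ u c l t x)))
    (fun t x => exp (-(2 * I * l) * x) * conj (rightColumn₂ σ u d l t x)) := by
  obtain ⟨M, hM⟩ := hR.exists_norm_rightColumn_le
  have hl : 0 ≤ (l : ℂ).im := by simp
  have hosc (x : ℝ) : ‖exp (-(2 * I * l) * x)‖ = 1 := by simp [Complex.norm_exp]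
  have hY₁ := tendsto_exp_mul_rightColumn₁ hσ hu hR l
  have hY₂ (t : ℝ) := (Complex.continuous_conj.tendsto _).comp
    (tendsto_rightColumn₂ hσ hu hR hl t)
  have hc (t x : ℝ) := hasDerivAt_conj (hasDerivAt_rightColumn₁ hσ hu hR hl t x)
  have hd (t x : ℝ) := hasDerivAt_conj (hasDerivAt_rightColumn₂ hσ hu hR hl t x)
  refine ⟨M, ⟨fun t x => ?_, fun t x => ?_, fun t x => ?_, fun t x => ?_,
    fun s t => by simpa using (hY₁ s).sub (hY₁ t), fun s t => ?_⟩⟩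
  · rw [norm_mul, hosc, norm_neg, norm_mul, norm_ofReal_of_abs_eq_one hσ, RCLike.norm_conj,
      one_mul, one_mul]
    exact (hM u l t x).1
  · rw [norm_mul, hosc, RCLike.norm_conj, one_mul]
    exact (hM u l t x).2
  · refine ((hasDerivAt_exp_mul_ofReal _ x).mul ((hc t x).const_mul (σ : ℂ)).fun_neg).congr_deriv ?_
    simp only [map_mul, map_sub, Complex.conj_I, Complex.conj_ofReal, map_ofNat]
    ring
  · refine ((hasDerivAt_exp_mul_ofReal _ x).mul (hd t x)).congr_deriv ?_
    simp only [map_mul, Complex.conj_conj, Complex.conj_ofReal]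
    ring
  · refine (tendsto_mul_zero_of_norm_le (fun x => (hosc x).le)
      (sub_self (conj (1 : ℂ)) ▸ (hY₂ s).sub (hY₂ t))).congr fun x => ?_
    simp only [Function.comp_apply, mul_sub]

end

/-- The ratio of the Wronskians in the gauge of the Lax pair to those of the Jost columns. -/
def gaugeFactor (σ : ℝ) (u : ℝ → ℂ) : ℂ := exp (I * leftPhase σ u 0) * exp (-I * phase σ u 0)

theorem gaugeFactor_ne_zero (σ : ℝ) (u : ℝ → ℂ) : gaugeFactor σ u ≠ 0 :=
  mul_ne_zero (Complex.exp_ne_zero _) (Complex.exp_ne_zero _)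

theorem laxPairing_eq_gaugeFactor_mul_wronskianA (σ : ℝ) (u : ℝ → ℝ → ℂ)
    (f g c d : ℝ → ℂ → ℝ → ℂ) (z : ℂ) (t : ℝ) :
    laxPairing (rightColumn₂ σ u d z) (fun t x => -(z * rightColumn₁ σ u c z t x))
      (leftColumn₁ σ u f z) (leftColumn₂ σ u g z) t t 0 =
        gaugeFactor σ (u t) * wronskianA f g c d t z := by
  rw [laxPairing, leftColumn₁, leftColumn₂, rightColumn₁, rightColumn₂, gaugeFactor, wronskianA]
  linear_combination (-(z * exp (I * leftPhase σ (u t) 0) * g t z 0 * c t z 0)) *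
    exp_I_mul_exp_neg_two_I (phase σ (u t) 0)

theorem laxPairing_eq_gaugeFactor_mul_wronskianB (σ : ℝ) (u : ℝ → ℝ → ℂ)
    (f g c d : ℝ → ℂ → ℝ → ℂ) (l t : ℝ) :
    laxPairing (fun t x => exp (-(2 * I * l) * x) * -(σ * conj (rightColumn₁ σ u c l t x)))
      (fun t x => exp (-(2 * I * l) * x) * conj (rightColumn₂ σ u d l t x))
      (leftColumn₁ σ u f l) (leftColumn₂ σ u g l) t t 0 =
        gaugeFactor σ (u t) * wronskianB σ f g c d t l := by
  rw [laxPairing, leftColumn₁, leftColumn₂, rightColumn₁, rightColumn₂, gaugeFactor, wronskianB]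
  simp only [map_mul, ← Complex.exp_conj, map_neg, Complex.conj_I, conj_phase, neg_neg,
    Complex.ofReal_zero, mul_zero, Complex.exp_zero, one_mul]
  linear_combination (exp (I * leftPhase σ (u t) 0) * g t l 0 * conj (d t l 0)) *
    exp_I_mul_exp_neg_two_I (phase σ (u t) 0)

instance neBot_cocompact_inf_principal_im_nonneg :
    (cocompact ℂ ⊓ 𝓟 {z : ℂ | 0 ≤ z.im}).NeBot := by
  have hlim : Tendsto (fun n : ℕ => (n : ℂ) * I) atTop
      (cocompact ℂ ⊓ 𝓟 {z : ℂ | 0 ≤ z.im}) := by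
    refine tendsto_inf.2 ⟨?_, tendsto_principal.2 (Eventually.of_forall fun n => by simp)⟩
    rw [← Metric.cobounded_eq_cocompact, ← tendsto_norm_atTop_iff_cobounded]
    simpa using tendsto_natCast_atTop_atTop (R := ℝ)
  exact hlim.neBot

section

variable (hσ : |σ| = 1) (hu : PotentialFamily u u' u'' C) (hut : IsFluxSolution σ T u u' u'')
  (hJ : IsJost σ (gauge σ u) f g h) (hR : IsRightJost σ (gauge σ u) c d e)
  (ht : t ∈ Set.Icc 0 T)
include hσ hu hut hJ hR ht

theorem gaugeFactor_mul_wronskianA (hz : 0 ≤ z.im) :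
    gaugeFactor σ (u t) * wronskianA f g c d t z =
      gaugeFactor σ (u 0) * wronskianA f g c d 0 z := by
  obtain ⟨M, hF⟩ := exists_isLaxColumn hσ hu hJ hz
  obtain ⟨M', hY⟩ := exists_isLaxRow_wronskianA hσ hu hR hz
  simp only [← laxPairing_eq_gaugeFactor_mul_wronskianA]
  exact laxPairing_eq_of_tendsto_Y₂ hF hY hσ hu hut (fun s => by
    simpa using ((tendsto_rightColumn₁ hσ hu hR hz s).const_mul z).neg) ht

theorem gaugeFactor_mul_wronskianB (l : ℝ) :
    gaugeFactor σ (u t) * wronskianB σ f g c d t l =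
      exp (4 * I * l ^ 2 * t) * (gaugeFactor σ (u 0) * wronskianB σ f g c d 0 l) := by
  obtain ⟨M, hF⟩ := exists_isLaxColumn hσ hu hJ (z := l) (by simp)
  obtain ⟨M', hY⟩ := exists_isLaxRow_wronskianB hσ hu hR l
  simp only [← laxPairing_eq_gaugeFactor_mul_wronskianB]
  exact laxPairing_eq_of_tendsto_Y₁ hF hY hσ hu hut (tendsto_exp_mul_rightColumn₁ hσ hu hR l) ht

/-- The gauge factor is conserved since `wronskianA` tends to `1` as `z → ∞`. -/
theorem gaugeFactor_eq : gaugeFactor σ (u t) = gaugeFactor σ (u 0) := by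
  have hlim_t := (tendsto_wronskianA hJ hR t).const_mul (gaugeFactor σ (u t))
  have hlim_zero := (tendsto_wronskianA hJ hR 0).const_mul (gaugeFactor σ (u 0))
  rw [mul_one] at hlim_t hlim_zero
  refine tendsto_nhds_unique hlim_t (hlim_zero.congr' ?_)
  filter_upwards [mem_inf_of_right (mem_principal_self _)] with z hz
  exact (gaugeFactor_mul_wronskianA hσ hu hut hJ hR ht hz).symm

theorem wronskianA_evolution (hz : 0 ≤ z.im) : wronskianA f g c d t z = wronskianA f g c d 0 z := by
  have hconserved := gaugeFactor_mul_wronskianA hσ hu hut hJ hR ht hz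
  rw [gaugeFactor_eq hσ hu hut hJ hR ht] at hconserved
  exact mul_left_cancel₀ (gaugeFactor_ne_zero _ _) hconserved

theorem wronskianB_evolution (l : ℝ) :
    wronskianB σ f g c d t l = exp (4 * I * l ^ 2 * t) * wronskianB σ f g c d 0 l := by
  have hevol := gaugeFactor_mul_wronskianB hσ hu hut hJ hR ht l
  rw [gaugeFactor_eq hσ hu hut hJ hR ht, mul_left_comm] at hevol
  exact mul_left_cancel₀ (gaugeFactor_ne_zero _ _) hevol

end

end Scattering

section HalfLine

theorem eq_zero_of_le_integral_Ioi {w : ℝ → ℝ} (h0 : 0 ≤ w) {B C : ℝ}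
    (hB : ∀ x, w x ≤ B) (hC : 0 < C)
    (h : ∀ x, w x ≤ ∫ y in Set.Ioi x, C * (1 + y ^ 2)⁻¹ * w y) : w = 0 := by
  have hreflect : (fun y => w (-y)) = 0 :=
    eq_zero_of_le_integral_Iic (fun y => h0 (-y)) (fun y => hB (-y)) hC fun y => by
      have := integral_comp_neg_Ioi (-y) fun y : ℝ => C * (1 + y ^ 2)⁻¹ * w (-y)
      simp only [neg_neg, neg_sq] at this
      exact (h (-y)).trans_eq this
  ext x
  simpa using congrFun hreflect (-x)

theorem eq_neg_integral_Ioi_of_hasDerivAt {lam : ℂ} (hl : 0 ≤ lam.im) {φ v : ℝ → ℂ}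
    (hi : Integrable φ) (hv : ∀ x, HasDerivAt v (-(2 * I * lam * v x) + φ x) x)
    (h0 : Tendsto v atTop (𝓝 0)) (x : ℝ) :
    v x = -∫ y in Set.Ioi x, exp (2 * I * lam * (y - x)) * φ y := by
  have hreflect := eq_volterra_of_hasDerivAt hl (φ := fun y => -φ (-y)) (v := fun y => v (-y))
    hi.comp_neg.neg
    (fun y => ((hv (-y)).scomp y (hasDerivAt_neg y)).congr_deriv (by simp))
    (h0.comp tendsto_neg_atBot_atTop)
  calc v x = volterra lam (fun y => -φ (-y)) (-x) := by simpa using congrFun hreflect (-x)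
    _ = ∫ y in Set.Ioi x, -(exp (2 * I * lam * (y - x)) * φ y) := by
      rw [volterra, ← integral_comp_neg_Ioi]
      refine integral_congr_ae (ae_of_all _ fun y => ?_)
      push_cast
      ring_nf
    _ = -∫ y in Set.Ioi x, exp (2 * I * lam * (y - x)) * φ y := integral_neg _

end HalfLine

section JostColumn

variable {σ : ℝ} {u u' u'' : ℝ → ℝ → ℂ} {C : ℝ} {t : ℝ} {k : ℂ} {j : Fin 2}

theorem V₁_mulVec (σ : ℝ) (u : ℝ → ℝ → ℂ) (t : ℝ) (k : ℂ) (x : ℝ) (w : Fin 2 → ℂ) :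
    (V₁ σ (u t) k x).mulVec w =
      ![-(I / 2) * (σ * conj (gauge σ u t x) * gauge σ u t x) * w 0 + k * gauge σ u t x * w 1,
        k * (σ * conj (gauge σ u t x)) * w 0 +
          (I / 2) * (σ * conj (gauge σ u t x) * gauge σ u t x) * w 1] := by
  rw [gauge_density, conj_gauge, gauge]
  ext i
  fin_cases i <;>
  · simp only [V₁, Matrix.mulVec, dotProduct, Fin.sum_univ_two, Matrix.of_apply, Fin.zero_eta,
      Fin.mk_one, Matrix.cons_val_zero, Matrix.cons_val_one, Matrix.cons_val',
      Matrix.cons_val_fin_one]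
    ring

theorem pauli_sub_mul_one (i j : Fin 2) :
    (pauli i - pauli j) * (1 : Matrix (Fin 2) (Fin 2) ℂ) i j = 0 := by
  rcases eq_or_ne i j with rfl | hij
  · rw [sub_self, zero_mul]
  · rw [Matrix.one_apply_ne hij, mul_zero]

theorem norm_exp_pauli_le {k p : ℂ} {x y : ℝ} (h : (k ^ 2 * p).im * (x - y) ≤ 0) :
    ‖exp (-I * k ^ 2 * (x - y) * p)‖ ≤ 1 := by
  have hexp : -I * k ^ 2 * (x - y) * p = -I * (k ^ 2 * p) * (x - y : ℝ) := by push_cast; ring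
  rw [hexp, Complex.norm_exp, Real.exp_le_one_iff, re_mul_ofReal]
  simpa using h

section

variable (hσ : |σ| = 1) (hu : PotentialFamily u u' u'' C)
include hσ hu

theorem norm_V₁_mulVec_le (t : ℝ) (k : ℂ) (x : ℝ) (w : Fin 2 → ℂ) :
    ‖(V₁ σ (u t) k x).mulVec w‖ ≤ (C ^ 2 + ‖k‖ * C) * (1 + x ^ 2)⁻¹ * ‖w‖ := by
  have hC := hu.pos
  have hdiag (i : Fin 2) : 1 / 2 * (‖u t x‖ * ‖u t x‖) * ‖w i‖ ≤ C ^ 2 * (1 + x ^ 2)⁻¹ * ‖w‖ := by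
    have hprod : ‖u t x‖ * ‖u t x‖ ≤ C * (C * (1 + x ^ 2)⁻¹) := by
      gcongr
      exacts [hu.norm_le t x, hu.decay t x]
    gcongr ?_ * ?_
    · nlinarith [mul_nonneg (norm_nonneg (u t x)) (norm_nonneg (u t x))]
    · exact norm_le_pi_norm w i
  have hoff (i : Fin 2) : ‖k‖ * ‖u t x‖ * ‖w i‖ ≤ ‖k‖ * (C * (1 + x ^ 2)⁻¹) * ‖w‖ := by
    gcongr
    exacts [hu.decay t x, norm_le_pi_norm w i]
  have hσ' := norm_ofReal_of_abs_eq_one hσ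
  rw [V₁_mulVec]
  refine (pi_norm_le_iff_of_nonneg (by positivity)).2 (Fin.forall_fin_two.2 ⟨?_, ?_⟩)
  all_goals
    simp only [Matrix.cons_val_zero, Matrix.cons_val_one, Matrix.cons_val_fin_one]
    refine (norm_add_le _ _).trans ?_
    simp only [norm_mul, norm_neg, norm_div, Complex.norm_I, Complex.norm_ofNat, hσ', one_mul,
      RCLike.norm_conj, norm_gauge]
    linarith [hdiag 0, hdiag 1, hoff 0, hoff 1]

theorem continuous_V₁_mulVec {m : ℝ → Fin 2 → ℂ} (hm : Continuous m) :
    Continuous fun x => (V₁ σ (u t) k x).mulVec (m x) := by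
  have hQ := (hu.gauge hσ).continuous_apply t
  simp only [V₁_mulVec]
  fun_prop

theorem decay_V₁_mulVec {m : ℝ → Fin 2 → ℂ} {B : ℝ} (hB : ∀ x, ‖m x‖ ≤ B) :
    QuadraticDecay ((C ^ 2 + ‖k‖ * C) * B) fun x => (V₁ σ (u t) k x).mulVec (m x) := by
  have hC := hu.pos
  intro x
  calc ‖(V₁ σ (u t) k x).mulVec (m x)‖ ≤ (C ^ 2 + ‖k‖ * C) * (1 + x ^ 2)⁻¹ * B :=
        (norm_V₁_mulVec_le hσ hu t k x (m x)).trans (by gcongr; exact hB x)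
    _ = (C ^ 2 + ‖k‖ * C) * B * (1 + x ^ 2)⁻¹ := by ring

theorem integrable_V₁_mulVec {m : ℝ → Fin 2 → ℂ} (hm : Continuous m) {B : ℝ}
    (hB : ∀ x, ‖m x‖ ≤ B) : Integrable fun x => (V₁ σ (u t) k x).mulVec (m x) :=
  (decay_V₁_mulVec hσ hu hB).integrable (continuous_V₁_mulVec hσ hu hm).aestronglyMeasurable

theorem norm_integral_V₁_mulVec_sub_le {m m' : ℝ → Fin 2 → ℂ} (hm : Continuous m) {B : ℝ}
    (hB : ∀ x, ‖m x‖ ≤ B) (hm' : Continuous m') {B' : ℝ} (hB' : ∀ x, ‖m' x‖ ≤ B') {s : Set ℝ}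
    (hs : MeasurableSet s) {E : ℝ → ℂ} (hE : Continuous E) (hE1 : ∀ y ∈ s, ‖E y‖ ≤ 1)
    (i : Fin 2) :
    ‖(∫ y in s, E y * (V₁ σ (u t) k y).mulVec (m y) i) -
      ∫ y in s, E y * (V₁ σ (u t) k y).mulVec (m' y) i‖ ≤
      ∫ y in s, (C ^ 2 + ‖k‖ * C) * (1 + y ^ 2)⁻¹ * ‖m y - m' y‖ := by
  have hintegrable {n : ℝ → Fin 2 → ℂ} {D : ℝ} (hn : Continuous n) (hD : ∀ x, ‖n x‖ ≤ D) :
      IntegrableOn (fun y => E y * (V₁ σ (u t) k y).mulVec (n y) i) s :=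
    ((integrable_V₁_mulVec hσ hu hn hD).eval i).integrableOn.bdd_mul
      hE.aestronglyMeasurable (ae_restrict_of_forall_mem hs hE1)
  have hmajorant : Integrable fun y : ℝ => (C ^ 2 + ‖k‖ * C) * (1 + y ^ 2)⁻¹ * ‖m y - m' y‖ :=
    (integrable_inv_one_add_sq.const_mul _).mul_bdd (c := B + B')
      (hm.sub hm').norm.aestronglyMeasurable
      (ae_of_all _ fun y => by
        rw [norm_norm]
        exact norm_sub_le_of_le (hB y) (hB' y))
  rw [← integral_sub (hintegrable hm hB) (hintegrable hm' hB')]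
  refine norm_integral_le_of_norm_le hmajorant.integrableOn
    (ae_restrict_of_forall_mem hs fun y hy => ?_)
  rw [← mul_sub, norm_mul, ← Pi.sub_apply, ← Matrix.mulVec_sub]
  exact (mul_le_of_le_one_left (norm_nonneg _) (hE1 y hy)).trans
    ((norm_le_pi_norm _ i).trans (norm_V₁_mulVec_le hσ hu t k y _))

theorem isJostColumn₂_unique (hk : ∀ i, (k ^ 2 * (pauli i - pauli j)).im ≤ 0)
    {m m' : ℝ → Fin 2 → ℂ} (hm : IsJostColumn₂ σ (u t) k j m)
    (hm' : IsJostColumn₂ σ (u t) k j m') : m = m' := by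
  obtain ⟨hc, ⟨B, hB⟩, h⟩ := hm
  obtain ⟨hc', ⟨B', hB'⟩, h'⟩ := hm'
  have hC := hu.pos
  have hzero : (fun x => ‖m x - m' x‖) = 0 := by
    refine eq_zero_of_le_integral_Iic (B := B + B') (C := C ^ 2 + ‖k‖ * C)
      (fun x => norm_nonneg _) (fun x => norm_sub_le_of_le (hB x) (hB' x))
      (by positivity) (fun x => ?_)
    refine (pi_norm_le_iff_of_nonneg (integral_nonneg fun y => by positivity)).2 fun i => ?_
    rw [Pi.sub_apply, h, h', add_sub_add_left_eq_sub]
    exact norm_integral_V₁_mulVec_sub_le hσ hu hc hB hc' hB' measurableSet_Iic (by fun_prop)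
      (fun y hy => norm_exp_pauli_le (mul_nonpos_of_nonpos_of_nonneg (hk i) (sub_nonneg.2 hy))) i
  ext1 x
  simpa [sub_eq_zero] using congrFun hzero x

theorem isJostColumn₁_unique (hk : ∀ i, 0 ≤ (k ^ 2 * (pauli i - pauli j)).im)
    {m m' : ℝ → Fin 2 → ℂ} (hm : IsJostColumn₁ σ (u t) k j m)
    (hm' : IsJostColumn₁ σ (u t) k j m') : m = m' := by
  obtain ⟨hc, ⟨B, hB⟩, h⟩ := hm
  obtain ⟨hc', ⟨B', hB'⟩, h'⟩ := hm'
  have hC := hu.pos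
  have hzero : (fun x => ‖m x - m' x‖) = 0 := by
    refine eq_zero_of_le_integral_Ioi (B := B + B') (C := C ^ 2 + ‖k‖ * C)
      (fun x => norm_nonneg _) (fun x => norm_sub_le_of_le (hB x) (hB' x))
      (by positivity) (fun x => ?_)
    refine (pi_norm_le_iff_of_nonneg (integral_nonneg fun y => by positivity)).2 fun i => ?_
    rw [Pi.sub_apply, h, h', sub_sub_sub_cancel_left, norm_sub_rev]
    exact norm_integral_V₁_mulVec_sub_le hσ hu hc hB hc' hB' measurableSet_Ioi (by fun_prop)
      (fun y hy => norm_exp_pauli_le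
        (mul_nonpos_of_nonneg_of_nonpos (hk i) (sub_nonpos.2 (le_of_lt hy)))) i
  ext1 x
  simpa [sub_eq_zero] using congrFun hzero x

theorem isJostColumn₂_of_hasDerivAt (hk : ∀ i, (k ^ 2 * (pauli i - pauli j)).im ≤ 0)
    {m : ℝ → Fin 2 → ℂ} {B : ℝ} (hB : ∀ x, ‖m x‖ ≤ B)
    (hderiv : ∀ i x, HasDerivAt (fun x => m x i)
      (-I * k ^ 2 * (pauli i - pauli j) * m x i + (V₁ σ (u t) k x).mulVec (m x) i) x)
    (hlim : ∀ i, Tendsto (fun x => m x i) atBot (𝓝 ((1 : Matrix (Fin 2) (Fin 2) ℂ) i j))) :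
    IsJostColumn₂ σ (u t) k j m := by
  have hcont : Continuous m :=
    continuous_pi fun i => continuous_iff_continuousAt.2 fun x => (hderiv i x).continuousAt
  refine ⟨hcont, ⟨B, hB⟩, fun x i => ?_⟩
  have hv := eq_volterra_of_hasDerivAt (lam := -(k ^ 2 * (pauli i - pauli j)) / 2)
    (by rw [div_ofNat_im, neg_im]; linarith [hk i])
    ((integrable_V₁_mulVec hσ hu hcont hB).eval i)
    (fun x => ((hderiv i x).sub_const ((1 : Matrix (Fin 2) (Fin 2) ℂ) i j)).congr_deriv (by
      linear_combination (-I * k ^ 2) * pauli_sub_mul_one i j))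
    (by simpa using (hlim i).sub_const ((1 : Matrix (Fin 2) (Fin 2) ℂ) i j))
  rw [← sub_eq_iff_eq_add', congrFun hv x, volterra]
  refine integral_congr_ae (ae_of_all _ fun y => ?_)
  ring_nf

theorem isJostColumn₁_of_hasDerivAt (hk : ∀ i, 0 ≤ (k ^ 2 * (pauli i - pauli j)).im)
    {m : ℝ → Fin 2 → ℂ} {B : ℝ} (hB : ∀ x, ‖m x‖ ≤ B)
    (hderiv : ∀ i x, HasDerivAt (fun x => m x i)
      (-I * k ^ 2 * (pauli i - pauli j) * m x i + (V₁ σ (u t) k x).mulVec (m x) i) x)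
    (hlim : ∀ i, Tendsto (fun x => m x i) atTop (𝓝 ((1 : Matrix (Fin 2) (Fin 2) ℂ) i j))) :
    IsJostColumn₁ σ (u t) k j m := by
  have hcont : Continuous m :=
    continuous_pi fun i => continuous_iff_continuousAt.2 fun x => (hderiv i x).continuousAt
  refine ⟨hcont, ⟨B, hB⟩, fun x i => ?_⟩
  have hv := eq_neg_integral_Ioi_of_hasDerivAt (lam := k ^ 2 * (pauli i - pauli j) / 2)
    (by rw [div_ofNat_im]; linarith [hk i])
    ((integrable_V₁_mulVec hσ hu hcont hB).eval i)
    (fun x => ((hderiv i x).sub_const ((1 : Matrix (Fin 2) (Fin 2) ℂ) i j)).congr_deriv (by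
      linear_combination (-I * k ^ 2) * pauli_sub_mul_one i j))
    (by simpa using (hlim i).sub_const ((1 : Matrix (Fin 2) (Fin 2) ℂ) i j)) x
  rw [sub_eq_add_neg, ← sub_eq_iff_eq_add', hv]
  refine congrArg Neg.neg (integral_congr_ae (ae_of_all _ fun y => ?_))
  ring_nf

end

theorem im_mul_pauli_sub_zero_nonpos {w : ℂ} (hw : 0 ≤ w.im) (i : Fin 2) :
    (w * (pauli i - pauli 0)).im ≤ 0 := by
  fin_cases i
  · simp [pauli]
  · norm_num [pauli]
    linarith

theorem im_mul_pauli_sub_one_nonneg {w : ℂ} (hw : 0 ≤ w.im) (i : Fin 2) :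
    0 ≤ (w * (pauli i - pauli 1)).im := by
  fin_cases i
  · norm_num [pauli]
    linarith
  · simp [pauli]

theorem norm_vecCons_le {a b : ℂ} {A B : ℝ} (ha : ‖a‖ ≤ A) (hb : ‖b‖ ≤ B) :
    ‖(![a, b] : Fin 2 → ℂ)‖ ≤ max A B :=
  (pi_norm_le_iff_of_nonneg ((norm_nonneg a).trans (ha.trans (le_max_left A B)))).2 <|
    Fin.forall_fin_two.2 ⟨ha.trans (le_max_left A B), hb.trans (le_max_right A B)⟩

variable {f g h c d e : ℝ → ℂ → ℝ → ℂ}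
variable (hσ : |σ| = 1) (hu : PotentialFamily u u' u'' C)
include hσ hu

theorem isJostColumn₂_zero (hJ : IsJost σ (gauge σ u) f g h) (hk : 0 ≤ (k ^ 2).im) :
    IsJostColumn₂ σ (u t) k 0 fun x => ![f t (k ^ 2) x, k * g t (k ^ 2) x] := by
  obtain ⟨M, hM⟩ := hJ.bound
  refine isJostColumn₂_of_hasDerivAt hσ hu (im_mul_pauli_sub_zero_nonpos hk)
    (fun x => norm_vecCons_le (hM t _ x).1 (norm_mul_le_of_le le_rfl (hM t _ x).2))
    (Fin.forall_fin_two.2 ⟨fun x => (hJ.deriv_f t _ x hk).congr_deriv ?_,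
      fun x => ((hJ.deriv_g t _ x hk).const_mul k).congr_deriv ?_⟩)
    (Fin.forall_fin_two.2 ⟨hJ.lim_f t _ hk, by simpa using (hJ.lim_g t _ hk).const_mul k⟩)
  all_goals
    simp only [V₁_mulVec, pauli, Matrix.cons_val_zero, Matrix.cons_val_one,
      Matrix.cons_val_fin_one, one_ne_zero, if_true, if_false]
    ring

theorem isJostColumn₁_one (hR : IsRightJost σ (gauge σ u) c d e) (hk : 0 ≤ (k ^ 2).im) :
    IsJostColumn₁ σ (u t) k 1 fun x => ![k * c t (k ^ 2) x, d t (k ^ 2) x] := by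
  obtain ⟨M, hM⟩ := hR.bound
  refine isJostColumn₁_of_hasDerivAt hσ hu (im_mul_pauli_sub_one_nonneg hk)
    (fun x => norm_vecCons_le (norm_mul_le_of_le le_rfl (hM t _ x).1) (hM t _ x).2)
    (Fin.forall_fin_two.2 ⟨fun x => ((hR.deriv_c t _ x hk).const_mul k).congr_deriv ?_,
      fun x => (hR.deriv_d t _ x hk).congr_deriv ?_⟩)
    (Fin.forall_fin_two.2 ⟨by simpa using (hR.lim_c t _ hk).const_mul k, hR.lim_d t _ hk⟩)
  all_goals
    simp only [V₁_mulVec, pauli, Matrix.cons_val_zero, Matrix.cons_val_one,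
      Matrix.cons_val_fin_one, one_ne_zero, if_true, if_false]
    ring

theorem isJostColumn₁_zero (hR : IsRightJost σ (gauge σ u) c d e) {l : ℝ} (hk : k ^ 2 = l) :
    IsJostColumn₁ σ (u t) k 0 fun x => ![conj (d t l x), k * (σ * conj (c t l x))] := by
  have hl : 0 ≤ (l : ℂ).im := by simp
  have hσ' := norm_ofReal_of_abs_eq_one hσ
  obtain ⟨M, hM⟩ := hR.bound
  have hlim_c : Tendsto (fun x => conj (c t l x)) atTop (𝓝 0) := by
    simpa using! (Complex.continuous_conj.tendsto _).comp (hR.lim_c t l hl)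
  have hlim_d : Tendsto (fun x => conj (d t l x)) atTop (𝓝 1) := by
    simpa using! (Complex.continuous_conj.tendsto _).comp (hR.lim_d t l hl)
  refine isJostColumn₁_of_hasDerivAt (B := max M (‖k‖ * M)) hσ hu (fun i => ?_)
    (fun x => norm_vecCons_le ?_ ?_)
    (Fin.forall_fin_two.2 ⟨fun x => (hasDerivAt_conj (hR.deriv_d t l x hl)).congr_deriv ?_,
      fun x => (((hasDerivAt_conj (hR.deriv_c t l x hl)).const_mul (σ : ℂ)).const_mul
        k).congr_deriv ?_⟩)
    (Fin.forall_fin_two.2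
      ⟨hlim_d, by simpa using (hlim_c.const_mul (σ : ℂ)).const_mul k⟩)
  · fin_cases i <;> simp [hk, pauli]
  · simpa only [RCLike.norm_conj] using (hM t l x).2
  · rw [norm_mul, norm_mul, hσ', one_mul, RCLike.norm_conj]
    gcongr
    exact (hM t l x).1
  all_goals
    simp only [V₁_mulVec, pauli, Matrix.cons_val_zero, Matrix.cons_val_one,
      Matrix.cons_val_fin_one, one_ne_zero, if_true, if_false, map_mul, map_add, map_sub, map_neg,
      Complex.conj_conj, Complex.conj_I, map_div₀, Complex.conj_ofReal, map_ofNat]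
  · linear_combination (-(σ * gauge σ u t x * conj (c t l x))) * hk
  · linear_combination (2 * I * k * σ * conj (c t l x)) * -hk

theorem μ₂_zero_eq (hJ : IsJost σ (gauge σ u) f g h) (hk : 0 ≤ (k ^ 2).im) (x : ℝ) :
    μ₂ σ (u t) k x 0 0 = f t (k ^ 2) x ∧ μ₂ σ (u t) k x 1 0 = k * g t (k ^ 2) x := by
  have hcol := isJostColumn₂_zero (t := t) hσ hu hJ hk
  have huniq := isJostColumn₂_unique hσ hu (im_mul_pauli_sub_zero_nonpos hk)
    (Classical.epsilon_spec ⟨_, hcol⟩) hcol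
  simp [μ₂, huniq]

theorem μ₁_one_eq (hR : IsRightJost σ (gauge σ u) c d e) (hk : 0 ≤ (k ^ 2).im) (x : ℝ) :
    μ₁ σ (u t) k x 0 1 = k * c t (k ^ 2) x ∧ μ₁ σ (u t) k x 1 1 = d t (k ^ 2) x := by
  have hcol := isJostColumn₁_one (t := t) hσ hu hR hk
  have huniq := isJostColumn₁_unique hσ hu (im_mul_pauli_sub_one_nonneg hk)
    (Classical.epsilon_spec ⟨_, hcol⟩) hcol
  simp [μ₁, huniq]

theorem μ₁_zero_eq (hR : IsRightJost σ (gauge σ u) c d e) {l : ℝ} (hk : k ^ 2 = l) (x : ℝ) :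
    μ₁ σ (u t) k x 0 0 = conj (d t l x) ∧ μ₁ σ (u t) k x 1 0 = k * (σ * conj (c t l x)) := by
  have hcol := isJostColumn₁_zero (t := t) hσ hu hR hk
  have huniq := isJostColumn₁_unique hσ hu (fun i => by fin_cases i <;> simp [hk, pauli])
    (Classical.epsilon_spec ⟨_, hcol⟩) hcol
  simp [μ₁, huniq]

theorem a_eq_wronskianA (hJ : IsJost σ (gauge σ u) f g h) (hR : IsRightJost σ (gauge σ u) c d e)
    (hk : 0 ≤ (k ^ 2).im) : a σ (u t) k = wronskianA f g c d t (k ^ 2) := by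
  obtain ⟨h00, h10⟩ := μ₂_zero_eq (t := t) hσ hu hJ hk 0
  obtain ⟨h01, h11⟩ := μ₁_one_eq (t := t) hσ hu hR hk 0
  rw [a, h00, h10, h01, h11, wronskianA]
  ring

theorem r_eq_wronskianB_div (hJ : IsJost σ (gauge σ u) f g h)
    (hR : IsRightJost σ (gauge σ u) c d e) {l : ℝ} (hk : k ^ 2 = l) :
    r σ (u t) k = k * wronskianB σ f g c d t l / wronskianA f g c d t l := by
  have hk' : 0 ≤ (k ^ 2).im := by simp [hk]
  obtain ⟨hm₂00, hm₂10⟩ := μ₂_zero_eq (t := t) hσ hu hJ hk' 0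
  obtain ⟨hm₁01, hm₁11⟩ := μ₁_one_eq (t := t) hσ hu hR hk' 0
  obtain ⟨hm₁00, hm₁10⟩ := μ₁_zero_eq (t := t) hσ hu hR hk 0
  rw [hk] at hm₂00 hm₂10 hm₁01 hm₁11
  have hdet : (μ₁ σ (u t) k 0).det = 1 := by
    rw [Matrix.det_fin_two, hm₁00, hm₁01, hm₁10, hm₁11, ← hR.normSq_sub_normSq t l 0]
    linear_combination (-(σ * c t l 0 * conj (c t l 0))) * hk
  have hS : S σ (u t) k = (μ₁ σ (u t) k 0).adjugate * μ₂ σ (u t) k 0 := by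
    rw [S, Matrix.inv_def, hdet, Ring.inverse_one, one_smul]
  have hb : S σ (u t) k 1 0 = k * wronskianB σ f g c d t l := by
    simp only [hS, Matrix.adjugate_fin_two, Matrix.mul_apply, Fin.sum_univ_two, Matrix.of_apply,
      Matrix.cons_val_zero, Matrix.cons_val_one, Matrix.cons_val', Matrix.cons_val_fin_one,
      hm₂00, hm₂10, hm₁00, hm₁10, wronskianB]
    ring
  have ha : S σ (u t) k 0 0 = wronskianA f g c d t l := by
    simp only [hS, Matrix.adjugate_fin_two, Matrix.mul_apply, Fin.sum_univ_two, Matrix.of_apply,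
      Matrix.cons_val_zero, Matrix.cons_val_one, Matrix.cons_val', Matrix.cons_val_fin_one,
      hm₂00, hm₂10, hm₁01, hm₁11, wronskianA]
    linear_combination (-(c t l 0 * g t l 0)) * hk
  rw [r, hb, ha]

end JostColumn

section Gluing

/-- The function `φ` is continuous on the closed upper half plane, holomorphic in the open one, and
tends to `b` at infinity. -/
structure HolomorphicWithLimit (φ : ℂ → ℂ) (b : ℂ) : Prop where
  diffContOnCl : DiffContOnCl ℂ φ {z | 0 < z.im}
  tendsto : Tendsto φ (cocompact ℂ ⊓ 𝓟 {z | 0 ≤ z.im}) (𝓝 b)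

namespace HolomorphicWithLimit

variable {φ ψ : ℂ → ℂ} {b b' : ℂ}

theorem const_mul (w : ℂ) (hφ : HolomorphicWithLimit φ b) :
    HolomorphicWithLimit (fun z => w * φ z) (w * b) :=
  ⟨hφ.diffContOnCl.const_smul w, hφ.tendsto.const_mul w⟩

theorem div (hφ : HolomorphicWithLimit φ b) (hψ : HolomorphicWithLimit ψ b')
    (h0 : ∀ z : ℂ, 0 ≤ z.im → ψ z ≠ 0) (hb' : b' ≠ 0) :
    HolomorphicWithLimit (fun z => φ z / ψ z) (b / b') where
  diffContOnCl := by
    simpa only [div_eq_mul_inv] using! hφ.diffContOnCl.smul <| hψ.diffContOnCl.inv fun z hz => by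
      rw [closure_setOfPred_lt_im] at hz
      exact h0 z hz
  tendsto := hφ.tendsto.div hψ.tendsto hb'

theorem continuousWithinAt (hφ : HolomorphicWithLimit φ b) (l : ℝ) :
    ContinuousWithinAt φ {z | 0 ≤ z.im} l := by
  have h := hφ.diffContOnCl.continuousOn
  rw [closure_setOfPred_lt_im] at h
  exact h l (by simp)

end HolomorphicWithLimit

/-- The function equal to `φ` in the upper half plane and to the Schwarz reflection of `ψ` in the
lower half plane. -/
def glue (φ ψ : ℂ → ℂ) (z : ℂ) : ℂ := if 0 < z.im then φ z else conj (ψ (conj z))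

variable {φ ψ : ℂ → ℂ} {b b' : ℂ}

theorem eqOn_glue_upper (φ ψ : ℂ → ℂ) : Set.EqOn (glue φ ψ) φ {z | 0 < z.im} := fun _ hz =>
  if_pos hz

theorem eqOn_glue_lower (φ ψ : ℂ → ℂ) :
    Set.EqOn (glue φ ψ) (fun z => conj (ψ (conj z))) {z | z.im < 0} := fun _ hz =>
  if_neg (le_of_lt hz).not_gt

theorem differentiableOn_glue (hφ : DifferentiableOn ℂ φ {z | 0 < z.im})
    (hψ : DifferentiableOn ℂ ψ {z | 0 < z.im}) :
    DifferentiableOn ℂ (glue φ ψ) {z | z.im ≠ 0} := fun z hz => by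
  have hopen : IsOpen {z : ℂ | 0 < z.im} := isOpen_lt continuous_const continuous_im
  rcases lt_or_gt_of_ne (show z.im ≠ 0 from hz) with hneg | hpos
  · have hψz : DifferentiableAt ℂ ψ (conj z) :=
      hψ.differentiableAt (hopen.mem_nhds (by simpa using hneg))
    have hreflect := hψz.conj_conj
    rw [Complex.conj_conj] at hreflect
    exact (hreflect.congr_of_eventuallyEq <| (eqOn_glue_lower φ ψ).eventuallyEq_of_mem <|
      (isOpen_lt continuous_im continuous_const).mem_nhds hneg).differentiableWithinAt
  · exact ((hφ.differentiableAt (hopen.mem_nhds hpos)).congr_of_eventuallyEq <|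
      (eqOn_glue_upper φ ψ).eventuallyEq_of_mem (hopen.mem_nhds hpos)).differentiableWithinAt

theorem setOf_im_pos_subset : {z : ℂ | 0 < z.im} ⊆ {z | 0 ≤ z.im} :=
  fun z (hz : 0 < z.im) => hz.le

theorem tendsto_glue_upper {l : ℝ} (hφ : ContinuousWithinAt φ {z | 0 ≤ z.im} l) :
    Tendsto (glue φ ψ) (𝓝[{z | 0 < z.im}] l) (𝓝 (φ l)) :=
  (hφ.mono setOf_im_pos_subset).tendsto.congr'
    ((eqOn_glue_upper φ ψ).symm.eventuallyEq_of_mem self_mem_nhdsWithin)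

theorem tendsto_glue_lower {l : ℝ} (hψ : ContinuousWithinAt ψ {z | 0 ≤ z.im} l) :
    Tendsto (glue φ ψ) (𝓝[{z | z.im < 0}] l) (𝓝 (conj (ψ l))) := by
  have hconj : Tendsto (conj : ℂ → ℂ) (𝓝[{z | z.im < 0}] (l : ℂ)) (𝓝[{z | 0 ≤ z.im}] (l : ℂ)) := by
    have hmaps : Set.MapsTo (conj : ℂ → ℂ) {z | z.im < 0} {z | 0 ≤ z.im} :=
      fun z (hz : z.im < 0) => by simpa using hz.le
    simpa only [Complex.conj_ofReal] using
      Complex.continuous_conj.continuousWithinAt.tendsto_nhdsWithin (x := (l : ℂ)) hmaps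
  exact ((Complex.continuous_conj.tendsto _).comp (hψ.tendsto.comp hconj)).congr'
    ((eqOn_glue_lower φ ψ).symm.eventuallyEq_of_mem self_mem_nhdsWithin)

theorem tendsto_glue_cocompact (hφ : Tendsto φ (cocompact ℂ ⊓ 𝓟 {z | 0 ≤ z.im}) (𝓝 b))
    (hψ : Tendsto ψ (cocompact ℂ ⊓ 𝓟 {z | 0 ≤ z.im}) (𝓝 (conj b))) :
    Tendsto (glue φ ψ) (cocompact ℂ ⊓ 𝓟 {z | z.im ≠ 0}) (𝓝 b) := by
  have hsplit : {z : ℂ | z.im ≠ 0} = {z | 0 < z.im} ∪ {z | z.im < 0} := by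
    ext z
    exact ne_iff_lt_or_gt.trans or_comm
  rw [hsplit, ← sup_principal, inf_sup_left]
  refine tendsto_sup.2 ⟨?_, ?_⟩
  · refine (hφ.mono_left (inf_le_inf_left _ (principal_mono.2 setOf_im_pos_subset))).congr' ?_
    exact (eqOn_glue_upper φ ψ).symm.eventuallyEq_of_mem (mem_inf_of_right (mem_principal_self _))
  · have hconj : Tendsto (conj : ℂ → ℂ) (cocompact ℂ ⊓ 𝓟 {z | z.im < 0})
        (cocompact ℂ ⊓ 𝓟 {z | 0 ≤ z.im}) :=
      Complex.conjCLE.toHomeomorph.isClosedEmbedding.tendsto_cocompact.inf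
        (tendsto_principal_principal.2 fun z (hz : z.im < 0) => by simpa using hz.le)
    have hreflect := (Complex.continuous_conj.tendsto _).comp (hψ.comp hconj)
    rw [Complex.conj_conj] at hreflect
    exact hreflect.congr'
      ((eqOn_glue_lower φ ψ).symm.eventuallyEq_of_mem (mem_inf_of_right (mem_principal_self _)))

/-- Entrywise `glue` for matrix functions. -/
def glueMatrix (U W : ℂ → Matrix (Fin 2) (Fin 2) ℂ) (z : ℂ) : Matrix (Fin 2) (Fin 2) ℂ :=
  .of fun i j => glue (fun w => U w i j) (fun w => W w i j) z

theorem isRHSolution_mul_glueMatrix {σ : ℝ} {ρ : ℝ → ℂ} {x t : ℝ}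
    {U W : ℂ → Matrix (Fin 2) (Fin 2) ℂ} {L P : Matrix (Fin 2) (Fin 2) ℂ} (hPL : P * L = 1)
    (hU : ∀ i j, HolomorphicWithLimit (fun z => U z i j) (L i j))
    (hW : ∀ i j, HolomorphicWithLimit (fun z => W z i j) (conj (L i j)))
    (hjump : ∀ l : ℝ, U l = (W l).map conj * conjExp (-I * (l * x + 2 * l ^ 2 * t)) (JN σ ρ l)) :
    IsRHSolution σ ρ x t fun z => P * glueMatrix U W z := by
  have tendsto_mul {F : Filter ℂ} {A : Matrix (Fin 2) (Fin 2) ℂ}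
      (h : ∀ i j, Tendsto (glue (fun z => U z i j) fun z => W z i j) F (𝓝 (A i j))) :
      Tendsto (fun z => P * glueMatrix U W z) F (𝓝 (P * A)) :=
    tendsto_const_nhds.mul (tendsto_pi_nhds.2 fun i => tendsto_pi_nhds.2 (h i))
  refine ⟨fun i j => ?_, fun l => ⟨P * U l, P * (W l).map conj, ?_, ?_, ?_⟩, ?_⟩
  · have hglue (i : Fin 2) := differentiableOn_glue (hU i j).diffContOnCl.differentiableOn
      (hW i j).diffContOnCl.differentiableOn
    simp only [Matrix.mul_apply, Fin.sum_univ_two]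
    exact ((hglue 0).const_mul _).add ((hglue 1).const_mul _)
  · exact tendsto_mul fun i j => tendsto_glue_upper ((hU i j).continuousWithinAt l)
  · exact tendsto_mul fun i j => tendsto_glue_lower ((hW i j).continuousWithinAt l)
  · rw [hjump l, Matrix.mul_assoc]
  · rw [← hPL]
    exact tendsto_mul fun i j => tendsto_glue_cocompact (hU i j).tendsto (hW i j).tendsto

end Gluing

theorem conjExp_JN (σ : ℝ) (ρ : ℝ → ℂ) (l : ℝ) (w : ℂ) :
    conjExp w (JN σ ρ l) = !![1 - σ * l * (conj (ρ l) * ρ l), -σ * conj (ρ l) * exp (2 * w);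
      l * ρ l * exp (-2 * w), 1] := by
  have hinv : exp w * exp (-w) = 1 := by rw [← Complex.exp_add, add_neg_cancel, Complex.exp_zero]
  rw [neg_mul 2 w, two_mul, neg_add, Complex.exp_add, Complex.exp_add, Complex.conj_mul']
  ext i j
  fin_cases i <;> fin_cases j <;> simp [conjExp, JN, pauli, Matrix.mul_apply]
  · linear_combination (1 - σ * l * (‖ρ l‖ : ℂ) ^ 2) * hinv
  · ring
  · ring
  · linear_combination hinv

section RHSolution

variable {σ : ℝ} {Q : ℝ → ℝ → ℂ} {f g h c d e : ℝ → ℂ → ℝ → ℂ} {t : ℝ}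

/-- The matrix of the first Jost column at `-∞`, divided by `a`, and the second Jost column at `+∞`,
conjugated by `diag (1, k)` so that it depends on `z = k²` only. -/
def upperJost (f g c d : ℝ → ℂ → ℝ → ℂ) (t x : ℝ) (z : ℂ) : Matrix (Fin 2) (Fin 2) ℂ :=
  !![f t z x / wronskianA f g c d t z, c t z x;
    z * (g t z x / wronskianA f g c d t z), d t z x]

/-- The Schwarz reflection of the matrix in the lower half plane corresponding to `upperJost`: its
columns come from the other two Jost columns, which are reflections of the ones in `upperJost`. -/
def lowerJost (σ : ℝ) (f g c d : ℝ → ℂ → ℝ → ℂ) (t x : ℝ) (z : ℂ) : Matrix (Fin 2) (Fin 2) ℂ :=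
  !![d t z x, σ * (g t z x / wronskianA f g c d t z);
    σ * (z * c t z x), f t z x / wronskianA f g c d t z]

/-- The solution of the Riemann–Hilbert problem. The left factor makes the limit at infinity, which
is lower triangular for `upperJost` and `lowerJost`, the identity. -/
def rhSolution (σ : ℝ) (Q : ℝ → ℝ → ℂ) (f g c d : ℝ → ℂ → ℝ → ℂ) (t x : ℝ) (z : ℂ) :
    Matrix (Fin 2) (Fin 2) ℂ :=
  Matrix.transvection 1 0 (-(I / 2 * (σ * conj (Q t x)))) *
    glueMatrix (upperJost f g c d t x) (lowerJost σ f g c d t x) z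

theorem holomorphicWithLimit_wronskianA (hJ : IsJost σ Q f g h) (hR : IsRightJost σ Q c d e)
    (t : ℝ) : HolomorphicWithLimit (wronskianA f g c d t) 1 :=
  ⟨⟨differentiableOn_wronskianA hJ hR t, (continuous_wronskianA hJ hR t).continuousOn⟩,
    tendsto_wronskianA hJ hR t⟩

namespace IsJost

variable (hJ : IsJost σ Q f g h)
include hJ

theorem holomorphicWithLimit_f (t x : ℝ) : HolomorphicWithLimit (fun z => f t z x) 1 :=
  ⟨⟨hJ.hol_f t x, (hJ.cont_f.comp (by fun_prop :
    Continuous fun z : ℂ => (((t, z), x) : (ℝ × ℂ) × ℝ))).continuousOn⟩, hJ.tendsto_f t x⟩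

theorem holomorphicWithLimit_g (t x : ℝ) : HolomorphicWithLimit (fun z => g t z x) 0 :=
  ⟨⟨hJ.hol_g t x, (hJ.cont_g.comp (by fun_prop :
    Continuous fun z : ℂ => (((t, z), x) : (ℝ × ℂ) × ℝ))).continuousOn⟩,
    tendsto_zero_of_tendsto_mul inf_le_left (hJ.tendsto_mul_g t x)⟩

theorem holomorphicWithLimit_mul_g (t x : ℝ) :
    HolomorphicWithLimit (fun z => z * g t z x) (I / 2 * (σ * conj (Q t x))) where
  diffContOnCl := differentiable_id.diffContOnCl.smul (hJ.holomorphicWithLimit_g t x).diffContOnCl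
  tendsto := by
    have hlim := (hJ.tendsto_mul_g t x).const_mul (2 * I)⁻¹
    simp only [inv_mul_cancel_left₀ (mul_ne_zero two_ne_zero Complex.I_ne_zero)] at hlim
    convert hlim using 2
    rw [mul_inv, Complex.inv_I]
    ring

end IsJost

namespace IsRightJost

variable (hR : IsRightJost σ Q c d e)
include hR

theorem holomorphicWithLimit_d (t x : ℝ) : HolomorphicWithLimit (fun z => d t z x) 1 :=
  ⟨⟨hR.hol_d t x, (hR.cont_d.comp (by fun_prop :
    Continuous fun z : ℂ => (((t, z), x) : (ℝ × ℂ) × ℝ))).continuousOn⟩, hR.tendsto_d t x⟩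

theorem holomorphicWithLimit_c (t x : ℝ) : HolomorphicWithLimit (fun z => c t z x) 0 :=
  ⟨⟨hR.hol_c t x, (hR.cont_c.comp (by fun_prop :
    Continuous fun z : ℂ => (((t, z), x) : (ℝ × ℂ) × ℝ))).continuousOn⟩,
    tendsto_zero_of_tendsto_mul inf_le_left (hR.tendsto_mul_c t x)⟩

theorem holomorphicWithLimit_mul_c (t x : ℝ) :
    HolomorphicWithLimit (fun z => z * c t z x) (-(I / 2) * Q t x) where
  diffContOnCl := differentiable_id.diffContOnCl.smul (hR.holomorphicWithLimit_c t x).diffContOnCl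
  tendsto := by
    have hlim := (hR.tendsto_mul_c t x).const_mul (2 * I)⁻¹
    simp only [inv_mul_cancel_left₀ (mul_ne_zero two_ne_zero Complex.I_ne_zero)] at hlim
    convert hlim using 2
    rw [mul_inv, Complex.inv_I]
    ring

end IsRightJost

theorem holomorphicWithLimit_upperJost (hJ : IsJost σ Q f g h) (hR : IsRightJost σ Q c d e)
    (hA : ∀ z : ℂ, 0 ≤ z.im → wronskianA f g c d t z ≠ 0) (x : ℝ) (i j : Fin 2) :
    HolomorphicWithLimit (fun z => upperJost f g c d t x z i j)
      (Matrix.transvection 1 0 (I / 2 * (σ * conj (Q t x))) i j) := by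
  have hWronskian := holomorphicWithLimit_wronskianA hJ hR t
  fin_cases i <;> fin_cases j
  · simpa [Matrix.transvection] using!
      (hJ.holomorphicWithLimit_f t x).div hWronskian hA one_ne_zero
  · simpa [Matrix.transvection] using! hR.holomorphicWithLimit_c t x
  · simpa [Matrix.transvection, upperJost, mul_div_assoc] using
      (hJ.holomorphicWithLimit_mul_g t x).div hWronskian hA one_ne_zero
  · simpa [Matrix.transvection] using! hR.holomorphicWithLimit_d t x

theorem holomorphicWithLimit_lowerJost (hJ : IsJost σ Q f g h) (hR : IsRightJost σ Q c d e)
    (hA : ∀ z : ℂ, 0 ≤ z.im → wronskianA f g c d t z ≠ 0) (x : ℝ) (i j : Fin 2) :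
    HolomorphicWithLimit (fun z => lowerJost σ f g c d t x z i j)
      (conj (Matrix.transvection 1 0 (I / 2 * (σ * conj (Q t x))) i j)) := by
  have hWronskian := holomorphicWithLimit_wronskianA hJ hR t
  fin_cases i <;> fin_cases j
  · simpa [Matrix.transvection] using! hR.holomorphicWithLimit_d t x
  · simpa [Matrix.transvection] using!
      ((hJ.holomorphicWithLimit_g t x).div hWronskian hA one_ne_zero).const_mul σ
  · simpa [Matrix.transvection, lowerJost, mul_left_comm (σ : ℂ), map_ofNat, neg_div] using
      (hR.holomorphicWithLimit_mul_c t x).const_mul σ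
  · simpa [Matrix.transvection] using!
      (hJ.holomorphicWithLimit_f t x).div hWronskian hA one_ne_zero

theorem upperJost_eq_lowerJost_mul (hσ : |σ| = 1) (hJ : IsJost σ Q f g h)
    (hR : IsRightJost σ Q c d e) {ρ : ℝ → ℂ} {l : ℝ} (hA : wronskianA f g c d t l ≠ 0)
    (hρ : wronskianB σ f g c d t l = exp (4 * I * l ^ 2 * t) * (ρ l * wronskianA f g c d t l))
    (x : ℝ) :
    upperJost f g c d t x l = (lowerJost σ f g c d t x l).map conj *
      conjExp (-I * (l * x + 2 * l ^ 2 * t)) (JN σ ρ l) := by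
  have hσσ := ofReal_mul_self_of_abs_eq_one hσ
  set E := exp (-2 * (-I * (l * x + 2 * l ^ 2 * t))) with hE
  have hconjE : exp (2 * (-I * (l * x + 2 * l ^ 2 * t))) = conj E := by
    rw [hE, ← Complex.exp_conj]
    simp [map_ofNat]
  have hEE : E * conj E = 1 := by
    rw [← hconjE, hE, ← Complex.exp_add, neg_mul, neg_add_cancel, Complex.exp_zero]
  have hB : wronskianB σ f g c d t l * exp (2 * I * l * x) =
      E * (ρ l * wronskianA f g c d t l) := by
    rw [hρ, mul_right_comm, ← Complex.exp_add, hE]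
    ring_nf
  have hf : f t l x / wronskianA f g c d t l = conj (d t l x) + l * (E * ρ l) * c t l x := by
    rw [div_eq_iff hA, jost_first_eq hJ hR t l x]
    linear_combination (l * c t l x) * hB
  have hg : g t l x / wronskianA f g c d t l = σ * conj (c t l x) + E * ρ l * d t l x := by
    rw [div_eq_iff hA, jost_second_eq hJ hR t l x]
    linear_combination (d t l x) * hB
  rw [conjExp_JN, hconjE, ← hE, upperJost, lowerJost, hf, hg]
  ext i j
  fin_cases i <;> fin_cases j <;>
    simp only [Matrix.mul_apply, Fin.sum_univ_two, Matrix.map_apply, Matrix.of_apply,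
      Matrix.cons_val', Matrix.cons_val_zero, Matrix.cons_val_one, Matrix.cons_val_fin_one,
      Fin.zero_eta, Fin.mk_one, map_add, map_mul, Complex.conj_ofReal, Complex.conj_conj]
  · linear_combination (-(l * ρ l * E * c t l x)) * hσσ -
      (conj (d t l x) * σ * l * ρ l * conj (ρ l)) * hEE
  · linear_combination (-c t l x) * hσσ
  · linear_combination (l ^ 2 * conj (c t l x) * ρ l * conj (ρ l)) * (hσσ - hEE)
  · linear_combination (l * conj (c t l x) * conj (ρ l) * conj E) * hσσ

theorem isRHSolution_rhSolution (hσ : |σ| = 1) (hJ : IsJost σ Q f g h)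
    (hR : IsRightJost σ Q c d e) {ρ : ℝ → ℂ}
    (hA : ∀ z : ℂ, 0 ≤ z.im → wronskianA f g c d t z ≠ 0)
    (hρ : ∀ l : ℝ, wronskianB σ f g c d t l =
      exp (4 * I * l ^ 2 * t) * (ρ l * wronskianA f g c d t l)) (x : ℝ) :
    IsRHSolution σ ρ x t (rhSolution σ Q f g c d t x) :=
  isRHSolution_mul_glueMatrix
    (by rw [Matrix.transvection_mul_transvection_same _ _ (by decide), neg_add_cancel,
      Matrix.transvection_zero])
    (holomorphicWithLimit_upperJost hJ hR hA x) (holomorphicWithLimit_lowerJost hJ hR hA x)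
    fun l => upperJost_eq_lowerJost_mul hσ hJ hR (hA l (by simp)) (hρ l) x

theorem tendsto_mul_rhSolution (hσ : |σ| = 1) (hJ : IsJost σ Q f g h)
    (hR : IsRightJost σ Q c d e) (t x : ℝ) :
    Tendsto (fun z => 2 * I * (z * rhSolution σ Q f g c d t x z 0 1))
      (cocompact ℂ ⊓ 𝓟 {z | z.im ≠ 0}) (𝓝 (Q t x)) := by
  have hupper := hR.tendsto_mul_c t x
  have hlower := ((hJ.tendsto_mul_g t x).div (tendsto_wronskianA hJ hR t) one_ne_zero).const_mul
    (-σ : ℂ)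
  rw [div_one, neg_mul_neg, ← mul_assoc, ofReal_mul_self_of_abs_eq_one hσ, one_mul] at hlower
  refine (tendsto_glue_cocompact hupper hlower).congr fun z => ?_
  rw [rhSolution, Matrix.transvection_mul_apply_of_ne _ _ _ _ zero_ne_one]
  simp only [glueMatrix, glue, upperJost, lowerJost, Matrix.of_apply, Matrix.cons_val',
    Matrix.cons_val_zero, Matrix.cons_val_one, Matrix.cons_val_fin_one, Pi.div_apply]
  split_ifs
  · rfl
  · simp only [map_mul, map_neg, map_div₀, Complex.conj_conj, Complex.conj_I, Complex.conj_ofReal,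
      map_ofNat]
    ring

end RHSolution

section Reconstruction

variable {σ T C : ℝ} {u u' u'' : ℝ → ℝ → ℂ} {f g h c d e : ℝ → ℂ → ℝ → ℂ}

/-- The reflection coefficient `r(k) / k` at time `0` as a function of `l = k²`. -/
def reflection (σ : ℝ) (f g c d : ℝ → ℂ → ℝ → ℂ) (l : ℝ) : ℂ :=
  wronskianB σ f g c d 0 l / wronskianA f g c d 0 l

theorem continuous_reflection {Q : ℝ → ℝ → ℂ} (hJ : IsJost σ Q f g h) (hR : IsRightJost σ Q c d e)
    (hA : ∀ z : ℂ, 0 ≤ z.im → wronskianA f g c d 0 z ≠ 0) :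
    Continuous (reflection σ f g c d) :=
  (continuous_wronskianB hJ hR 0).div
    ((continuous_wronskianA hJ hR 0).comp Complex.continuous_ofReal) fun l => hA l (by simp)

theorem PotentialFamily.integrable_norm_sq (hu : PotentialFamily u u' u'' C) (t : ℝ) :
    Integrable fun x => ‖u t x‖ ^ 2 := by
  have hcont := hu.continuous_apply t
  have hdecay := (hu.decay t).mul (hu.decay t)
  refine (hdecay.integrable (hcont.mul hcont).aestronglyMeasurable).norm.congr (ae_of_all _ ?_)
  simp only [norm_mul, sq, implies_true]

theorem two_I_mul_phase_eq (σ : ℝ) (u : ℝ → ℂ) (x : ℝ) :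
    2 * I * phase σ u x = σ * I * ((-∫ y in Set.Ioi x, ‖u y‖ ^ 2 : ℝ) : ℂ) := by
  have hdensity (y : ℝ) : (1 / 2) * u y * (σ * conj (u y)) = (σ / 2) * ((‖u y‖ ^ 2 : ℝ) : ℂ) := by
    rw [Complex.ofReal_pow, ← Complex.mul_conj']
    ring
  rw [phase, funext hdensity, integral_const_mul, integral_complex_ofReal]
  push_cast
  ring

theorem gauge_mul_exp (σ : ℝ) (u : ℝ → ℝ → ℂ) (t x : ℝ) :
    gauge σ u t x * exp (σ * I * ((-∫ y in Set.Ioi x, ‖gauge σ u t y‖ ^ 2 : ℝ) : ℂ)) = u t x := by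
  simp only [norm_gauge]
  rw [← two_I_mul_phase_eq, gauge, mul_assoc, ← Complex.exp_add, neg_mul (2 : ℂ), neg_mul,
    neg_add_cancel, Complex.exp_zero, mul_one]

variable (hσ : |σ| = 1) (hu : PotentialFamily u u' u'' C)
  (hJ : IsJost σ (gauge σ u) f g h) (hR : IsRightJost σ (gauge σ u) c d e)
include hσ hu hJ hR

theorem wronskianA_ne_zero {t : ℝ} (ha : ∀ k : ℂ, 0 ≤ (k ^ 2).im → a σ (u t) k ≠ 0) (z : ℂ)
    (hz : 0 ≤ z.im) : wronskianA f g c d t z ≠ 0 := by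
  obtain ⟨k, rfl⟩ := IsAlgClosed.exists_pow_nat_eq z two_pos
  rw [← a_eq_wronskianA hσ hu hJ hR hz]
  exact ha k hz

theorem reflection_eq {k : ℂ} {l : ℝ} (hk0 : k ≠ 0) (hk : k ^ 2 = l) :
    reflection σ f g c d l = r σ (u 0) k / k := by
  rw [r_eq_wronskianB_div hσ hu hJ hR hk, mul_div_assoc, mul_div_cancel_left₀ _ hk0, reflection]

theorem isRHSolution_reflection (hut : IsFluxSolution σ T u u' u'')
    (hA : ∀ z : ℂ, 0 ≤ z.im → wronskianA f g c d 0 z ≠ 0) {t : ℝ} (ht : t ∈ Set.Icc 0 T) (x : ℝ) :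
    IsRHSolution σ (reflection σ f g c d) x t (rhSolution σ (gauge σ u) f g c d t x) := by
  have hAt (z : ℂ) (hz : 0 ≤ z.im) := wronskianA_evolution hσ hu hut hJ hR ht hz
  refine isRHSolution_rhSolution hσ hJ hR (fun z hz => hAt z hz ▸ hA z hz) (fun l => ?_) x
  have hl : 0 ≤ (l : ℂ).im := by simp
  rw [hAt l hl, reflection, div_mul_cancel₀ _ (hA l hl),
    wronskianB_evolution hσ hu hut hJ hR ht l]

theorem tendsto_mul_of_isRHSolution (hut : IsFluxSolution σ T u u' u'')
    (hA : ∀ z : ℂ, 0 ≤ z.im → wronskianA f g c d 0 z ≠ 0) {t : ℝ} (ht : t ∈ Set.Icc 0 T) {x : ℝ}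
    {N : ℂ → Matrix (Fin 2) (Fin 2) ℂ} (hN : IsRHSolution σ (reflection σ f g c d) x t N) :
    Tendsto (fun z : ℂ => 2 * I * (z * N z 0 1)) (cocompact ℂ ⊓ 𝓟 {z | z.im ≠ 0})
      (𝓝 (gauge σ u t x)) := by
  refine (tendsto_mul_rhSolution hσ hJ hR t x).congr' ?_
  filter_upwards [mem_inf_of_right (mem_principal_self _)] with z hz
  rw [(isRHSolution_reflection hσ hu hJ hR hut hA ht x).unique hN hz]

end Reconstruction

end DNLS

end

theorem mainTheorem2 (σ : ℝ) (hσ : σ = 1 ∨ σ = -1) (T : ℝ) (hT : 0 < T)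
    (q₀ : ℝ → ℂ) (q : ℝ → ℝ → ℂ) (hq : DNLS.IsSolution σ T q₀ q)
    (ha : ∀ k : ℂ, 0 ≤ (k ^ 2).im → DNLS.a σ q₀ k ≠ 0) :
    ∃ ρ : ℝ → ℂ, Continuous ρ ∧
      (∀ (k : ℂ) (l : ℝ), k ≠ 0 → k ^ 2 = (l : ℂ) → ρ l = DNLS.r σ q₀ k / k) ∧
      ∃ qt : ℝ → ℝ → ℂ, ∀ t ∈ Set.Icc 0 T, ∀ x : ℝ,
        (∃ N, DNLS.IsRHSolution σ ρ x t N) ∧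
        (∀ N N', DNLS.IsRHSolution σ ρ x t N → DNLS.IsRHSolution σ ρ x t N' →
          ∀ z : ℂ, z.im ≠ 0 → N z = N' z) ∧
        (∀ N, DNLS.IsRHSolution σ ρ x t N →
          Tendsto (fun z : ℂ => 2 * I * (z * N z 0 1))
            (cocompact ℂ ⊓ 𝓟 {z | z.im ≠ 0}) (𝓝 (qt x t))) ∧
        IntegrableOn (fun y => ‖qt y t‖ ^ 2) (Set.Ioi x) ∧
        q x t = qt x t *
          exp (σ * I * ((-∫ y in Set.Ioi x, ‖qt y t‖ ^ 2 : ℝ) : ℂ)) := by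
  have hσ : |σ| = 1 := (abs_eq zero_le_one).2 hσ
  obtain ⟨u, u', u'', C, hu, huq, hut⟩ := hq.exists_potentialFamily hT.le
  have hq₀ : q₀ = u 0 :=
    funext fun x => ((huq 0 (Set.left_mem_Icc.2 hT.le) x).trans (hq.initial x)).symm
  obtain ⟨f, g, h, hJ⟩ := DNLS.exists_isJost hσ (hu.gauge hσ)
  obtain ⟨c, d, e, hR⟩ := DNLS.exists_isRightJost hσ (hu.gauge hσ)
  have hA := DNLS.wronskianA_ne_zero hσ hu hJ hR (t := 0) (hq₀ ▸ ha)
  refine ⟨DNLS.reflection σ f g c d, DNLS.continuous_reflection hJ hR hA,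
    fun k l hk0 hk => hq₀ ▸ DNLS.reflection_eq hσ hu hJ hR hk0 hk,
    fun x t => DNLS.gauge σ u t x, fun t ht x =>
    ⟨?existence, ?uniqueness, ?limit, ?integrability, ?reconstruction⟩⟩
  case existence => exact ⟨_, DNLS.isRHSolution_reflection hσ hu hJ hR hut hA ht x⟩
  case uniqueness => exact fun N N' hN hN' z hz => hN.unique hN' hz
  case limit => exact fun N => DNLS.tendsto_mul_of_isRHSolution hσ hu hJ hR hut hA ht
  case integrability => exact ((hu.gauge hσ).integrable_norm_sq t).integrableOn
  case reconstruction => rw [DNLS.gauge_mul_exp, huq t ht x]
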